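/- **Setting.** Let $\mathscr A$ be a $\mathbb Q$-linear abelian category with an additive exact autoequivalence $V\mapsto V(1)$, with iterates $(m)$, $m\in\mathbb Z$. Let $\mathscr{AF}$ be the category of pairs $\mathbb V=(V,F)$, where $F$ is a finite increasing filtration of $V\in\mathscr A$ indexed by $\mathbb Z$, with the arrows that respect the filtrations. Put $V_p=F_pV/F_{p-1}V$, $V_{\ge p}=V/F_{p-1}V$ and $\mathbb V[n](m)=(V(m),F[n])$ with $F[n]_p=F_{n+p}$. An arrow $l:\mathbb V\to\mathbb W[n](m)$ induces $l_p:V_p\to W_{n+p}(m)$. Let $r\ge 0$, let $\mathbb V$ be of type $[-r,r]$ (that is, $V_p=0$ for $|p|>r$), and let $e:\mathbb V\to\mathbb V[2](1)$ be an arrow of $\mathscr{AF}$ satisfying condition HL: $e^k:V_{-k}\to V_k(k)$ is an isomorphism for all $k\ge 0$. Let $\mathbb V_*=\bigoplus_{p\in[-r,r]}V_p$, with $V_p$ placed in position $p$. **Splittings.** A splitting is an isomorphism $\varphi:\mathbb V_*\cong\mathbb V$ in $\mathscr{AF}$. It is *good* if it induces the identity on every $V_p$. Let $\tilde e(\varphi)=\varphi^{-1}\circ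 e\circ\varphi:V_*\to V_*(1)$; for $d\in\mathbb Z$ its degree-$d$ part $\tilde e(\varphi)^{\{d\}}$ is the sum of its components $V_p\to V_{p+d}(1)$. The splitting $\varphi$ is *$e$-good* if it is good and $\tilde e(\varphi)=\tilde e(\varphi)^{\{2\}}$. **The five splittings.** * $\omega_{\rm I}(e)$ is defined by recursion on $r$. If $r=0$ it is the identity $V_0=V$. If $r\ge1$, put $l=e^r$, let $i:V_{-r}\to V$ and $p:V\to V_r$ be the first inclusion and the last quotient, let $s=l\,i\,l_{-r}^{-1}:V_r\to V$ and $$\rho=(l_{-r}^{-1}\,p\,l-l_{-r}^{-1}\,p\,l\,s\,p,\;p):V\to V_{-r}\oplus V_r ,$$ let $\iota:K=\operatorname{Ker}\rho\to V$ be the inclusion, and give $K$ the filtration induced by $F$. Then $w=i+\iota+s:V_{-r}\oplus K\oplus V_r\to V$ is an isomorphism, $\iota$ induces $K_p\cong V_p$ for $|p|<r$, and the $K$-component $e'$ of $w^{-1}ew$ satisfies HL on $K$, which is of type $[-r+1,r-1]$. The splitting $\omega_{\rm I}(e)$ is $i$ on $V_{-r}$, $s$ on $V_r$, and $\iota\circ\omega_{\rm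 I}(e')$ on $V_p\cong K_p$ for $|p|<r$. * $\phi_{\rm I}(e)$: for $i\ge0$ let $P_{-i}=\operatorname{Ker}(e^{i+1}:V_{-i}\to V_{i+2}(i+1))$, placed in position $-i$. There is a unique arrow $f_i:P_{-i}\to\mathbb V$ in $\mathscr{AF}$ that lifts the natural arrow $P_{-i}\to V_{\ge -i}$ and for which the composition of $e^s\circ f_i$ with $V(s)\to V_{\ge s}(s)$ is zero for every $s>i$. By the primitive Lefschetz decomposition $\bigoplus_{0\le j\le i}P_{-i}(-j)\cong V_*$, in which $P_{-i}(-j)$ is mapped to $V_{-i+2j}$ by $e^j$, the splitting $\phi_{\rm I}(e)$ is defined to be $e^j\circ f_i$ on the summand $P_{-i}(-j)$. * $\omega_{\rm II}(e)=(\omega_{\rm I}(e^o)^o)^{-1}$ and $\phi_{\rm II}(e)=(\phi_{\rm I}(e^o)^o)^{-1}$, where $e^o:\mathbb V^o\to\mathbb V^o[2](1)$ is the opposite arrow in the filtered category of $\mathscr A^o$; here $F_iV^o=(V_{\ge -i})^o$ and the shift of $\mathscr A^o$ is $V^o(m)=(V(-m))^o$. * $\phi_{\rm III}(e)$ is the unique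 good splitting $\varphi$ such that $(\operatorname{ad}\bar e)^{1-d}\big(\tilde e(\varphi)^{\{d\}}\big)=0$ for every integer $d\le1$, where $\bar e=\sum_pe_p:V_*\to V_*(1)$ and $\operatorname{ad}\bar e(u)=\bar e\circ u-u\circ\bar e$. **Proposition.** Suppose that an $e$-good splitting of $\mathbb V$ exists. Then it is unique and it coincides with $\phi_{\rm III}(e)$. Moreover, in this case, $$\omega_{\rm I}(e)=\omega_{\rm II}(e)=\phi_{\rm I}(e)=\phi_{\rm II}(e)=\phi_{\rm III}(e).$$ -/

import Mathlib

open CategoryTheory CategoryTheory.Limits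

universe v u

noncomputable section

open scoped CategoryTheory.Pretriangulated.Opposite

attribute [local instance] Abelian.hasFiniteBiproducts

/-- An object of the filtered category of an abelian category `C`: an object `X` of `C` with a
finite increasing filtration `F` by subobjects, indexed by `ℤ`. -/
structure FiltObj (C : Type u) [Category.{v} C] [Abelian C] where
  X : C
  F : ℤ → Subobject X
  mono : ∀ ⦃p q : ℤ⦄, p ≤ q → F p ≤ F q
  exists_bot : ∃ a, F a = ⊥
  exists_top : ∃ b, F b = ⊤

namespace FiltObj

section Basic

variable {C : Type u} [Category.{v} C] [Abelian C]

/-- Filtered arrows: arrows of `C` mapping `F_p V` to `F_p W` for every `p`. -/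
@[ext]
structure Hom (V W : FiltObj C) where
  f : V.X ⟶ W.X
  factors : ∀ p, (W.F p).Factors ((V.F p).arrow ≫ f)

instance : Category (FiltObj C) where
  Hom := Hom
  id V := ⟨𝟙 V.X, fun p => by simpa using (V.F p).factors_self⟩
  comp {U V W} g h := ⟨g.f ≫ h.f, fun p => by
    rw [← Category.assoc, ← Subobject.factorThru_arrow _ _ (g.factors p), Category.assoc]
    exact Subobject.factors_of_factors_right _ (h.factors p)⟩
  id_comp f := Hom.ext (Category.id_comp f.f)
  comp_id f := Hom.ext (Category.comp_id f.f)
  assoc f g h := Hom.ext (Category.assoc f.f g.f h.f)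

/-- The graded piece `V_p = F_p V / F_{p-1} V`. -/
abbrev gr (V : FiltObj C) (p : ℤ) : C :=
  cokernel (Subobject.ofLE (V.F (p - 1)) (V.F p) (V.mono (by lia)))

/-- The projection `F_p V ⟶ V_p`. -/
def grπ (V : FiltObj C) (p : ℤ) : (V.F p : C) ⟶ V.gr p :=
  cokernel.π (Subobject.ofLE (V.F (p - 1)) (V.F p) (V.mono (by lia)))

/-- `V_{≥ p} = V / F_{p-1} V`. -/
abbrev quot (V : FiltObj C) (p : ℤ) : C := cokernel (V.F (p - 1)).arrow

/-- The projection `V ⟶ V_{≥ p}`. -/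
def toQuot (V : FiltObj C) (p : ℤ) : V.X ⟶ V.quot p := cokernel.π (V.F (p - 1)).arrow

instance (V : FiltObj C) (p : ℤ) : Epi (V.grπ p) :=
  inferInstanceAs (Epi (cokernel.π _))

instance (V : FiltObj C) (p : ℤ) : Epi (V.toQuot p) :=
  inferInstanceAs (Epi (cokernel.π _))

/-- The natural monomorphism `V_p ⟶ V_{≥ p}`. -/
def grToQuot (V : FiltObj C) (p : ℤ) : V.gr p ⟶ V.quot p :=
  cokernel.desc _ ((V.F p).arrow ≫ V.toQuot p) (by
    rw [← Category.assoc, Subobject.ofLE_arrow]; exact cokernel.condition _)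

/-- `V` has type `[a, b]`: `V_p = 0` for every `p ∉ [a, b]`. -/
def HasType (V : FiltObj C) (a b : ℤ) : Prop := ∀ p, ¬ (a ≤ p ∧ p ≤ b) → IsZero (V.gr p)

/-- The arrow `V_p ⟶ W_p` induced by a filtered arrow `V ⟶ W`. -/
def Hom.gr {V W : FiltObj C} (l : V ⟶ W) (p : ℤ) : V.gr p ⟶ W.gr p :=
  cokernel.desc _ ((W.F p).factorThru _ (l.factors p) ≫ W.grπ p) (by
    have h1 : Subobject.ofLE (V.F (p - 1)) (V.F p) (V.mono (by lia)) ≫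
        (W.F p).factorThru _ (l.factors p) = (W.F (p - 1)).factorThru _ (l.factors (p - 1)) ≫
          Subobject.ofLE (W.F (p - 1)) (W.F p) (W.mono (by lia)) := by
      rw [← cancel_mono (W.F p).arrow]
      simp
    rw [← Category.assoc, h1, Category.assoc]
    exact (congrArg _ (cokernel.condition _)).trans comp_zero)

/-- The filtration induced on a subobject `ι : K ⟶ V`, `F_p K = K ∩ F_p V`. -/
abbrev restrict (V : FiltObj C) {K : C} (ι : K ⟶ V.X) [Mono ι] : FiltObj C where
  X := K
  F p := (Subobject.pullback ι).obj (V.F p)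
  mono _ _ h := (Subobject.pullback ι).monotone (V.mono h)
  exists_bot := by
    obtain ⟨a, ha⟩ := V.exists_bot
    refine ⟨a, ?_⟩
    have h : ((Subobject.pullback ι).obj (V.F a)).arrow = 0 := by
      rw [← cancel_mono ι, ← (Subobject.isPullback ι (V.F a)).w, zero_comp]
      have h0 : (V.F a).arrow = 0 :=
        (Subobject.bot_factors_iff_zero _).1 (ha ▸ (V.F a).factors_self)
      rw [h0, comp_zero]
    rw [← Subobject.mk_arrow ((Subobject.pullback ι).obj (V.F a))]
    exact Subobject.mk_eq_bot_iff_zero.2 h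
  exists_top := by
    obtain ⟨b, hb⟩ := V.exists_top
    exact ⟨b, by rw [hb, Subobject.pullback_top]⟩

/-- The inclusion `K ⟶ V` as a filtered arrow. -/
def restrictι (V : FiltObj C) {K : C} (ι : K ⟶ V.X) [Mono ι] : V.restrict ι ⟶ V where
  f := ι
  factors p := by
    have h := (Subobject.isPullback ι (V.F p)).w
    exact (Subobject.factors_iff _ _).2 ⟨_, h⟩

/-- `(X, T[-a])`: the object `X` with the trivial filtration placed in position `a`. -/
abbrev trivialAt (X : C) (a : ℤ) : FiltObj C where
  X := X
  F p := if a ≤ p then ⊤ else ⊥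
  mono p q h := by
    split_ifs with h1 h2
    · exact le_rfl
    · exact absurd (h1.trans h) h2
    · exact bot_le
    · exact le_rfl
  exists_bot := ⟨a - 1, if_neg (by lia)⟩
  exists_top := ⟨a, if_pos le_rfl⟩

/-- The component `V_p ⟶ ⨁_{q ∈ [-r, r]} V_q` (zero if `p ∉ [-r, r]`). -/
def gι (V : FiltObj C) (r : ℕ) (p : ℤ) :
    V.gr p ⟶ ⨁ (fun q : Finset.Icc (-r : ℤ) r => V.gr q) :=
  if h : p ∈ Finset.Icc (-r : ℤ) r then
    biproduct.ι (fun q : Finset.Icc (-r : ℤ) r => V.gr q) ⟨p, h⟩ else 0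

/-- The component `⨁_{q ∈ [-r, r]} V_q ⟶ V_p` (zero if `p ∉ [-r, r]`). -/
def gπ (V : FiltObj C) (r : ℕ) (p : ℤ) :
    (⨁ (fun q : Finset.Icc (-r : ℤ) r => V.gr q)) ⟶ V.gr p :=
  if h : p ∈ Finset.Icc (-r : ℤ) r then
    biproduct.π (fun q : Finset.Icc (-r : ℤ) r => V.gr q) ⟨p, h⟩ else 0

/-- The graded object `V_* = ⨁_{p ∈ [-r, r]} V_p` of an object of type `[-r, r]`, each `V_p` being
placed in position `p`: `F_q V_* = ⨁_{p ≤ q} V_p`. -/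
abbrev graded (V : FiltObj C) (r : ℕ) : FiltObj C where
  X := ⨁ (fun q : Finset.Icc (-r : ℤ) r => V.gr q)
  F q := (Finset.univ.filter (fun p : Finset.Icc (-r : ℤ) r => (p : ℤ) ≤ q)).sup
    (fun p => Subobject.mk (biproduct.ι (fun q : Finset.Icc (-r : ℤ) r => V.gr q) p))
  mono q q' h := Finset.sup_mono (fun p hp => by
    simp only [Finset.mem_filter, Finset.mem_univ, true_and] at hp ⊢; exact hp.trans h)
  exists_bot := ⟨-r - 1, by
    rw [Finset.filter_false_of_mem, Finset.sup_empty]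
    intro p _
    have := Finset.mem_Icc.1 p.2
    lia⟩
  exists_top := ⟨r, by
    set S := (Finset.univ.filter (fun p : Finset.Icc (-r : ℤ) r => (p : ℤ) ≤ r)).sup
      (fun p => Subobject.mk (biproduct.ι (fun q : Finset.Icc (-r : ℤ) r => V.gr q) p))
    have h (p : Finset.Icc (-r : ℤ) r) :
        S.Factors (biproduct.ι (fun q : Finset.Icc (-r : ℤ) r => V.gr q) p) :=
      Subobject.factors_of_le _ (Finset.le_sup (by simpa using (Finset.mem_Icc.1 p.2).2))
        (Subobject.mk_factors_self _)
    rw [eq_top_iff]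
    refine Subobject.le_of_comm ((⊤ : Subobject _).arrow ≫
      biproduct.desc (fun p => S.factorThru _ (h p))) ?_
    rw [Category.assoc]
    conv_rhs => rw [← Category.comp_id (⊤ : Subobject _).arrow]
    congr 1
    ext p
    simp⟩

/-- A splitting `φ : V_* ≅ V` is good if it induces the identity on the graded pieces: its
restriction to `V_p` has values in `F_p V`, and lifts the identity of `V_p`. -/
def IsGood {V : FiltObj C} {r : ℕ} (φ : V.graded r ≅ V) : Prop :=
  ∀ p ∈ Finset.Icc (-r : ℤ) r, ∃ g : V.gr p ⟶ (V.F p : C),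
    g ≫ (V.F p).arrow = V.gι r p ≫ φ.hom.f ∧ g ≫ V.grπ p = 𝟙 (V.gr p)

end Basic


section Opposite

variable {C : Type u} [Category.{v} C] [Abelian C]

/-- The projection `V_{≥ p} ⟶ V_{≥ q}` for `p ≤ q`. -/
def quotMap (V : FiltObj C) {p q : ℤ} (h : p ≤ q) : V.quot p ⟶ V.quot q :=
  cokernel.desc _ (V.toQuot q) (by
    rw [← Subobject.ofLE_arrow (V.mono (by lia : p - 1 ≤ q - 1)), Category.assoc]
    exact (congrArg _ (cokernel.condition _)).trans comp_zero)

lemma toQuot_quotMap (V : FiltObj C) {p q : ℤ} (h : p ≤ q) :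
    V.toQuot p ≫ V.quotMap h = V.toQuot q :=
  cokernel.π_desc _ _ _

lemma grπ_grToQuot (V : FiltObj C) (p : ℤ) :
    V.grπ p ≫ V.grToQuot p = (V.F p).arrow ≫ V.toQuot p :=
  cokernel.π_desc _ _ _

lemma exists_lift_of_toQuot_eq_zero (V : FiltObj C) {T : C} (x : T ⟶ V.X) (p q : ℤ)
    (hq : q = p + 1) (hx : x ≫ V.toQuot q = 0) :
    ∃ y : T ⟶ (V.F p : C), y ≫ (V.F p).arrow = x := by
  obtain rfl : p = q - 1 := by lia
  exact ⟨Abelian.monoLift (V.F (q - 1)).arrow x hx, Abelian.monoLift_comp _ _ _⟩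

lemma arrow_toQuot (V : FiltObj C) (p q : ℤ) (hq : q = p + 1) :
    (V.F p).arrow ≫ V.toQuot q = 0 := by
  obtain rfl : p = q - 1 := by lia
  exact cokernel.condition _

instance (V : FiltObj C) (p : ℤ) : Mono (V.grToQuot p) := by
  refine Preadditive.mono_of_cancel_zero _ (fun {T} k hk => ?_)
  obtain ⟨T', π, hπ, x, hx⟩ := surjective_up_to_refinements_of_epi (V.grπ p) k
  have h : (x ≫ (V.F p).arrow) ≫ V.toQuot p = 0 := by
    rw [Category.assoc, ← grπ_grToQuot, ← Category.assoc, ← hx, Category.assoc, hk, comp_zero]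
  obtain ⟨y, hy⟩ := V.exists_lift_of_toQuot_eq_zero _ (p - 1) p (by lia) h
  have hy' : y ≫ Subobject.ofLE (V.F (p - 1)) (V.F p) (V.mono (by lia)) = x := by
    rw [← cancel_mono (V.F p).arrow, Category.assoc, Subobject.ofLE_arrow, hy]
  rw [← cancel_epi π, hx, ← hy', Category.assoc, comp_zero]
  exact (congrArg _ (cokernel.condition _)).trans comp_zero

lemma grToQuot_quotMap (V : FiltObj C) (p q : ℤ) (hq : q = p + 1) :
    V.grToQuot p ≫ V.quotMap (by lia : p ≤ q) = 0 := by
  rw [← cancel_epi (V.grπ p), ← Category.assoc, grπ_grToQuot, Category.assoc, toQuot_quotMap,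
    V.arrow_toQuot p q hq, comp_zero]

/-- `V_p` is the kernel of `V_{≥ p} ⟶ V_{≥ p+1}`. -/
def grIsKernel (V : FiltObj C) (p q : ℤ) (hq : q = p + 1) :
    IsLimit (KernelFork.ofι (V.grToQuot p) (V.grToQuot_quotMap p q hq)) := by
  have H {T : C} (k : T ⟶ V.quot p) (hk : k ≫ V.quotMap (by lia : p ≤ q) = 0) :
      ∃ l : T ⟶ V.gr p, l ≫ V.grToQuot p = k := by
    have hz : k ≫ cokernel.π (V.grToQuot p) = 0 := by
      obtain ⟨T', π, hπ, x, hx⟩ := surjective_up_to_refinements_of_epi (V.toQuot p) k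
      obtain ⟨y, hy⟩ := V.exists_lift_of_toQuot_eq_zero x p q hq (by
        rw [← V.toQuot_quotMap (by lia : p ≤ q), ← Category.assoc, ← hx, Category.assoc, hk,
          comp_zero])
      have h1 : (V.F p).arrow ≫ V.toQuot p ≫ cokernel.π (V.grToQuot p) = 0 := by
        rw [← Category.assoc, ← grπ_grToQuot, Category.assoc, cokernel.condition, comp_zero]
      rw [← cancel_epi π, ← Category.assoc, hx, ← hy, Category.assoc, Category.assoc, h1,
        comp_zero, comp_zero]
    exact ⟨Abelian.monoLift _ k hz, Abelian.monoLift_comp _ _ _⟩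
  exact KernelFork.IsLimit.ofι' _ _ (fun k hk => ⟨(H k hk).choose, (H k hk).choose_spec⟩)

/-- The object `V^o` of the filtered category of `Cᵒᵖ`, with `F_i V^o = (V_{≥ -i})^o`. -/
abbrev op (V : FiltObj C) : FiltObj Cᵒᵖ where
  X := Opposite.op V.X
  F i := Subobject.mk (V.toQuot (-i)).op
  mono i j h := Subobject.mk_le_mk_of_comm (V.quotMap (neg_le_neg h)).op
    (by rw [← op_comp, toQuot_quotMap])
  exists_bot := by
    obtain ⟨b, hb⟩ := V.exists_top
    refine ⟨-(b + 1), Subobject.mk_eq_bot_iff_zero.2 ?_⟩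
    have h : IsIso (V.F b).arrow := (Subobject.isIso_arrow_iff_eq_top _).2 hb
    have h0 : V.toQuot (b + 1) = 0 := by
      rw [← cancel_epi (V.F b).arrow, V.arrow_toQuot b _ rfl, comp_zero]
    rw [neg_neg, h0, op_zero]
  exists_top := by
    obtain ⟨a, ha⟩ := V.exists_bot
    refine ⟨-(a + 1), ?_⟩
    have h0 : (V.F a).arrow = 0 :=
      (Subobject.bot_factors_iff_zero _).1 (ha ▸ (V.F a).factors_self)
    have : Mono (V.toQuot (a + 1)) := Preadditive.mono_of_cancel_zero _ (fun k hk => by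
      obtain ⟨y, hy⟩ := V.exists_lift_of_toQuot_eq_zero k a _ rfl hk
      rw [← hy, h0, comp_zero])
    have : IsIso (V.toQuot (a + 1)) := isIso_of_mono_of_epi _
    have : IsIso (V.toQuot (- -(a + 1))) := by rwa [neg_neg]
    exact Subobject.mk_eq_top_of_isIso _

/-- The identification `F_i V^o = (V_{≥ -i})^o` of objects. -/
def opFIso (V : FiltObj C) (i : ℤ) : (V.op.F i : Cᵒᵖ) ≅ Opposite.op (V.quot (-i)) :=
  Subobject.underlyingIso (X := Opposite.op (V.quot (-i))) (V.toQuot (-i)).op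

lemma opFIso_hom_toQuot (V : FiltObj C) (i : ℤ) :
    (V.opFIso i).hom ≫ (V.toQuot (-i)).op = (V.op.F i).arrow :=
  Subobject.underlyingIso_hom_comp_eq_mk _

lemma ofLE_opFIso_hom (V : FiltObj C) {i j : ℤ} (h : i ≤ j) :
    Subobject.ofLE (V.op.F i) (V.op.F j) (V.op.mono h) ≫ (V.opFIso j).hom =
      (V.opFIso i).hom ≫ (V.quotMap (neg_le_neg h)).op := by
  have h1 : (V.toQuot (-i)).op = (V.quotMap (neg_le_neg h)).op ≫ (V.toQuot (-j)).op := by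
    rw [← op_comp, toQuot_quotMap]
  refine (cancel_mono (V.toQuot (-j)).op).1 ?_
  refine (Category.assoc _ _ _).trans ?_
  rw [Category.assoc, ← h1]
  exact ((congrArg _ (V.opFIso_hom_toQuot j)).trans (Subobject.ofLE_arrow (V.op.mono h))).trans
    (V.opFIso_hom_toQuot i).symm

/-- The canonical identification `(V^o)_i ≅ (V_{-i})^o`, induced by `F_i V^o = (V_{≥ -i})^o`. -/
def grOp (V : FiltObj C) (i : ℤ) : V.op.gr i ≅ Opposite.op (V.gr (-i)) :=
  cokernel.mapIso _ (V.quotMap (neg_le_neg (by lia : i - 1 ≤ i))).op (V.opFIso (i - 1))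
      (V.opFIso i) (V.ofLE_opFIso_hom (by lia)) ≪≫
    IsColimit.coconePointUniqueUpToIso (cokernelIsCokernel _)
      (KernelFork.IsLimit.ofιOp _ _ (V.grIsKernel (-i) (-(i - 1)) (by lia)))

lemma grπ_grOp (V : FiltObj C) (i : ℤ) :
    V.op.grπ i ≫ (V.grOp i).hom = (V.opFIso i).hom ≫ (V.grToQuot (-i)).op := by
  have h1 : V.op.grπ i ≫ (cokernel.mapIso _ (V.quotMap (neg_le_neg (by lia : i - 1 ≤ i))).op
      (V.opFIso (i - 1)) (V.opFIso i) (V.ofLE_opFIso_hom (by lia))).hom =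
        (V.opFIso i).hom ≫ cokernel.π _ := cokernel.π_desc _ _ _
  unfold grOp
  rw [Iso.trans_hom, ← Category.assoc]
  refine (congrArg (· ≫ _) h1).trans ?_
  refine (Category.assoc _ _ _).trans (congrArg _ ?_)
  exact IsColimit.comp_coconePointUniqueUpToIso_hom (cokernelIsCokernel _) _ WalkingParallelPair.one

end Opposite

section Shift

variable {C : Type u} [Category.{v} C] [Abelian C] [HasShift C ℤ]

/-- The object `W[n](m)`: translation `F[n]_p = F_{n+p}` and shift `(m)`. -/
abbrev twist (W : FiltObj C) (n m : ℤ) : FiltObj C where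
  X := W.X⟦m⟧
  F p := Subobject.mk ((W.F (n + p)).arrow⟦m⟧')
  mono p q h := Subobject.mk_le_mk_of_comm
    ((Subobject.ofLE _ _ (W.mono (by lia : n + p ≤ n + q)))⟦m⟧')
    (by rw [← Functor.map_comp, Subobject.ofLE_arrow])
  exists_bot := by
    obtain ⟨a, ha⟩ := W.exists_bot
    refine ⟨a - n, Subobject.mk_eq_bot_iff_zero.2 ?_⟩
    have h0 : (W.F a).arrow = 0 :=
      (Subobject.bot_factors_iff_zero _).1 (ha ▸ (W.F a).factors_self)
    rw [add_sub_cancel, h0, Functor.map_zero]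
  exists_top := by
    obtain ⟨b, hb⟩ := W.exists_top
    refine ⟨b - n, ?_⟩
    rw [← add_sub_cancel n b] at hb
    have : IsIso (W.F (n + (b - n))).arrow := (Subobject.isIso_arrow_iff_eq_top _).2 hb
    exact Subobject.mk_eq_top_of_isIso _

/-- For an arrow `l : V ⟶ W[n](m)`, the induced arrow `F_p V ⟶ (F_q W)(m)`, `q = n + p`. -/
def Hom.filMap {V W : FiltObj C} {n m : ℤ} (l : V ⟶ W.twist n m) (p q : ℤ) (h : n + p = q) :
    (V.F p : C) ⟶ (W.F q : C)⟦m⟧ :=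
  ((W.twist n m).F p).factorThru _ (l.factors p) ≫
    (Subobject.underlyingIso ((W.F (n + p)).arrow⟦m⟧')).hom ≫
      (Subobject.ofLE _ _ (W.mono h.le))⟦m⟧'

lemma Hom.filMap_arrow {V W : FiltObj C} {n m : ℤ} (l : V ⟶ W.twist n m) (p q : ℤ)
    (h : n + p = q) :
    Hom.filMap l p q h ≫ (W.F q).arrow⟦m⟧' = (V.F p).arrow ≫ l.f := by
  unfold filMap
  rw [Category.assoc, Category.assoc, ← Functor.map_comp, Subobject.ofLE_arrow,
    Subobject.underlyingIso_hom_comp_eq_mk]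
  exact Subobject.factorThru_arrow _ _ _

/-- An arrow of `C` respecting the filtrations up to translation by `n` and shift by `m`. -/
def mkHom {V W : FiltObj C} {n m : ℤ} (f : V.X ⟶ W.X⟦m⟧)
    (hf : ∀ p, ∃ g : (V.F p : C) ⟶ (W.F (n + p) : C)⟦m⟧,
      g ≫ (W.F (n + p)).arrow⟦m⟧' = (V.F p).arrow ≫ f) : V ⟶ W.twist n m :=
  Hom.mk (W := W.twist n m) f (fun p => (Subobject.mk_factors_iff _ _).2 (hf p))

/-- The arrow `l_p : V_p ⟶ W_{q}(m)`, `q = n + p`, induced by `l : V ⟶ W[n](m)`. -/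
def Hom.grMap {V W : FiltObj C} {n m : ℤ} (l : V ⟶ W.twist n m) (p q : ℤ) (h : n + p = q) :
    V.gr p ⟶ (W.gr q)⟦m⟧ :=
  cokernel.desc _ (Hom.filMap l p q h ≫ (W.grπ q)⟦m⟧') (by
    have h1 : Subobject.ofLE (V.F (p - 1)) (V.F p) (V.mono (by lia)) ≫ Hom.filMap l p q h =
        Hom.filMap l (p - 1) (q - 1) (by lia) ≫
          (Subobject.ofLE (W.F (q - 1)) (W.F q) (W.mono (by lia)))⟦m⟧' := by
      rw [← cancel_mono ((W.F q).arrow⟦m⟧'), Category.assoc, Hom.filMap_arrow, ← Category.assoc,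
        Subobject.ofLE_arrow, Category.assoc, ← Functor.map_comp, Subobject.ofLE_arrow,
        Hom.filMap_arrow]
    have h2 : Subobject.ofLE (W.F (q - 1)) (W.F q) (W.mono (by lia)) ≫ W.grπ q = 0 :=
      cokernel.condition _
    rw [← Category.assoc, h1, Category.assoc, ← Functor.map_comp, h2, Functor.map_zero, comp_zero])

/-- The iterates `e^k : V ⟶ V[2k](k)` of an arrow `e : V ⟶ V[2](1)`. -/
def pow {V : FiltObj C} (e : V ⟶ V.twist 2 1) : ∀ k : ℕ, V ⟶ V.twist (2 * k) k
  | 0 => mkHom (ShiftedHom.mk₀ _ rfl (𝟙 V.X)) (fun p =>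
      ⟨ShiftedHom.mk₀ _ rfl (Subobject.ofLE _ _ (V.mono (by simp))), by
        simp only [ShiftedHom.mk₀, Category.assoc, Category.id_comp]
        rw [← NatTrans.naturality]
        simp⟩)
  | k + 1 => mkHom (ShiftedHom.comp (pow e k).f e.f (by push_cast; ring)) (fun p =>
      ⟨ShiftedHom.comp (Hom.filMap (pow e k) p (2 * k + p) rfl)
        (Hom.filMap e (2 * k + p) (2 * (k + 1 : ℕ) + p) (by push_cast; ring))
        (by push_cast; ring), by
        unfold ShiftedHom.comp
        rw [Category.assoc, Category.assoc, ← NatTrans.naturality, Functor.comp_map,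
          ← Functor.map_comp_assoc, Hom.filMap_arrow, Functor.map_comp_assoc,
          ← Category.assoc, Hom.filMap_arrow, Category.assoc]⟩)

/-- Condition HL: the arrows `e^k : V_{-k} ⟶ V_k(k)` are isomorphisms. -/
def HL {V : FiltObj C} (e : V ⟶ V.twist 2 1) : Prop :=
  ∀ k : ℕ, IsIso (Hom.grMap (pow e k) (-k) k (by ring))

lemma exists_quotMap {V W : FiltObj C} {n m : ℤ} (l : V ⟶ W.twist n m) (p q : ℤ) (h : n + p = q) :
    ∃ g : V.quot p ⟶ (W.quot q)⟦m⟧, V.toQuot p ≫ g = l.f ≫ (W.toQuot q)⟦m⟧' := by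
  refine ⟨cokernel.desc _ (l.f ≫ (W.toQuot q)⟦m⟧') ?_, cokernel.π_desc _ _ _⟩
  rw [← Category.assoc, ← Hom.filMap_arrow l (p - 1) (q - 1) (by lia), Category.assoc,
    ← Functor.map_comp, W.arrow_toQuot (q - 1) q (by lia), Functor.map_zero, comp_zero]

/-- The arrow `e^o : V^o ⟶ V^o[2](1)` in the filtered category of `Cᵒᵖ`, whose shift functor `(m)`
is the opposite of the shift functor `(-m)` of `C`. -/
def opHom {V : FiltObj C} (e : V ⟶ V.twist 2 1) : V.op ⟶ V.op.twist 2 1 :=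
  mkHom (ShiftedHom.opEquiv 1 e.f) (fun p => by
    obtain ⟨g, hg⟩ := exists_quotMap e (-(2 + p)) (-p) (by ring)
    let adj : (shiftFunctor C (1 : ℤ)).op ⊣ shiftFunctor Cᵒᵖ (1 : ℤ) :=
      (Pretriangulated.opShiftFunctorEquivalence C 1).symm.toAdjunction
    refine ⟨(V.opFIso p).hom ≫ ShiftedHom.opEquiv 1 g ≫ ((V.opFIso (2 + p)).inv)⟦(1 : ℤ)⟧', ?_⟩
    have h1 : (V.opFIso (2 + p)).inv ≫ (V.op.F (2 + p)).arrow = (V.toQuot (-(2 + p))).op := by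
      rw [← opFIso_hom_toQuot, Iso.inv_hom_id_assoc]
    have h2 : (ShiftedHom.opEquiv 1 g) ≫ ((V.toQuot (-(2 + p))).op)⟦(1 : ℤ)⟧' =
        ShiftedHom.opEquiv 1 (V.toQuot (-(2 + p)) ≫ g) :=
      (adj.homEquiv_naturality_right (X := Opposite.op (V.quot (-p))) g.op
        (V.toQuot (-(2 + p))).op).symm
    have h3 : (V.toQuot (-p)).op ≫ ShiftedHom.opEquiv 1 e.f =
        ShiftedHom.opEquiv 1 (e.f ≫ (V.toQuot (-p))⟦(1 : ℤ)⟧') :=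
      (adj.homEquiv_naturality_left (V.toQuot (-p)).op e.f.op).symm
    rw [Category.assoc, Category.assoc, ← Functor.map_comp, h1, h2, hg, ← h3, ← Category.assoc,
      opFIso_hom_toQuot])

/-- The matrix `ẽ(φ) = φ⁻¹ ∘ e ∘ φ : V_* ⟶ V_*(1)` of `e` with respect to a splitting `φ`. -/
def matrix {V : FiltObj C} {r : ℕ} (e : V ⟶ V.twist 2 1) (φ : V.graded r ≅ V) :
    ShiftedHom (V.graded r).X (V.graded r).X (1 : ℤ) :=
  φ.hom.f ≫ e.f ≫ φ.inv.f⟦(1 : ℤ)⟧'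

/-- The part of degree `d` of an arrow `u : V_* ⟶ V_*(m)`: the sum of its components
`V_p ⟶ V_q(m)` with `q - p = d`. -/
def homPart (V : FiltObj C) (r : ℕ) {m : ℤ} (u : ShiftedHom (V.graded r).X (V.graded r).X m)
    (d : ℤ) : ShiftedHom (V.graded r).X (V.graded r).X m :=
  ∑ p ∈ Finset.Icc (-r : ℤ) r,
    V.gπ r p ≫ V.gι r p ≫ u ≫ (V.gπ r (p + d) ≫ V.gι r (p + d))⟦m⟧'

/-- A splitting `φ` is `e`-good if it induces the identity on the graded pieces and `ẽ(φ)` is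
homogeneous of degree two. -/
def IsEGood {V : FiltObj C} {r : ℕ} (e : V ⟶ V.twist 2 1) (φ : V.graded r ≅ V) : Prop :=
  IsGood φ ∧ matrix e φ = homPart V r (matrix e φ) 2

/-! ### The splitting `ω_I(e)` -/

/-- The setting of the splitting mechanism: an arrow `l : V ⟶ V[b - a](m)` inducing an isomorphism
`l_a : V_a ≅ V_b(m)`, together with the first inclusion `i_a : V_a ⟶ V` and the last quotient
`p_b : V ⟶ V_b`. -/
structure Unwrapping {V : FiltObj C} {n m : ℤ} (l : V ⟶ V.twist n m) (a b : ℤ) where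
  h : n + a = b
  isIso : IsIso (Hom.grMap l a b h)
  ia : V.gr a ⟶ V.X
  grπ_ia : V.grπ a ≫ ia = (V.F a).arrow
  pb : V.X ⟶ V.gr b
  arrow_pb : (V.F b).arrow ≫ pb = V.grπ b

namespace Unwrapping

variable {V : FiltObj C} {n m : ℤ} {l : V ⟶ V.twist n m} {a b : ℤ} (D : Unwrapping l a b)

/-- The inverse `l_a⁻¹ : V_b(m) ⟶ V_a`. -/
def laInv : (V.gr b)⟦m⟧ ⟶ V.gr a :=
  haveI := D.isIso
  inv (Hom.grMap l a b D.h)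

/-- The arrow `l ∘ i_a ∘ l_a⁻¹ : V_b ⟶ V`, i.e. the arrow whose shift by `m` is
`l ∘ i_a ∘ l_a⁻¹ : V_b(m) ⟶ V_a ⟶ V ⟶ V(m)`. -/
def sb : V.gr b ⟶ V.X := (shiftFunctor C m).preimage (D.laInv ≫ D.ia ≫ l.f)

/-- `ρ = (l_a⁻¹ p_b l - l_a⁻¹ p_b l² i_a l_a⁻¹ p_b, p_b) : V ⟶ V_a ⊕ V_b`. -/
def ρ : V.X ⟶ V.gr a ⊞ V.gr b :=
  biprod.lift (l.f ≫ D.pb⟦m⟧' ≫ D.laInv - D.pb ≫ D.sb ≫ l.f ≫ D.pb⟦m⟧' ≫ D.laInv) D.pb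

/-- The filtered object `Ker ρ`, with the filtration induced by that of `V`. -/
abbrev ker : FiltObj C := V.restrict (kernel.ι D.ρ)

/-- The arrow `w = i_a + ι_ρ + l i_a l_a⁻¹ : V_a ⊕ Ker ρ ⊕ V_b ⟶ V` (an isomorphism when `V` has
type `[a, b]` and `a < b`). -/
def w : V.gr a ⊞ (kernel D.ρ ⊞ V.gr b) ⟶ V.X :=
  biprod.desc D.ia (biprod.desc (kernel.ι D.ρ) D.sb)

end Unwrapping

/-- `IsOmegaI r e φ`: for `V` of type `[-r, r]` and `e : V ⟶ V[2](1)` satisfying HL, the splitting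
`φ` is the splitting `ω_I(e)`, defined by recursion on `r`. If `r = 0`, then `ω_I(e)` is the identity
`V_0 = V`. To go from `r` to `r + 1`, let `l = e^{r+1}`, which gives
`w : V_{-r-1} ⊕ Ker ρ ⊕ V_{r+1} ≅ V`, let `e' : Ker ρ ⟶ Ker ρ[2](1)` be the
`Ker ρ`-component of `w⁻¹ ∘ e ∘ w`, and let `χ = ω_I(e')`. Then `ω_I(e)` has components `i_a` on
`V_{-r-1}` and `l i_a l_a⁻¹` on `V_{r+1}`, and is given by `χ` on the other `V_p`, identified with
`(Ker ρ)_p` through `ι_ρ`. -/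
def IsOmegaI : ∀ (r : ℕ) {V : FiltObj C} (_ : V ⟶ V.twist 2 1) (_ : V.graded r ≅ V), Prop
  | 0, _, _, φ => IsGood φ
  | r + 1, V, e, φ =>
    ∃ (D : Unwrapping (pow e (r + 1)) (-(r + 1 : ℕ)) (r + 1 : ℕ))
      (t : V.X ⟶ kernel D.ρ) (e' : D.ker ⟶ D.ker.twist 2 1) (χ : D.ker.graded r ≅ D.ker),
      D.w ≫ t = biprod.snd ≫ biprod.fst ∧
      e'.f = kernel.ι D.ρ ≫ e.f ≫ t⟦(1 : ℤ)⟧' ∧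
      IsOmegaI r e' χ ∧
      V.gι (r + 1) (-(r + 1 : ℕ)) ≫ φ.hom.f = D.ia ∧
      V.gι (r + 1) (r + 1 : ℕ) ≫ φ.hom.f = D.sb ∧
      ∀ p ∈ Finset.Icc (-r : ℤ) r,
        Hom.gr (V.restrictι (kernel.ι D.ρ)) p ≫ V.gι (r + 1) p ≫ φ.hom.f =
          D.ker.gι r p ≫ χ.hom.f ≫ kernel.ι D.ρ

/-! ### The first Deligne splitting `φ_I(e)` -/

/-- The primitive object `P_{-i} = Ker (e^{i+1} : V_{-i} ⟶ V_{i+2}(i+1))`. -/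
abbrev prim {V : FiltObj C} (e : V ⟶ V.twist 2 1) (i : ℕ) : C :=
  kernel (Hom.grMap (pow e (i + 1)) (-i) (i + 2) (by push_cast; ring))

/-- The defining properties of the arrow `f_i : P_{-i} ⟶ V` in the filtered category, `P_{-i}` being
placed in position `-i`: it lifts the natural arrow `P_{-i} ⟶ V_{≥ -i}`, and for every `s > i` the
composition `P_{-i} ⟶ V ⟶ V(s) ⟶ V_{≥ s}(s)` of `f_i`, `e^s` and the projection is zero. -/
def IsDeligneLift {V : FiltObj C} (e : V ⟶ V.twist 2 1) (i : ℕ)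
    (f : trivialAt (prim e i) (-i) ⟶ V) : Prop :=
  f.f ≫ V.toQuot (-i) = kernel.ι _ ≫ V.grToQuot (-i) ∧
  ∀ s : ℕ, i < s → f.f ≫ (pow e s).f ≫ (V.toQuot s)⟦(s : ℤ)⟧' = 0

/-- `φ` is the first Deligne splitting `φ_I(e)`: for `0 ≤ j ≤ i`, its restriction to the summand
`P_{-i}(-j)` of the primitive Lefschetz decomposition of `V_*`, embedded in `V_{-i+2j}` by `e^j`, is
`e^j ∘ f_i`. All arrows are shifted by `j`, so that their source is `P_{-i}`. -/
def IsPhiI {V : FiltObj C} {r : ℕ} (e : V ⟶ V.twist 2 1) (φ : V.graded r ≅ V) : Prop :=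
  ∃ f : ∀ i : ℕ, trivialAt (prim e i) (-i) ⟶ V, (∀ i, IsDeligneLift e i (f i)) ∧
    ∀ i j : ℕ, j ≤ i →
      kernel.ι _ ≫ Hom.grMap (pow e j) (-i) (-i + 2 * j) (by ring) ≫
        (V.gι r (-i + 2 * j) ≫ φ.hom.f)⟦(j : ℤ)⟧' = (f i).f ≫ (pow e j).f

/-! ### The splittings `ω_II(e)` and `φ_II(e)` -/

/-- `φ = (χ^o)⁻¹`, for splittings `φ` of `V` and `χ` of `V^o`: the component `(V^o)_i ⟶ V^o` of `χ`
is the opposite of the component `V ⟶ V_{-i}` of `φ⁻¹`. -/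
def IsDual {V : FiltObj C} {r : ℕ} (φ : V.graded r ≅ V) (χ : V.op.graded r ≅ V.op) : Prop :=
  ∀ i ∈ Finset.Icc (-r : ℤ) r,
    V.op.gι r i ≫ χ.hom.f = (V.grOp i).hom ≫ (φ.inv.f ≫ V.gπ r (-i)).op

/-- `φ` is the splitting `ω_II(e) = (ω_I(e^o)^o)⁻¹`. -/
def IsOmegaII {V : FiltObj C} {r : ℕ} (e : V ⟶ V.twist 2 1) (φ : V.graded r ≅ V) : Prop :=
  ∃ χ : V.op.graded r ≅ V.op, IsOmegaI r (opHom e) χ ∧ IsDual φ χ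

/-- `φ` is the second Deligne splitting `φ_II(e) = (φ_I(e^o)^o)⁻¹`. -/
def IsPhiII {V : FiltObj C} {r : ℕ} (e : V ⟶ V.twist 2 1) (φ : V.graded r ≅ V) : Prop :=
  ∃ χ : V.op.graded r ≅ V.op, IsPhiI (opHom e) χ ∧ IsDual φ χ

/-! ### The third Deligne splitting `φ_III(e)` -/

/-- The arrow `V_* ⟶ V_*(1)`, sum of the arrows `e_p : V_p ⟶ V_{p+2}(1)`. -/
def gradedE {V : FiltObj C} (e : V ⟶ V.twist 2 1) (r : ℕ) :
    ShiftedHom (V.graded r).X (V.graded r).X (1 : ℤ) :=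
  ∑ p ∈ Finset.Icc (-r : ℤ) r,
    V.gπ r p ≫ Hom.grMap e p (p + 2) (by ring) ≫ (V.gι r (p + 2))⟦(1 : ℤ)⟧'

/-- The iterates of `u ↦ gradedE ∘ u - u ∘ gradedE` on the arrows `u : V_* ⟶ V_*(m)`. -/
def adPow {V : FiltObj C} (e : V ⟶ V.twist 2 1) (r : ℕ) {m : ℤ}
    (u : ShiftedHom (V.graded r).X (V.graded r).X m) :
    ∀ k : ℕ, ShiftedHom (V.graded r).X (V.graded r).X (k + m)
  | 0 => ShiftedHom.comp u (ShiftedHom.mk₀ ((0 : ℕ) : ℤ) rfl (𝟙 _)) rfl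
  | k + 1 =>
    ShiftedHom.comp (adPow e r u k) (gradedE e r) (by push_cast; ring) -
      ShiftedHom.comp (gradedE e r) (adPow e r u k) (by push_cast; ring)

/-- `φ` is the third Deligne splitting `φ_III(e)`: it is good, and the `(1 - d)`-th iterate of
`u ↦ gradedE ∘ u - u ∘ gradedE` kills the part of degree `d` of `ẽ(φ)`, for every `d ≤ 1`
(here `d = 1 - k`). -/
def IsPhiIII {V : FiltObj C} {r : ℕ} (e : V ⟶ V.twist 2 1) (φ : V.graded r ≅ V) : Prop :=
  IsGood φ ∧ ∀ k : ℕ, adPow e r (homPart V r (matrix e φ) (1 - k)) k = 0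

end Shift

end FiltObj

end

/-! Fix an `e`-good splitting `φ`, with components `sec φ p : V_p ⟶ V` and `ret φ p : V ⟶ V_p`. Then
`e` carries the summand `V_p` to `V_{p+2}(1)` by its graded map (`sec_e`, `sec_pow`, `pow_ret`), so
every arrow built from `e` can be computed on `V_*`. Each of the other constructions is shown to be
satisfied by `φ` and to determine its splitting.

For `φ_III`, existence is immediate: `ẽ(φ)` has no part of degree `≤ 1`. For uniqueness, let `ψ` be
another candidate. Since both splittings are good, `φ⁻¹ψ = 1 + n` with `n` strictly lowering the
degree, and `(1 + n) ẽ(ψ) = ē (1 + n)`. If the parts of `n` of degree `≥ -k` vanish, the part of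
`ẽ(ψ)` of degree `1 - k` is `[ē, n_{-k-1}]`. The condition on `ψ` then gives `(ad ē)^{k+1} n_{-k-1}
= 0`, and hard Lefschetz for the adjoint action gives `n_{-k-1} = 0` (`eq_zero_of_conj`). That
injectivity, `eq_zero_of_iterate_lie`, is the only place where rational coefficients matter. It
comes from completing `ē` to an `sl₂`-triple. The argument is carried out in an abstract ring
(`LefschetzData`), into which shifted arrows are mapped by a faithful action (`act`). Uniqueness of
the `e`-good splitting follows, since `e`-good implies `φ_III`.

For `φ_I`, the condition on `e^s ∘ f_i` forces the component of `f_i` in `V_{-s}` to vanish because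
`e^s : V_{-s} ⟶ V_s(s)` is invertible, so `f_i` is the restriction of `sec φ (-i)`. The primitive
decomposition then recovers the whole splitting.

For `ω_I`, the outer components `i` and `s` are those of `φ`, and `ρ` is the pair of outer
projections. Hence `Ker ρ` is the sum of the inner `V_p`, on which `e'` is again homogeneous and HL,
and induction on `r` applies.

The second versions follow by transposing `φ` to the opposite category, where it remains homogeneous
(`isHomogeneous_opHom`). -/

noncomputable section

open scoped CategoryTheory.Pretriangulated.Opposite

attribute [local instance] Abelian.hasFiniteBiproducts

/-! ### Hard Lefschetz and the `sl₂`-triple in a ring with graded idempotents. -/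

/-- A ring with a complete family of orthogonal idempotents `π p`, `p ∈ [-r, r]`, and an element `e`
of degree two satisfying the hard Lefschetz condition: `g k` inverts `e ^ k : π (-k) ⟶ π k`. -/
structure LefschetzData (R : Type*) [Ring R] (r : ℕ) where
  π : ℤ → R
  e : R
  g : ℕ → R
  π_mul_self : ∀ p, π p * π p = π p
  π_mul_of_ne : ∀ p q, p ≠ q → π p * π q = 0
  π_of_notMem : ∀ p, p ∉ Finset.Icc (-r : ℤ) r → π p = 0
  sum_π : ∑ p ∈ Finset.Icc (-r : ℤ) r, π p = 1
  e_mul_π : ∀ p, e * π p = π (p + 2) * e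
  g_mul_π : ∀ k : ℕ, g k * π k = π (-k) * g k
  g_mul_pow_mul_π : ∀ k : ℕ, g k * e ^ k * π (-k) = π (-k)
  pow_mul_g_mul_π : ∀ k : ℕ, e ^ k * g k * π k = π k

namespace LefschetzData

attribute [local instance] LieRing.ofAssociativeRing

variable {R : Type*} [Ring R] {r : ℕ} (D : LefschetzData R r)

/-- `u` is homogeneous of degree `d`. -/
def IsHom (u : R) (d : ℤ) : Prop := ∀ p, u * D.π p = D.π (p + d) * u

lemma ext_right {x y : R} (h : ∀ p, x * D.π p = y * D.π p) : x = y := by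
  rw [← mul_one x, ← mul_one y, ← D.sum_π, Finset.mul_sum, Finset.mul_sum]
  exact Finset.sum_congr rfl fun p _ => h p

lemma isHom_of_right {u : R} {d : ℤ} (h : ∀ p, u * D.π p = D.π (p + d) * u * D.π p) :
    D.IsHom u d := by
  intro p
  refine D.ext_right fun q => ?_
  by_cases hpq : p = q
  · subst hpq; rw [mul_assoc, D.π_mul_self, h]
  · rw [mul_assoc, D.π_mul_of_ne _ _ hpq, mul_zero, mul_assoc, h, mul_assoc, ← mul_assoc,
      D.π_mul_of_ne _ _ (by lia), zero_mul]

lemma pow_mul_π (n : ℕ) (p : ℤ) : D.e ^ n * D.π p = D.π (p + 2 * n) * D.e ^ n := by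
  induction n generalizing p with
  | zero => simp
  | succ n ih =>
    rw [pow_succ, mul_assoc, D.e_mul_π, ← mul_assoc, ih, mul_assoc]
    congr 2
    push_cast
    ring

lemma IsHom.mul {u v : R} {a b : ℤ} (hu : D.IsHom u a) (hv : D.IsHom v b) :
    D.IsHom (u * v) (a + b) := fun p => by
  rw [mul_assoc, hv, ← mul_assoc, hu, mul_assoc, show p + b + a = p + (a + b) by ring]

lemma IsHom.sub {u v : R} {a : ℤ} (hu : D.IsHom u a) (hv : D.IsHom v a) :
    D.IsHom (u - v) a := fun p => by rw [sub_mul, mul_sub, hu, hv]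

lemma isHom_e : D.IsHom D.e 2 := D.e_mul_π

lemma IsHom.lie {u v : R} {a b : ℤ} (hu : D.IsHom u a) (hv : D.IsHom v b) :
    D.IsHom ⁅u, v⁆ (a + b) := by
  rw [Ring.lie_def]
  exact (hu.mul D hv).sub D (add_comm b a ▸ hv.mul D hu)

/-- The component of the inverse of hard Lefschetz `π (-i) ⟶ π (-i - 2)`. -/
def lam (i : ℕ) : R := D.g (i + 2) * D.e ^ (i + 1) * D.π (-i)

lemma π_mul_lam (i : ℕ) : D.π (-i - 2) * D.lam i = D.lam i := by
  have h1 : D.e ^ (i + 1) * D.π (-i) = D.π ((i + 2 : ℕ) : ℤ) * D.e ^ (i + 1) * D.π (-i) := by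
    rw [mul_assoc, D.pow_mul_π, ← mul_assoc]
    rw [show (-(i : ℤ) + 2 * (i + 1 : ℕ)) = ((i + 2 : ℕ) : ℤ) by push_cast; ring, D.π_mul_self]
  have h2 : D.lam i = D.π (-i - 2) * (D.g (i + 2) * (D.e ^ (i + 1) * D.π (-i))) := by
    have h3 := D.g_mul_π (i + 2)
    rw [show (-((i + 2 : ℕ) : ℤ)) = -(i : ℤ) - 2 by push_cast; ring] at h3
    rw [← mul_assoc (D.π _), ← h3, mul_assoc (D.g _), ← mul_assoc (D.π ((i + 2 : ℕ) : ℤ)), ← h1,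
      lam, mul_assoc]
  rw [h2, ← mul_assoc, D.π_mul_self]

/-- `lam i` is `(e^{i+2})⁻¹ e^{i+1}`, hence a left inverse of `e : V_{-i-2} → V_{-i}`. Its kernel is
the primitive part, so it encodes `V_{-i} = P_{-i} ⊕ e V_{-i-2}` without naming `P_{-i}`. -/
lemma lam_mul_e (i : ℕ) : D.lam i * D.e * D.π (-i - 2) = D.π (-i - 2) := by
  have h := D.g_mul_pow_mul_π (i + 2)
  rw [show (-((i + 2 : ℕ) : ℤ)) = -(i : ℤ) - 2 by push_cast; ring] at h
  have h1 := D.e_mul_π (-i - 2)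
  rw [sub_add_cancel] at h1
  rw [lam, mul_assoc _ (D.π _), ← h1, mul_assoc, mul_assoc D.e, D.π_mul_self]
  conv_rhs => rw [← h, pow_succ]
  simp only [mul_assoc]

lemma pow_mul_lam (i : ℕ) : D.e ^ (i + 2) * D.lam i = D.e ^ (i + 1) * D.π (-i) := by
  have h1 : D.e ^ (i + 1) * D.π (-i) = D.π ((i + 2 : ℕ) : ℤ) * D.e ^ (i + 1) := by
    rw [D.pow_mul_π, show (-(i : ℤ) + 2 * (i + 1 : ℕ)) = ((i + 2 : ℕ) : ℤ) by push_cast; ring]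
  rw [lam, mul_assoc (D.g _), h1, ← mul_assoc, ← mul_assoc, D.pow_mul_g_mul_π]

/-- Approximations of the lowering operator on `π (-i)`. -/
def lowerAux : ℕ → ℕ → R
  | 0, _ => 0
  | n + 1, i => (D.e * lowerAux n (i + 2) + (i + 2)) * D.lam i

/-- The first index is fuel for a recursion towards larger `i`; the recursion really stops when `i >
r`, because `π (-i) = 0` there. -/
lemma lowerAux_stable (n i : ℕ) (h : r < n + i) : D.lowerAux (n + 1) i = D.lowerAux n i := by
  induction n generalizing i with
  | zero =>
    have : D.lam i = 0 := by
      rw [lam, D.π_of_notMem (-i) (by rw [Finset.mem_Icc]; lia), mul_zero]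
    simp [lowerAux, this]
  | succ n ih => rw [lowerAux, ih _ (by lia), lowerAux]

/-- The lowering operator on `π (-i)`. -/
def lowerNeg (i : ℕ) : R := D.lowerAux (r + 1) i

/-- This formula is forced: the lowering operator `f` must kill `P_{-i}`, and on `e x` with `x` of
weight `-i-2` the relation `[e, f] x = -(i+2) x` gives `f e x = (e f + (i+2)) x`. -/
lemma lowerNeg_eq (i : ℕ) : D.lowerNeg i = (D.e * D.lowerNeg (i + 2) + (i + 2)) * D.lam i := by
  rw [lowerNeg, ← D.lowerAux_stable (r + 1) i (by lia), lowerAux, lowerNeg]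

lemma lowerNeg_mul_π (i : ℕ) : D.lowerNeg i * D.π (-i) = D.lowerNeg i := by
  rw [lowerNeg_eq, mul_assoc, lam, mul_assoc, D.π_mul_self]

lemma π_mul_lowerAux (n i : ℕ) : D.π (-i - 2) * D.lowerAux n i = D.lowerAux n i := by
  induction n generalizing i with
  | zero => simp [lowerAux]
  | succ n ih =>
    have h : D.π (-i - 2) * D.e * D.lowerAux n (i + 2) = D.e * D.lowerAux n (i + 2) := by
      have h1 := ih (i + 2)
      rw [show (-((i + 2 : ℕ) : ℤ) - 2) = -(i : ℤ) - 4 by push_cast; ring] at h1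
      rw [show -(i : ℤ) - 2 = -(i : ℤ) - 4 + 2 by ring, ← D.e_mul_π, mul_assoc, h1]
    rw [lowerAux, ← mul_assoc, mul_add, add_mul, add_mul, ← mul_assoc, h]
    congr 1
    rw [show D.π (-i - 2) * ((i : R) + 2) = (i + 2) * D.π (-i - 2) by
      have := (Nat.cast_commute (i + 2) (D.π (-i - 2))).eq
      push_cast at this
      exact this.symm, mul_assoc, D.π_mul_lam]

/-- The value of the lowering operator on `π p`. -/
def lowerAt : ℤ → R
  | .negSucc i => D.lowerNeg (i + 1)
  | .ofNat 0 => D.lowerNeg 0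
  | .ofNat (i + 1) => (D.e ^ (i + 1) * D.lowerNeg (i + 1) + (i + 1) * D.e ^ i) * D.g (i + 1)

/-- The lowering operator of the `sl₂`-triple defined by hard Lefschetz. -/
def lower : R := ∑ p ∈ Finset.Icc (-r : ℤ) r, D.lowerAt p * D.π p

lemma lower_mul_π (p : ℤ) : D.lower * D.π p = D.lowerAt p * D.π p := by
  rw [lower, Finset.sum_mul]
  by_cases hp : p ∈ Finset.Icc (-r : ℤ) r
  · rw [Finset.sum_eq_single_of_mem p hp, mul_assoc, D.π_mul_self]
    intro q _ hq
    rw [mul_assoc, D.π_mul_of_ne _ _ hq, mul_zero]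
  · rw [D.π_of_notMem p hp]; simp

lemma lower_mul_π_neg (i : ℕ) : D.lower * D.π (-i) = D.lowerNeg i := by
  rw [lower_mul_π, ← lowerNeg_mul_π]
  cases i <;> rfl

lemma lower_mul_lam (i : ℕ) : D.lower * D.lam i = D.lowerNeg (i + 2) * D.lam i := by
  rw [← π_mul_lam, ← mul_assoc, show -(i : ℤ) - 2 = -((i + 2 : ℕ) : ℤ) by push_cast; ring,
    lower_mul_π_neg, ← mul_assoc, lowerNeg_mul_π]

lemma lower_mul_π_neg' (i : ℕ) :
    D.lower * D.π (-i) = (D.e * D.lower + (i + 2)) * D.lam i := by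
  rw [lower_mul_π_neg, lowerNeg_eq, add_mul (D.e * _), add_mul (D.e * _), mul_assoc,
    mul_assoc, lower_mul_lam]

/-- Positive weights are reached as `e^k V_{-k}`. The coefficient `k = i + 1` is minus the sum of
the weights `-k, -k+2, …, k-2` crossed when `f` is commuted past `e^k`. -/
lemma lower_mul_pow_mul_π (i : ℕ) :
    D.lower * (D.e ^ (i + 1) * D.π (-(i + 1 : ℕ))) =
      (D.e ^ (i + 1) * D.lower + (i + 1) * D.e ^ i) * D.π (-(i + 1 : ℕ)) := by
  have h1 : D.e ^ (i + 1) * D.π (-(i + 1 : ℕ)) = D.π ((i + 1 : ℕ) : ℤ) * D.e ^ (i + 1) := by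
    rw [D.pow_mul_π]; congr 2; push_cast; ring
  have h2 : D.lower * D.π ((i + 1 : ℕ) : ℤ) = (D.e ^ (i + 1) * D.lowerNeg (i + 1) +
      (i + 1) * D.e ^ i) * D.g (i + 1) * D.π ((i + 1 : ℕ) : ℤ) := D.lower_mul_π _
  rw [h1, ← mul_assoc, h2, mul_assoc, ← h1, mul_assoc, ← mul_assoc (D.g _), D.g_mul_pow_mul_π,
    add_mul, add_mul _ _ (D.π _), mul_assoc, lowerNeg_mul_π, mul_assoc _ D.lower, lower_mul_π_neg]

/-- The remaining `sl₂` relation: `[e, f]` is multiplication by the weight. In negative weight it is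
built into the definition of `f`; in weight `i ≥ 0` it is checked on `e^i V_{-i}`. -/
lemma lie_lower_mul_π (p : ℤ) : ⁅D.e, D.lower⁆ * D.π p = p * D.π p := by
  have key : ∀ i : ℕ, D.lower * (D.e ^ i * D.π (-i)) =
      D.e ^ i * D.lower * D.π (-i) + i * (D.e ^ (i - 1) * D.π (-i)) := by
    rintro (_ | i)
    · simp
    · rw [lower_mul_pow_mul_π, add_mul]; simp [mul_assoc]
  rw [Ring.lie_def, sub_mul]
  obtain ⟨i, rfl | rfl⟩ : ∃ i : ℕ, p = i ∨ p = -(i + 1) := by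
    rcases p with i | i
    · exact ⟨i, Or.inl rfl⟩
    · exact ⟨i, Or.inr (by rw [Int.negSucc_eq])⟩
  · have h : (D.e * D.lower - D.lower * D.e) * (D.e ^ i * D.π (-i)) =
        i * (D.e ^ i * D.π (-i)) := by
      -- On weight `-i`, `e^{i+1} x = e^{i+2} (lam x)`, so the formula for `f e^{i+2}` in weight
      -- `-i-2` applies to `lam x`; the recursion for `f x` then reassembles the result into
      -- `e^{i+1} f x`.
      have h1 : D.lower * (D.e * (D.e ^ i * D.π (-i))) = D.e ^ (i + 1) * D.lower * D.π (-i) := by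
        have h2 := key (i + 2)
        rw [show (-((i + 2 : ℕ) : ℤ)) = -(i : ℤ) - 2 by push_cast; ring] at h2
        have h3 := congrArg (· * D.lam i) h2
        simp only [add_mul, mul_assoc, π_mul_lam, pow_mul_lam] at h3
        rw [← mul_assoc D.e, ← pow_succ', h3]
        rw [show i + 2 - 1 = i + 1 by lia, mul_assoc, lower_mul_π_neg', pow_succ D.e (i + 1)]
        have := (Nat.cast_commute (i + 2) (D.e ^ (i + 1))).eq
        rw [add_mul, mul_add, ← mul_assoc _ _ (D.lam i), ← mul_assoc _ _ (D.lam i), this]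
        push_cast
        noncomm_ring
      rw [sub_mul, mul_assoc D.lower, h1, mul_assoc D.e, key, mul_add]
      have h4 : (D.e * (i * (D.e ^ (i - 1) * D.π (-i)))) = i * (D.e ^ i * D.π (-i)) := by
        rcases i with _ | i
        · simp
        · rw [← mul_assoc, ← (Nat.cast_commute (i + 1) D.e).eq, mul_assoc, ← mul_assoc D.e,
            Nat.add_sub_cancel, ← pow_succ']
      rw [h4, pow_succ']
      noncomm_ring
    have h5 : D.π i = D.e ^ i * D.π (-i) * D.g i := by
      rw [mul_assoc, ← g_mul_π, ← mul_assoc, pow_mul_g_mul_π]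
    rw [← sub_mul, h5, ← mul_assoc, h]
    push_cast
    noncomm_ring
  · rcases i with _ | i
    · have h := D.lower_mul_pow_mul_π 0
      simp at h
      simp [mul_assoc, h, add_mul]
    · have h : D.lower * D.e * D.π (-i - 2) = (D.e * D.lower + (i + 2)) * D.π (-i - 2) := by
        have h1 : D.e * D.π (-i - 2) = D.π (-i) * (D.e * D.π (-i - 2)) := by
          rw [← mul_assoc, show -(i : ℤ) = -i - 2 + 2 by ring, ← D.e_mul_π, mul_assoc]
          rw [show (-(i : ℤ) - 2 + 2 - 2) = -(i : ℤ) - 2 by ring, D.π_mul_self]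
        rw [mul_assoc, h1, ← mul_assoc, lower_mul_π_neg', mul_assoc, ← mul_assoc (D.lam i),
          lam_mul_e]
      rw [show -(((i + 1 : ℕ) : ℤ) + 1) = -(i : ℤ) - 2 by push_cast; ring, h]
      push_cast
      noncomm_ring

lemma isHom_lower : D.IsHom D.lower (-2) := by
  refine D.isHom_of_right fun p => ?_
  rw [mul_assoc, lower_mul_π]
  rcases p with (_ | i) | i
  · have := D.π_mul_lowerAux (r + 1) 0
    simp only [lowerAt, lowerNeg, Int.ofNat_eq_natCast]
    rw [← mul_assoc]
    congr 1
    simpa using this.symm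
  · have h := D.π_mul_lowerAux (r + 1) (i + 1)
    have h1 : D.π (i + 1 - 2) * D.e ^ (i + 1) * D.lowerNeg (i + 1) =
        D.e ^ (i + 1) * D.lowerNeg (i + 1) := by
      have h0 : D.e ^ (i + 1) * D.lowerAux (r + 1) (i + 1) =
          D.e ^ (i + 1) * D.π (-(i + 1 : ℕ) - 2) * D.lowerAux (r + 1) (i + 1) := by
        rw [mul_assoc, h]
      rw [lowerNeg, mul_assoc, h0, D.pow_mul_π, ← mul_assoc, ← mul_assoc]
      rw [show (-((i + 1 : ℕ) : ℤ) - 2 + 2 * (i + 1 : ℕ)) = (i : ℤ) + 1 - 2 by push_cast; ring,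
        D.π_mul_self]
    have h2 : D.e ^ i * D.π (-(i + 1 : ℕ)) = D.π (i + 1 - 2) * D.e ^ i := by
      rw [D.pow_mul_π]; congr 2; push_cast; ring
    have h3 : D.g (i + 1) * D.π (Int.ofNat (i + 1)) = D.π (-(i + 1 : ℕ)) * D.g (i + 1) :=
      D.g_mul_π (i + 1)
    have h4 := (Nat.cast_commute (i + 1) (D.π (i + 1 - 2))).eq
    push_cast at h4
    simp only [lowerAt]
    rw [show Int.ofNat (i + 1) + -2 = (i : ℤ) + 1 - 2 by simp; ring, mul_assoc _ (D.g _), h3,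
      add_mul, mul_add]
    congr 1
    · simp only [← mul_assoc]; rw [h1]
    · rw [← mul_assoc, ← mul_assoc, mul_assoc _ _ (D.π _), h2, ← mul_assoc (D.π _),
        ← h4, mul_assoc _ (D.π _) (D.π _ * _),
        ← mul_assoc (D.π _) (D.π _), D.π_mul_self]
  · have h := D.π_mul_lowerAux (r + 1) (i + 1)
    simp only [lowerAt, lowerNeg]
    rw [← mul_assoc, show Int.negSucc i + -2 = -((i + 1 : ℕ) : ℤ) - 2 by
      rw [Int.negSucc_eq]; push_cast; ring, h]

lemma lie_lie_lower {u : R} {d : ℤ} (hu : D.IsHom u d) :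
    ⁅D.e, ⁅D.lower, u⁆⁆ = ⁅D.lower, ⁅D.e, u⁆⁆ + d * u := by
  rw [leibniz_lie, add_comm]
  congr 1
  refine D.ext_right fun p => ?_
  have h1 : ⁅D.e, D.lower⁆ * u * D.π p = (p + d : ℤ) * (u * D.π p) := by
    rw [mul_assoc, hu, ← mul_assoc, lie_lower_mul_π, mul_assoc]
  rw [Ring.lie_def, sub_mul, h1, mul_assoc u, lie_lower_mul_π, ← mul_assoc u,
    ← (Int.cast_commute p u).eq]
  push_cast
  noncomm_ring

/-- The usual `sl₂` commutation formula for the adjoint action; `(n+1)(d+n)` is the sum of the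
weights `d, d+2, …, d+2n`. -/
lemma iterate_lie_lower {u : R} {d : ℤ} (hu : D.IsHom u d) (n : ℕ) :
    (fun x => ⁅D.e, x⁆)^[n + 1] ⁅D.lower, u⁆ = ⁅D.lower, (fun x => ⁅D.e, x⁆)^[n + 1] u⁆ +
      ((n + 1) * (d + n) : ℤ) • (fun x => ⁅D.e, x⁆)^[n] u := by
  have hadd : ∀ (n : ℕ) (x y : R), (fun x => ⁅D.e, x⁆)^[n] (x + y) =
      (fun x => ⁅D.e, x⁆)^[n] x + (fun x => ⁅D.e, x⁆)^[n] y := by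
    intro n
    induction n with
    | zero => intros; rfl
    | succ n ih => intro x y; rw [Function.iterate_succ_apply, lie_add, ih]; rfl
  have hsmul : ∀ (n : ℕ) (c : ℤ) (x : R), (fun x => ⁅D.e, x⁆)^[n] (c • x) =
      c • (fun x => ⁅D.e, x⁆)^[n] x := by
    intro n c
    induction n with
    | zero => intros; rfl
    | succ n ih => intro x; rw [Function.iterate_succ_apply, lie_zsmul, ih]; rfl
  induction n generalizing u d with
  | zero =>
    simp only [zero_add, Function.iterate_succ_apply, Function.iterate_zero, id]
    rw [D.lie_lie_lower hu]
    simp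
  | succ n ih =>
    rw [Function.iterate_succ_apply, D.lie_lie_lower hu, hadd, ih (D.isHom_e.lie D hu),
      ← zsmul_eq_mul, hsmul, ← Function.iterate_succ_apply, ← Function.iterate_succ_apply,
      add_assoc, ← add_smul]
    congr 2
    push_cast
    ring

/-- Hard Lefschetz for the adjoint action: `(ad e) ^ k` is injective in degree `-k`. -/
lemma eq_zero_of_iterate_lie [Module ℚ R] {u : R} {k : ℕ} (hk : 1 ≤ k) (hu : D.IsHom u (-k))
    (h : (fun x => ⁅D.e, x⁆)^[k] u = 0) : u = 0 := by
  -- Descending induction on the degree `-k`, which starts because nothing nonzero has degree below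
  -- `-2r`.
  obtain ⟨n, hn⟩ : ∃ n : ℕ, 2 * r < k + n := ⟨2 * r + 1, by lia⟩
  induction n using Nat.strong_induction_on generalizing u k with
  | _ n ih =>
    by_cases hkr : 2 * r < k
    · refine D.ext_right fun p => ?_
      rw [zero_mul]
      by_cases hp : p ∈ Finset.Icc (-r : ℤ) r
      · rw [hu, D.π_of_notMem _ (by rw [Finset.mem_Icc] at hp ⊢; lia), zero_mul]
      · rw [D.π_of_notMem _ hp, mul_zero]
    -- `[f, u]` has degree `-k-2` and is killed by `(ad e)^{k+2}`, since both terms of the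
    -- commutation formula contain `(ad e)^k u`. Thus `u` is a lowest weight vector.
    have hF : ⁅D.lower, u⁆ = 0 := by
      refine ih (n - 1) (by lia) (k := k + 2) (by lia) ?_ ?_ (by lia)
      · convert D.isHom_lower.lie D hu using 1
        push_cast
        ring
      · rw [D.iterate_lie_lower hu, Function.iterate_succ_apply', Function.iterate_succ_apply', h,
          lie_zero, lie_zero, lie_zero, smul_zero, add_zero]
    -- With `[f, u] = 0` the commutation formula reads `(n+1)(n-k) (ad e)^n u = 0` once `(ad
    -- e)^{n+1} u = 0`. For `n < k` the coefficient is nonzero, so one descends from `(ad e)^k u` to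
    -- `u`.
    have hd : ∀ j ≤ k, (fun x => ⁅D.e, x⁆)^[k - j] u = 0 := by
      intro j
      induction j with
      | zero => intro _; exact h
      | succ j ihj =>
        intro hj
        have h1 := D.iterate_lie_lower hu (k - (j + 1))
        rw [hF, show k - (j + 1) + 1 = k - j by lia, ihj (by lia),
          Function.iterate_fixed (lie_zero D.e), lie_zero, zero_add, eq_comm, ← Int.cast_smul_eq_zsmul ℚ,
          smul_eq_zero] at h1
        refine h1.resolve_left ?_
        refine Int.cast_ne_zero.2 ?_
        exact mul_ne_zero (by lia) (by lia)
    simpa using hd k le_rfl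

/-- The part of degree `d` of `u`. -/
def part (u : R) (d : ℤ) : R := ∑ p ∈ Finset.Icc (-r : ℤ) r, D.π (p + d) * u * D.π p

lemma part_mul_π (u : R) (d p : ℤ) : D.part u d * D.π p = D.π (p + d) * u * D.π p := by
  rw [part, Finset.sum_mul]
  by_cases hp : p ∈ Finset.Icc (-r : ℤ) r
  · rw [Finset.sum_eq_single_of_mem p hp, mul_assoc, D.π_mul_self]
    intro q _ hq
    rw [mul_assoc, D.π_mul_of_ne _ _ hq, mul_zero]
  · rw [D.π_of_notMem p hp]; simp

lemma isHom_part (u : R) (d : ℤ) : D.IsHom (D.part u d) d := D.isHom_of_right fun p => by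
  rw [mul_assoc, part_mul_π, ← mul_assoc, ← mul_assoc, D.π_mul_self]

lemma mul_eq_sum (x y : R) : x * y = ∑ p ∈ Finset.Icc (-r : ℤ) r, x * D.π p * y := by
  rw [← Finset.sum_mul, ← Finset.mul_sum, D.sum_π, mul_one]

lemma π_mul_e_mul_π (p q : ℤ) (h : q ≠ p + 2) : D.π q * D.e * D.π p = 0 := by
  rw [mul_assoc, D.e_mul_π, ← mul_assoc, D.π_mul_of_ne _ _ h, zero_mul]

/-- If a strictly lower triangular `n` conjugates `e` (through `1 + n`) to an element all of whose
parts of degree `1 - k` are killed by `(ad e) ^ k`, then `n = 0`. -/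
lemma eq_zero_of_conj [Module ℚ R] {n e' : R} (hn : ∀ p q, p ≤ q → D.π q * n * D.π p = 0)
    (he : (1 + n) * e' = D.e * (1 + n))
    (h : ∀ k : ℕ, (fun x => D.e * x - x * D.e)^[k] (D.part e' (1 - k)) = 0) : n = 0 := by
  have he' : e' = D.e + D.e * n - n * e' := by
    rw [mul_add, add_mul, mul_one, one_mul] at he
    rw [← he, add_sub_cancel_right]
  have hen : ∀ (p q a b : ℤ), q = a + 2 → b = p → D.π q * (D.e * n) * D.π p =
      D.e * (D.π a * n * D.π b) := by
    rintro p _ a _ rfl rfl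
    rw [← mul_assoc, ← D.e_mul_π]
    simp only [mul_assoc]
  have hcomp : ∀ p q, D.π q * e' * D.π p = D.π q * D.e * D.π p +
      D.e * (D.π (q - 2) * n * D.π p) -
        ∑ a ∈ Finset.Icc (-r : ℤ) r, D.π q * n * D.π a * (D.π a * e' * D.π p) := by
    intro p q
    conv_lhs => rw [he']
    have h1 : D.π q * (n * e') * D.π p = D.π q * n * (e' * D.π p) := by simp only [mul_assoc]
    rw [mul_sub, mul_add, sub_mul, add_mul, hen p q (q - 2) p (by ring) rfl, h1,
      D.mul_eq_sum (D.π q * n)]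
    congr 1
    refine Finset.sum_congr rfl fun a _ => ?_
    simp only [mul_assoc, ← mul_assoc (D.π a) (D.π a), D.π_mul_self]
  -- No parts of degree `> 2` in `e'`: descending induction on the target `q`, since in `n e'` the
  -- factor `n` only reaches `q` from some `a > q`.
  have hup : ∀ (m : ℕ) (p q : ℤ), r < q + m → p + 2 < q → D.π q * e' * D.π p = 0 := by
    intro m
    induction m with
    | zero =>
      intro p q hq _
      rw [D.π_of_notMem q (by rw [Finset.mem_Icc]; lia), zero_mul, zero_mul]
    | succ m ih =>
      intro p q hq hpq
      rw [hcomp, D.π_mul_e_mul_π _ _ (by lia), hn _ _ (by lia), mul_zero, add_zero, zero_sub,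
        neg_eq_zero]
      refine Finset.sum_eq_zero fun a _ => ?_
      rcases le_or_gt a q with haq | haq
      · rw [hn _ _ haq, zero_mul]
      · rw [ih p a (by push_cast at hq; lia) (by lia), mul_zero]
  have htwo : ∀ p, D.π (p + 2) * e' * D.π p = D.π (p + 2) * D.e * D.π p := by
    intro p
    rw [hcomp, hn _ _ (by lia), mul_zero, add_zero, sub_eq_self]
    refine Finset.sum_eq_zero fun a _ => ?_
    rcases le_or_gt a (p + 2) with haq | haq
    · rw [hn _ _ haq, zero_mul]
    · obtain ⟨m, hm⟩ : ∃ m : ℕ, r < a + m := ⟨(r + 1 - a).toNat, by lia⟩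
      rw [hup m p a hm haq, mul_zero]
  -- The parts of `n` are eliminated one degree at a time, from degree `0` downwards.
  have hlow : ∀ (k : ℕ) (p q : ℤ), p - k ≤ q → D.π q * n * D.π p = 0 := by
    intro k
    induction k with
    | zero => intro p q hpq; exact hn p q (by simpa using hpq)
    | succ k ih =>
      -- Compare parts of degree `1 - k` in `e' = e + e n - n e'`. In `n e'` only the intermediate
      -- weight `p + 2` survives: smaller ones need a part of `n` already known to vanish, larger
      -- ones a part of `e'` of degree `> 2`. In degree two, `e'` equals `e`.
      have hpart : D.part e' (1 - k) = ⁅D.e, D.part n (-(k + 1 : ℕ))⁆ := by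
        refine D.ext_right fun p => ?_
        rw [part_mul_π, hcomp, D.π_mul_e_mul_π _ _ (by lia), zero_add, Ring.lie_def, sub_mul,
          mul_assoc D.e, part_mul_π, mul_assoc _ D.e, D.e_mul_π, ← mul_assoc _ (D.π _), part_mul_π]
        rw [show p + (1 - (k : ℤ)) - 2 = p + -(k + 1 : ℕ) by push_cast; ring]
        congr 1
        have hterm : ∀ a : ℤ, a ≠ p + 2 →
            D.π (p + (1 - k)) * n * D.π a * (D.π a * e' * D.π p) = 0 := by
          intro a ha
          rcases le_or_gt a (p + 2) with haq | haq
          · rw [ih _ _ (by lia), zero_mul]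
          · obtain ⟨m, hm⟩ : ∃ m : ℕ, r < a + m := ⟨(r + 1 - a).toNat, by lia⟩
            rw [hup m p a hm haq, mul_zero]
        rw [show p + 2 + -((k + 1 : ℕ) : ℤ) = p + (1 - k) by push_cast; ring]
        have hval : D.π (p + (1 - k)) * n * D.π (p + 2) * (D.π (p + 2) * e' * D.π p) =
            D.π (p + (1 - k)) * n * D.π (p + 2) * D.e := by
          rw [htwo, mul_assoc (D.π (p + 2)), D.e_mul_π, ← mul_assoc (D.π (p + 2)), D.π_mul_self,
            ← mul_assoc, mul_assoc _ (D.π (p + 2)) (D.π (p + 2)), D.π_mul_self]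
        -- The surviving weight may lie outside `[-r, r]`, in which case its idempotent is zero.
        by_cases hp : p + 2 ∈ Finset.Icc (-r : ℤ) r
        · rw [Finset.sum_eq_single_of_mem _ hp (fun a _ ha => hterm a ha), hval]
        · rw [← hval, Finset.sum_eq_zero (fun a ha => hterm a (by rintro rfl; exact hp ha)),
            D.π_of_notMem _ hp]
          simp
      have h0 : D.part n (-(k + 1 : ℕ)) = 0 := by
        refine D.eq_zero_of_iterate_lie (by lia) (D.isHom_part _ _) ?_
        rw [Function.iterate_succ_apply, ← hpart]
        exact h k
      intro p q hpq
      rcases hpq.eq_or_lt with rfl | hlt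
      · rw [sub_eq_add_neg, ← part_mul_π, h0, zero_mul]
      · exact ih p q (by push_cast at hlt; lia)
  refine D.ext_right fun p => ?_
  rw [zero_mul, ← one_mul n, D.mul_eq_sum 1 n, Finset.sum_mul]
  refine Finset.sum_eq_zero fun q _ => ?_
  rw [one_mul]
  exact hlow (p - q).toNat p q (by lia)

end LefschetzData

/-! ### Decompositions of filtered objects and good splittings. -/

namespace FiltObj

section Decomposition

variable {C : Type u} [Category.{v} C] [Abelian C]

section GradedObject

variable (V : FiltObj C) (r : ℕ)

lemma gι_of_notMem {p : ℤ} (h : p ∉ Finset.Icc (-r : ℤ) r) : V.gι r p = 0 := dif_neg h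

lemma gπ_of_notMem {p : ℤ} (h : p ∉ Finset.Icc (-r : ℤ) r) : V.gπ r p = 0 := dif_neg h

lemma gι_gπ {p : ℤ} (h : p ∈ Finset.Icc (-r : ℤ) r) : V.gι r p ≫ V.gπ r p = 𝟙 _ := by
  rw [gι, gπ, dif_pos h, dif_pos h, biproduct.ι_π_self]

lemma gι_gπ_of_ne {p q : ℤ} (h : p ≠ q) : V.gι r p ≫ V.gπ r q = 0 := by
  by_cases hp : p ∈ Finset.Icc (-r : ℤ) r
  · by_cases hq : q ∈ Finset.Icc (-r : ℤ) r
    · rw [gι, gπ, dif_pos hp, dif_pos hq]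
      exact biproduct.ι_π_ne _ (by simpa using h)
    · rw [gπ_of_notMem _ _ hq, comp_zero]
  · rw [gι_of_notMem _ _ hp, zero_comp]

lemma sum_gπ_gι : ∑ p ∈ Finset.Icc (-r : ℤ) r, V.gπ r p ≫ V.gι r p = 𝟙 (V.graded r).X := by
  rw [← Finset.sum_coe_sort]
  refine Eq.trans ?_ (biproduct.total (f := fun q : Finset.Icc (-r : ℤ) r => V.gr q))
  refine Finset.sum_congr rfl fun p _ => ?_
  rw [gι, gπ, dif_pos p.2, dif_pos p.2]

lemma gι_proj (p : ℤ) : V.gι r p ≫ V.gπ r p ≫ V.gι r p = V.gι r p := by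
  by_cases hp : p ∈ Finset.Icc (-r : ℤ) r
  · rw [← Category.assoc, gι_gπ _ _ hp, Category.id_comp]
  · rw [gι_of_notMem _ _ hp, zero_comp]

lemma gι_proj_of_ne {p q : ℤ} (h : p ≠ q) : V.gι r p ≫ V.gπ r q ≫ V.gι r q = 0 := by
  rw [← Category.assoc, gι_gπ_of_ne _ _ h, zero_comp]

lemma proj_gπ_assoc (p : ℤ) {Y : C} (f : V.gr p ⟶ Y) :
    V.gπ r p ≫ V.gι r p ≫ V.gπ r p ≫ f = V.gπ r p ≫ f := by
  by_cases hp : p ∈ Finset.Icc (-r : ℤ) r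
  · rw [← Category.assoc (V.gι r p), gι_gπ _ _ hp, Category.id_comp]
  · rw [gπ_of_notMem _ _ hp, zero_comp, zero_comp]

variable {V r} in
lemma graded_hom_ext {Y : C} {f g : (V.graded r).X ⟶ Y}
    (h : ∀ p ∈ Finset.Icc (-r : ℤ) r, V.gι r p ≫ f = V.gι r p ≫ g) : f = g := by
  rw [← Category.id_comp f, ← Category.id_comp g, ← V.sum_gπ_gι r, Preadditive.sum_comp,
    Preadditive.sum_comp]
  refine Finset.sum_congr rfl fun p hp => ?_
  rw [Category.assoc, Category.assoc, h p hp]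

lemma graded_factors_gι {p q : ℤ} (h : p ≤ q) : ((V.graded r).F q).Factors (V.gι r p) := by
  by_cases hp : p ∈ Finset.Icc (-r : ℤ) r
  · have hmem : (⟨p, hp⟩ : Finset.Icc (-r : ℤ) r) ∈
        Finset.univ.filter (fun p : Finset.Icc (-r : ℤ) r => (p : ℤ) ≤ q) := by simpa using h
    refine Subobject.factors_of_le _ (Finset.le_sup (f := fun p => Subobject.mk
      (biproduct.ι (fun q : Finset.Icc (-r : ℤ) r => V.gr q) p)) hmem) ?_
    rw [gι, dif_pos hp]
    exact Subobject.mk_factors_self _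
  · rw [gι_of_notMem _ _ hp]
    exact Subobject.factors_zero

lemma graded_arrow_gπ {p q : ℤ} (h : q < p) : ((V.graded r).F q).arrow ≫ V.gπ r p = 0 := by
  have hle : (V.graded r).F q ≤ kernelSubobject (V.gπ r p) := by
    have h0 : (V.graded r).F q = (Finset.univ.filter
        (fun p : Finset.Icc (-r : ℤ) r => (p : ℤ) ≤ q)).sup
          (fun p => Subobject.mk (biproduct.ι (fun q : Finset.Icc (-r : ℤ) r => V.gr q) p)) := rfl
    rw [h0]
    refine Finset.sup_le fun a ha => ?_
    refine Subobject.mk_le_of_comm (factorThruKernelSubobject _ _ ?_)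
      (factorThruKernelSubobject_comp_arrow _ _ _)
    have h1 := V.gι_gπ_of_ne r (p := a) (q := p) (by
      have : (a : ℤ) ≤ q := by simpa using ha
      lia)
    rwa [gι, dif_pos a.2] at h1
  rw [← Subobject.ofLE_arrow hle, Category.assoc, kernelSubobject_arrow_comp, comp_zero]

end GradedObject

/-- A decomposition of a filtered object: objects `A p`, `p ∈ [-r, r]`, such that `W` is the direct
sum of the `A p` placed in position `p`. -/
structure Decomp (W : FiltObj C) (r : ℕ) where
  A : ℤ → C
  s : ∀ p, A p ⟶ W.X
  t : ∀ p, W.X ⟶ A p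
  s_t : ∀ p ∈ Finset.Icc (-r : ℤ) r, s p ≫ t p = 𝟙 _
  s_t_of_ne : ∀ p q, p ≠ q → s p ≫ t q = 0
  s_of_notMem : ∀ p, p ∉ Finset.Icc (-r : ℤ) r → s p = 0
  t_of_notMem : ∀ p, p ∉ Finset.Icc (-r : ℤ) r → t p = 0
  sum_t_s : ∑ p ∈ Finset.Icc (-r : ℤ) r, t p ≫ s p = 𝟙 _
  factors : ∀ p, (W.F p).Factors (s p)
  arrow_t : ∀ p q, q < p → (W.F q).arrow ≫ t p = 0

namespace Decomp

variable {W : FiltObj C} {r : ℕ} (D : W.Decomp r)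

lemma hom_ext_right {T : C} {x y : T ⟶ W.X} (h : ∀ p ∈ Finset.Icc (-r : ℤ) r, x ≫ D.t p = y ≫ D.t p) :
    x = y := by
  rw [← Category.comp_id x, ← Category.comp_id y, ← D.sum_t_s, Preadditive.comp_sum,
    Preadditive.comp_sum]
  refine Finset.sum_congr rfl fun p hp => ?_
  rw [← Category.assoc, ← Category.assoc, h p hp]

lemma hom_ext_left {T : C} {x y : W.X ⟶ T} (h : ∀ p ∈ Finset.Icc (-r : ℤ) r, D.s p ≫ x = D.s p ≫ y) :
    x = y := by
  rw [← Category.id_comp x, ← Category.id_comp y, ← D.sum_t_s, Preadditive.sum_comp,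
    Preadditive.sum_comp]
  refine Finset.sum_congr rfl fun p hp => ?_
  rw [Category.assoc, Category.assoc, h p hp]

lemma factors_of_sum {X : C} (P : Subobject X) {T : C} {ι : Type*} (S : Finset ι) (f : ι → (T ⟶ X))
    (h : ∀ i ∈ S, P.Factors (f i)) : P.Factors (∑ i ∈ S, f i) := by
  classical
  induction S using Finset.induction_on with
  | empty => rw [Finset.sum_empty]; exact Subobject.factors_zero
  | insert a S ha ih =>
    rw [Finset.sum_insert ha]
    exact Subobject.factors_add _ _ (h _ (by simp)) (ih fun i hi => h i (by simp [hi]))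

/-- A decomposition makes the filtration explicit: `F_q` is the sum of the `A_p` with `p ≤ q`, so
membership is the vanishing of the higher components. -/
lemma factors_iff {T : C} (x : T ⟶ W.X) (q : ℤ) :
    (W.F q).Factors x ↔ ∀ p ∈ Finset.Icc (-r : ℤ) r, q < p → x ≫ D.t p = 0 := by
  constructor
  · intro h p _ hp
    rw [← Subobject.factorThru_arrow _ _ h, Category.assoc, D.arrow_t _ _ hp, comp_zero]
  · intro h
    rw [← Category.comp_id x, ← D.sum_t_s, Preadditive.comp_sum]
    refine factors_of_sum _ _ _ fun p hp => ?_
    rcases lt_or_ge q p with hpq | hpq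
    · rw [← Category.assoc, h p hp hpq, zero_comp]
      exact Subobject.factors_zero
    · rw [← Category.assoc]
      exact Subobject.factors_of_factors_right _ (Subobject.factors_of_le _ (W.mono hpq) (D.factors p))

/-- The arrow `W_p ⟶ A_p`. -/
def grHom (p : ℤ) : W.gr p ⟶ D.A p :=
  cokernel.desc _ ((W.F p).arrow ≫ D.t p) (by
    rw [← Category.assoc, Subobject.ofLE_arrow, D.arrow_t _ _ (by lia)])

/-- The arrow `A_p ⟶ W_p`. -/
def grInv (p : ℤ) : D.A p ⟶ W.gr p := (W.F p).factorThru _ (D.factors p) ≫ W.grπ p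

lemma grπ_grHom (p : ℤ) : W.grπ p ≫ D.grHom p = (W.F p).arrow ≫ D.t p := cokernel.π_desc _ _ _

lemma grInv_grHom {p : ℤ} (hp : p ∈ Finset.Icc (-r : ℤ) r) : D.grInv p ≫ D.grHom p = 𝟙 _ := by
  rw [grInv, Category.assoc, grπ_grHom, Subobject.factorThru_arrow_assoc, D.s_t p hp]

lemma grπ_eq_zero_of_factors (W : FiltObj C) {T : C} (p : ℤ) (x : T ⟶ (W.F p : C))
    (h : (W.F (p - 1)).Factors (x ≫ (W.F p).arrow)) : x ≫ W.grπ p = 0 := by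
  have : x = (W.F (p - 1)).factorThru _ h ≫ Subobject.ofLE _ _ (W.mono (by lia)) := by
    rw [← cancel_mono (W.F p).arrow]; simp
  rw [this, Category.assoc]
  exact (congrArg _ (cokernel.condition _)).trans comp_zero

/-- No range condition is needed here: for `p` outside `[-r, r]` the arrow `t p` is zero, and the
identity then says `W_p = 0`. The other composite does need the range, because `A p` is
unconstrained outside it. -/
lemma grHom_grInv (p : ℤ) : D.grHom p ≫ D.grInv p = 𝟙 _ := by
  rw [← cancel_epi (W.grπ p), ← Category.assoc, grπ_grHom, Category.comp_id, grInv,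
    ← Category.assoc, ← sub_eq_zero]
  nth_rw 2 [← Category.id_comp (W.grπ p)]
  rw [← Preadditive.sub_comp]
  apply grπ_eq_zero_of_factors
  rw [D.factors_iff]
  intro q hq hpq
  rw [Preadditive.sub_comp, Preadditive.sub_comp, Category.assoc _ _ (W.F p).arrow,
    Subobject.factorThru_arrow, Category.id_comp]
  rcases eq_or_ne p q with rfl | hne
  · simp only [Category.assoc, D.s_t p hq, Category.comp_id, sub_self]
  · simp only [Category.assoc, D.s_t_of_ne _ _ hne, D.arrow_t q p (by lia), comp_zero, sub_zero]

/-- The isomorphism `W_p ≅ A_p`. -/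
@[simps]
def grIso {p : ℤ} (hp : p ∈ Finset.Icc (-r : ℤ) r) : W.gr p ≅ D.A p where
  hom := D.grHom p
  inv := D.grInv p
  hom_inv_id := D.grHom_grInv p
  inv_hom_id := D.grInv_grHom hp

include D in
lemma isZero_gr {p : ℤ} (hp : p ∉ Finset.Icc (-r : ℤ) r) : IsZero (W.gr p) := by
  rw [IsZero.iff_id_eq_zero, ← D.grHom_grInv p, ← cancel_epi (W.grπ p), ← Category.assoc,
    grπ_grHom, D.t_of_notMem p hp]
  simp

include D in
lemma hasType : W.HasType (-r) r := fun _ hp =>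
  isZero_gr D (by rwa [Finset.mem_Icc])

/-- The good splitting defined by a decomposition. -/
def splitting : W.graded r ≅ W where
  hom := Hom.mk (V := W.graded r) (∑ p ∈ Finset.Icc (-r : ℤ) r, W.gπ r p ≫ D.grHom p ≫ D.s p)
    (fun q => by
      rw [Preadditive.comp_sum]
      refine factors_of_sum _ _ _ fun p _ => ?_
      rcases lt_or_ge q p with hpq | hpq
      · rw [← Category.assoc, W.graded_arrow_gπ r hpq, zero_comp]
        exact Subobject.factors_zero
      · rw [← Category.assoc, ← Category.assoc]
        exact Subobject.factors_of_factors_right _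
          (Subobject.factors_of_le _ (W.mono hpq) (D.factors p)))
  inv := Hom.mk (W := W.graded r) (∑ p ∈ Finset.Icc (-r : ℤ) r, D.t p ≫ D.grInv p ≫ W.gι r p)
    (fun q => by
      rw [Preadditive.comp_sum]
      refine factors_of_sum _ _ _ fun p _ => ?_
      rcases lt_or_ge q p with hpq | hpq
      · rw [← Category.assoc, D.arrow_t _ _ hpq, zero_comp]
        exact Subobject.factors_zero
      · rw [← Category.assoc, ← Category.assoc]
        exact Subobject.factors_of_factors_right _ (W.graded_factors_gι r hpq))
  hom_inv_id := Hom.ext (by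
    change (∑ p ∈ Finset.Icc (-r : ℤ) r, W.gπ r p ≫ D.grHom p ≫ D.s p) ≫
      (∑ p ∈ Finset.Icc (-r : ℤ) r, D.t p ≫ D.grInv p ≫ W.gι r p) = 𝟙 (W.graded r).X
    rw [← W.sum_gπ_gι r, Preadditive.sum_comp]
    refine Finset.sum_congr rfl fun p hp => ?_
    rw [Preadditive.comp_sum, Finset.sum_eq_single_of_mem p hp]
    · have := reassoc_of% (D.s_t p hp)
      have h2 := reassoc_of% (D.grHom_grInv p)
      simp only [Category.assoc, this, h2]
    · intro q _ hq
      have := reassoc_of% (D.s_t_of_ne p q hq.symm)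
      simp only [Category.assoc, this, zero_comp, comp_zero])
  inv_hom_id := Hom.ext (by
    change (∑ p ∈ Finset.Icc (-r : ℤ) r, D.t p ≫ D.grInv p ≫ W.gι r p) ≫
      (∑ p ∈ Finset.Icc (-r : ℤ) r, W.gπ r p ≫ D.grHom p ≫ D.s p) = 𝟙 W.X
    rw [← D.sum_t_s, Preadditive.sum_comp]
    refine Finset.sum_congr rfl fun p hp => ?_
    rw [Preadditive.comp_sum, Finset.sum_eq_single_of_mem p hp]
    · have := reassoc_of% (W.gι_gπ r hp)
      have h2 := reassoc_of% (D.grInv_grHom hp)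
      simp only [Category.assoc, this, h2]
    · intro q _ hq
      have := reassoc_of% (W.gι_gπ_of_ne r hq.symm)
      simp only [Category.assoc, this, zero_comp, comp_zero])

lemma gι_splitting_hom (p : ℤ) : W.gι r p ≫ D.splitting.hom.f = D.grHom p ≫ D.s p := by
  change W.gι r p ≫ (∑ p ∈ Finset.Icc (-r : ℤ) r, W.gπ r p ≫ D.grHom p ≫ D.s p) = _
  by_cases hp : p ∈ Finset.Icc (-r : ℤ) r
  · rw [Preadditive.comp_sum, Finset.sum_eq_single_of_mem p hp]
    · rw [← Category.assoc, W.gι_gπ r hp, Category.id_comp]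
    · intro q _ hq
      rw [← Category.assoc, W.gι_gπ_of_ne r hq.symm, zero_comp]
  · rw [gι_of_notMem _ _ hp, D.s_of_notMem _ hp, comp_zero, zero_comp]

lemma splitting_inv_gπ (p : ℤ) : D.splitting.inv.f ≫ W.gπ r p = D.t p ≫ D.grInv p := by
  change (∑ p ∈ Finset.Icc (-r : ℤ) r, D.t p ≫ D.grInv p ≫ W.gι r p) ≫ W.gπ r p = _
  by_cases hp : p ∈ Finset.Icc (-r : ℤ) r
  · rw [Preadditive.sum_comp, Finset.sum_eq_single_of_mem p hp]
    · simp only [Category.assoc, W.gι_gπ r hp, Category.comp_id]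
    · intro q _ hq
      simp only [Category.assoc, W.gι_gπ_of_ne r hq, comp_zero]
  · rw [gπ_of_notMem _ _ hp, D.t_of_notMem _ hp, comp_zero, zero_comp]

lemma isGood_splitting : IsGood D.splitting := fun p _ =>
  ⟨D.grHom p ≫ (W.F p).factorThru _ (D.factors p), by
    rw [gι_splitting_hom, Category.assoc, Subobject.factorThru_arrow], by
    rw [Category.assoc]; exact D.grHom_grInv p⟩

end Decomp

section Good

variable {V : FiltObj C} {r : ℕ} (φ : V.graded r ≅ V)

/-- The component `V_p ⟶ V` of a splitting. -/
def sec (p : ℤ) : V.gr p ⟶ V.X := V.gι r p ≫ φ.hom.f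

/-- The component `V ⟶ V_p` of the inverse of a splitting. -/
def ret (p : ℤ) : V.X ⟶ V.gr p := φ.inv.f ≫ V.gπ r p

lemma hom_inv_f : φ.hom.f ≫ φ.inv.f = 𝟙 _ := congrArg Hom.f φ.hom_inv_id

lemma inv_hom_f : φ.inv.f ≫ φ.hom.f = 𝟙 _ := congrArg Hom.f φ.inv_hom_id

lemma sec_ret {p : ℤ} (hp : p ∈ Finset.Icc (-r : ℤ) r) : sec φ p ≫ ret φ p = 𝟙 _ := by
  have := reassoc_of% hom_inv_f φ
  rw [sec, ret, Category.assoc, this, V.gι_gπ r hp]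

lemma sec_ret_of_ne {p q : ℤ} (h : p ≠ q) : sec φ p ≫ ret φ q = 0 := by
  have := reassoc_of% hom_inv_f φ
  rw [sec, ret, Category.assoc, this, V.gι_gπ_of_ne r h]

lemma splitting_ext {φ ψ : V.graded r ≅ V}
    (h : ∀ p ∈ Finset.Icc (-r : ℤ) r, sec φ p = sec ψ p) : φ = ψ :=
  Iso.ext (Hom.ext (graded_hom_ext h))

variable {φ}

lemma sec_inv (p : ℤ) : sec φ p ≫ φ.inv.f = V.gι r p := by
  rw [sec, Category.assoc, hom_inv_f, Category.comp_id]

lemma sec_of_notMem {p : ℤ} (hp : p ∉ Finset.Icc (-r : ℤ) r) : sec φ p = 0 := by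
  rw [sec, gι_of_notMem _ _ hp, zero_comp]

lemma ret_of_notMem {p : ℤ} (hp : p ∉ Finset.Icc (-r : ℤ) r) : ret φ p = 0 := by
  rw [ret, gπ_of_notMem _ _ hp, comp_zero]

variable (hφ : IsGood φ)

include hφ in
lemma factors_sec (p : ℤ) : (V.F p).Factors (sec φ p) := by
  by_cases hp : p ∈ Finset.Icc (-r : ℤ) r
  · obtain ⟨g, hg, -⟩ := hφ p hp
    exact (Subobject.factors_iff _ _).2 ⟨g, hg⟩
  · rw [sec, gι_of_notMem _ _ hp, zero_comp]
    exact Subobject.factors_zero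

lemma arrow_ret (p q : ℤ) (h : q < p) : (V.F q).arrow ≫ ret φ p = 0 := by
  rw [ret, ← Category.assoc, ← Subobject.factorThru_arrow _ _ (φ.inv.factors q), Category.assoc,
    V.graded_arrow_gπ r h, comp_zero]

/-- The decomposition defined by a good splitting. -/
abbrev IsGood.decomp : V.Decomp r where
  A := V.gr
  s := sec φ
  t := ret φ
  s_t _ hp := sec_ret φ hp
  s_t_of_ne _ _ h := sec_ret_of_ne φ h
  s_of_notMem p hp := by rw [sec, gι_of_notMem _ _ hp, zero_comp]
  t_of_notMem p hp := by rw [ret, gπ_of_notMem _ _ hp, comp_zero]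
  sum_t_s := by
    have h : ∀ p, ret φ p ≫ sec φ p = φ.inv.f ≫ (V.gπ r p ≫ V.gι r p) ≫ φ.hom.f := by
      intro p; simp only [sec, ret, Category.assoc]
    rw [Finset.sum_congr rfl fun p _ => h p, ← Preadditive.comp_sum, ← Preadditive.sum_comp,
      V.sum_gπ_gι r, Category.id_comp, inv_hom_f]
  factors := factors_sec hφ
  arrow_t := arrow_ret

include hφ in
-- The retraction side of goodness, which is what makes the isomorphisms `W_p ≅ A_p` of the
-- associated decomposition identities.
lemma arrow_ret_self {p : ℤ} (hp : p ∈ Finset.Icc (-r : ℤ) r) :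
    (V.F p).arrow ≫ ret φ p = V.grπ p := by
  obtain ⟨g, hg, hg'⟩ := hφ p hp
  have h1 : g ≫ V.grπ p ≫ hφ.decomp.grHom p = 𝟙 _ := by
    rw [Decomp.grπ_grHom]
    erw [← Category.assoc, hg]
    exact sec_ret φ hp
  rw [← Category.assoc, hg', Category.id_comp] at h1
  rw [← Category.comp_id (V.grπ p), ← h1]
  exact (hφ.decomp.grπ_grHom p).symm

lemma IsGood.grHom_decomp {p : ℤ} (hp : p ∈ Finset.Icc (-r : ℤ) r) :
    hφ.decomp.grHom p = 𝟙 _ := by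
  rw [← cancel_epi (V.grπ p), Category.comp_id]
  exact (hφ.decomp.grπ_grHom p).trans (arrow_ret_self hφ hp)

lemma IsGood.grInv_decomp {p : ℤ} (hp : p ∈ Finset.Icc (-r : ℤ) r) :
    hφ.decomp.grInv p = 𝟙 _ := by
  have := hφ.decomp.grHom_grInv p
  rwa [hφ.grHom_decomp hp, Category.id_comp] at this

include hφ in
lemma sec_toQuot (p : ℤ) (hp : p ∈ Finset.Icc (-r : ℤ) r) :
    sec φ p ≫ V.toQuot p = V.grToQuot p := by
  obtain ⟨g, hg, hg'⟩ := hφ p hp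
  rw [sec, ← hg, Category.assoc, ← grπ_grToQuot, ← Category.assoc, hg', Category.id_comp]

end Good

end Decomposition

section Shift

variable {C : Type u} [Category.{v} C] [Abelian C] [HasShift C ℤ]
  {V W : FiltObj C} {r r' : ℕ} (D : V.Decomp r) (D' : W.Decomp r') {n m : ℤ}

lemma grπ_grMap (l : V ⟶ W.twist n m) (p q : ℤ) (h : n + p = q) :
    V.grπ p ≫ Hom.grMap l p q h = Hom.filMap l p q h ≫ (W.grπ q)⟦m⟧' :=
  cokernel.π_desc _ _ _

/-- The induced arrow on graded pieces is the corresponding matrix entry of `l`; this replaces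
computations with quotients by computations with components. -/
lemma Decomp.grMap_eq (l : V ⟶ W.twist n m) (p q : ℤ) (h : n + p = q) :
    Hom.grMap l p q h = D.grHom p ≫ D.s p ≫ l.f ≫ (D'.t q)⟦m⟧' ≫ (D'.grInv q)⟦m⟧' := by
  have h1 : D.grInv p ≫ Hom.grMap l p q h ≫ (D'.grHom q)⟦m⟧' = D.s p ≫ l.f ≫ (D'.t q)⟦m⟧' := by
    rw [grInv, Category.assoc, ← Category.assoc (V.grπ p), grπ_grMap, Category.assoc,
      ← Functor.map_comp, D'.grπ_grHom, Functor.map_comp, ← Category.assoc (Hom.filMap l p q h),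
      Hom.filMap_arrow, Category.assoc, Subobject.factorThru_arrow_assoc]
  have h2 := congrArg (fun x => D.grHom p ≫ x ≫ (D'.grInv q)⟦m⟧') h1
  simp only [Category.assoc, ← Functor.map_comp, D'.grHom_grInv] at h2
  rw [← Category.assoc, D.grHom_grInv, Category.id_comp] at h2
  simpa using h2

lemma grMap_eq_of_isGood (hV : V.HasType (-r) r) (hW : W.HasType (-r') r') {φ : V.graded r ≅ V}
    {ψ : W.graded r' ≅ W} (hφ : IsGood φ) (hψ : IsGood ψ) (l : V ⟶ W.twist n m) (p q : ℤ)
    (h : n + p = q) : Hom.grMap l p q h = sec φ p ≫ l.f ≫ (ret ψ q)⟦m⟧' := by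
  by_cases hp : p ∈ Finset.Icc (-r : ℤ) r
  · by_cases hq : q ∈ Finset.Icc (-r' : ℤ) r'
    · rw [hφ.decomp.grMap_eq hψ.decomp, hφ.grHom_decomp hp, hψ.grInv_decomp hq, CategoryTheory.Functor.map_id,
        Category.id_comp]
      exact congrArg _ (congrArg _ (Category.comp_id _))
    · exact ((shiftFunctor C m).map_isZero (hW q (by rwa [← Finset.mem_Icc]))).eq_of_tgt _ _
  · exact (hV p (by rwa [← Finset.mem_Icc])).eq_of_src _ _

end Shift

lemma sec_ret_of_isGood {C : Type u} [Category.{v} C] [Abelian C] {V : FiltObj C} {r : ℕ}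
    {φ ψ : V.graded r ≅ V} (hφ : IsGood φ) (hψ : IsGood ψ) {p : ℤ}
    (hp : p ∈ Finset.Icc (-r : ℤ) r) : sec ψ p ≫ ret φ p = 𝟙 _ := by
  obtain ⟨g, hg, hg'⟩ := hψ p hp
  rw [sec, ← hg, Category.assoc, arrow_ret_self hφ hp, hg']

end FiltObj

/-! ### Shifted composition, iterates of `e`, and homogeneous splittings. -/

namespace FiltObj

section ShiftedComp

variable {C : Type u} [Category.{v} C] [HasShift C ℤ] {X Y Z T : C}

lemma shiftedHom_comp_map {a b c : ℤ} (f : ShiftedHom X Y a) (g : ShiftedHom Y Z b) (z : Z ⟶ T)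
    (h : b + a = c) :
    ShiftedHom.comp f (g ≫ z⟦b⟧' : ShiftedHom Y T b) h = ShiftedHom.comp f g h ≫ z⟦c⟧' := by
  simp only [ShiftedHom.comp, Functor.map_comp, Category.assoc]
  congr 2
  exact (shiftFunctorAdd' C b a c h).inv.naturality z

lemma shiftedHom_map_comp {a b c : ℤ} (f : ShiftedHom X Y a) (y : Y ⟶ Z) (g : ShiftedHom Z T b)
    (h : b + a = c) :
    ShiftedHom.comp (f ≫ y⟦a⟧' : ShiftedHom X Z a) g h = ShiftedHom.comp f (y ≫ g) h := by
  simp only [ShiftedHom.comp, Functor.map_comp, Category.assoc]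

lemma comp_shiftedHom_comp {a b c : ℤ} (x : X ⟶ Y) (f : ShiftedHom Y Z a) (g : ShiftedHom Z T b)
    (h : b + a = c) :
    ShiftedHom.comp (x ≫ f : ShiftedHom X Z a) g h = x ≫ ShiftedHom.comp f g h := by
  simp only [ShiftedHom.comp, Category.assoc]

end ShiftedComp

variable {C : Type u} [Category.{v} C] [Abelian C] [HasShift C ℤ]

section Pow

variable {V : FiltObj C} (e : V ⟶ V.twist 2 1)

lemma pow_zero_f : (pow e 0).f = ShiftedHom.mk₀ _ rfl (𝟙 V.X) := rfl

lemma pow_succ_f (k : ℕ) : (pow e (k + 1)).f =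
    ShiftedHom.comp (pow e k).f e.f (by push_cast; ring) := rfl

/-- The iterates are defined by adding `e` at the end; peeling it off at the start is needed for
restrictions to `V_p` and for passing to the opposite category. -/
lemma pow_succ_f' (k : ℕ) : (pow e (k + 1)).f =
    ShiftedHom.comp e.f (pow e k).f (by push_cast; ring) := by
  induction k with
  | zero =>
    rw [pow_succ_f, pow_zero_f]
    have h1 := ShiftedHom.mk₀_id_comp ((0 : ℕ) : ℤ) rfl (X := V.X) (Y := V.X) (a := (1 : ℤ)) e.f
    have h2 := ShiftedHom.comp_mk₀_id (X := V.X) (Y := V.X) (a := (1 : ℤ)) e.f ((0 : ℕ) : ℤ) rfl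
    exact h1.trans h2.symm
  | succ k ih =>
    rw [pow_succ_f, ih, ShiftedHom.comp_assoc _ _ _ _ (a₂₃ := ((k + 1 : ℕ) : ℤ))
      (by push_cast; ring) (by push_cast; ring), ← pow_succ_f, ← ih]

end Pow

section Homogeneous

variable {V : FiltObj C} {r : ℕ} {e : V ⟶ V.twist 2 1} {φ : V.graded r ≅ V}

/-- A splitting with respect to which `e` is homogeneous of degree two. -/
def IsHomogeneous (e : V ⟶ V.twist 2 1) (φ : V.graded r ≅ V) : Prop :=
  ∀ p q, q ≠ p + 2 → sec φ p ≫ e.f ≫ (ret φ q)⟦(1 : ℤ)⟧' = 0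

variable [∀ n : ℤ, (shiftFunctor C n).Additive]

lemma Decomp.sum_shift {W : FiltObj C} (D : W.Decomp r) (m : ℤ) :
    ∑ p ∈ Finset.Icc (-r : ℤ) r, (D.t p)⟦m⟧' ≫ (D.s p)⟦m⟧' = 𝟙 (W.X⟦m⟧) := by
  simp only [← Functor.map_comp]
  rw [← Functor.map_sum, D.sum_t_s, CategoryTheory.Functor.map_id]

lemma Decomp.hom_ext_shift {W : FiltObj C} (D : W.Decomp r) (m : ℤ) {T : C} {x y : T ⟶ W.X⟦m⟧}
    (h : ∀ p ∈ Finset.Icc (-r : ℤ) r, x ≫ (D.t p)⟦m⟧' = y ≫ (D.t p)⟦m⟧') : x = y := by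
  rw [← Category.comp_id x, ← Category.comp_id y, ← D.sum_shift m, Preadditive.comp_sum,
    Preadditive.comp_sum]
  refine Finset.sum_congr rfl fun p hp => ?_
  rw [← Category.assoc, ← Category.assoc, h p hp]

lemma shift_isZero (hV : V.HasType (-r) r) {p : ℤ} (hp : p ∉ Finset.Icc (-r : ℤ) r) (m : ℤ) :
    IsZero ((V.gr p)⟦m⟧) :=
  (shiftFunctor C m).map_isZero (hV p (by rwa [← Finset.mem_Icc]))

variable (hV : V.HasType (-r) r) (hφ : IsGood φ)

include hV hφ

/-- To identify a graded map it is enough to factor `sec φ p ≫ l` through `sec φ q`: the factor is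
then forced. Powers of `e` are handled by producing such factors inductively. -/
lemma grMap_eq_of_sec_comp {n m : ℤ} (l : V ⟶ V.twist n m) (p q : ℤ) (h : n + p = q)
    {y : V.gr p ⟶ (V.gr q)⟦m⟧} (hy : sec φ p ≫ l.f = y ≫ (sec φ q)⟦m⟧') :
    Hom.grMap l p q h = y := by
  by_cases hq : q ∈ Finset.Icc (-r : ℤ) r
  · rw [grMap_eq_of_isGood hV hV hφ hφ, ← Category.assoc, hy, Category.assoc, ← Functor.map_comp,
      sec_ret φ hq, CategoryTheory.Functor.map_id, Category.comp_id]
  · exact (shift_isZero hV hq m).eq_of_tgt _ _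

lemma sec_comp_of_exists {n m : ℤ} (l : V ⟶ V.twist n m) (p q : ℤ) (h : n + p = q)
    (H : ∃ y : V.gr p ⟶ (V.gr q)⟦m⟧, sec φ p ≫ l.f = y ≫ (sec φ q)⟦m⟧') :
    sec φ p ≫ l.f = Hom.grMap l p q h ≫ (sec φ q)⟦m⟧' := by
  obtain ⟨y, hy⟩ := H
  rw [grMap_eq_of_sec_comp hV hφ l p q h hy, hy]

lemma grMap_pow_zero (p : ℤ) : Hom.grMap (pow e 0) p p (by simp) =
    (shiftFunctorZero' C ((0 : ℕ) : ℤ) rfl).inv.app _ := by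
  refine grMap_eq_of_sec_comp hV hφ _ _ _ _ ?_
  rw [pow_zero_f, ShiftedHom.mk₀, Category.id_comp]
  exact (shiftFunctorZero' C ((0 : ℕ) : ℤ) rfl).inv.naturality (sec φ p)

variable (he : IsHomogeneous e φ)

include he

lemma sec_e (p q : ℤ) (h : 2 + p = q) :
    sec φ p ≫ e.f = Hom.grMap e p q h ≫ (sec φ q)⟦(1 : ℤ)⟧' := by
  refine hφ.decomp.hom_ext_shift 1 fun a ha => ?_
  rw [grMap_eq_of_isGood hV hV hφ hφ]
  simp only [Category.assoc, ← Functor.map_comp]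
  by_cases haq : a = q
  · subst haq
    rw [sec_ret φ ha, Category.comp_id]
  · rw [sec_ret_of_ne φ (Ne.symm haq), he p a (by lia), comp_zero, Functor.map_zero, comp_zero, comp_zero]

lemma sec_pow (k : ℕ) (p q : ℤ) (h : 2 * k + p = q) :
    sec φ p ≫ (pow e k).f = Hom.grMap (pow e k) p q h ≫ (sec φ q)⟦(k : ℤ)⟧' := by
  refine sec_comp_of_exists hV hφ _ _ _ _ ?_
  induction k generalizing q with
  | zero =>
    obtain rfl : p = q := by simpa using h
    refine ⟨(shiftFunctorZero' C ((0 : ℕ) : ℤ) rfl).inv.app _, ?_⟩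
    rw [pow_zero_f, ShiftedHom.mk₀, Category.id_comp]
    exact (shiftFunctorZero' C ((0 : ℕ) : ℤ) rfl).inv.naturality (sec φ p)
  | succ k ih =>
    obtain ⟨y, hy⟩ := ih (q - 2) (by push_cast at h ⊢; lia)
    refine ⟨ShiftedHom.comp y (Hom.grMap e (q - 2) q (by ring)) (by push_cast; ring), ?_⟩
    rw [pow_succ_f]
    refine (comp_shiftedHom_comp _ _ _ _).symm.trans ?_
    rw [hy, shiftedHom_map_comp, sec_e hV hφ he (q - 2) q (by ring), shiftedHom_comp_map]

lemma grMap_pow_succ (k : ℕ) (p p' q : ℤ) (h : 2 + p = p') (h' : 2 * k + p' = q) :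
    Hom.grMap (pow e (k + 1)) p q (by push_cast; lia) =
      ShiftedHom.comp (Hom.grMap e p p' h) (Hom.grMap (pow e k) p' q h') (by push_cast; ring) := by
  refine grMap_eq_of_sec_comp hV hφ _ _ _ _ ?_
  rw [pow_succ_f']
  refine (comp_shiftedHom_comp _ _ _ _).symm.trans ?_
  rw [sec_e hV hφ he p p' h, shiftedHom_map_comp, sec_pow hV hφ he k p' q h',
    shiftedHom_comp_map]

/-- The transpose of `sec_pow`: homogeneity lets the component of `e^k` in `V_q` see only `V_p`. -/
lemma pow_ret (k : ℕ) (p q : ℤ) (h : 2 * k + p = q) :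
    (pow e k).f ≫ (ret φ q)⟦(k : ℤ)⟧' = ret φ p ≫ Hom.grMap (pow e k) p q h := by
  refine hφ.decomp.hom_ext_left fun a ha => ?_
  rw [← Category.assoc, sec_pow hV hφ he k a (2 * k + a) rfl, Category.assoc, ← Functor.map_comp,
    ← Category.assoc]
  by_cases hap : a = p
  · subst hap
    subst h
    change _ = (sec φ a ≫ ret φ a) ≫ _
    rw [sec_ret φ ha, Category.id_comp]
    by_cases hq : 2 * k + a ∈ Finset.Icc (-r : ℤ) r
    · rw [sec_ret φ hq, CategoryTheory.Functor.map_id, Category.comp_id]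
    · exact (shift_isZero hV hq _).eq_of_tgt _ _
  · change _ = (sec φ a ≫ ret φ p) ≫ _
    rw [sec_ret_of_ne φ hap, sec_ret_of_ne φ (by lia), Functor.map_zero, comp_zero, zero_comp]

end Homogeneous

/-! ### Primitive parts and the first Deligne splitting. -/

section Primitive

variable [∀ n : ℤ, (shiftFunctor C n).Additive]
  {V : FiltObj C} {r : ℕ} {e : V ⟶ V.twist 2 1} {φ : V.graded r ≅ V}
  (hV : V.HasType (-r) r) (hφ : IsGood φ) (he : IsHomogeneous e φ) (hL : HL e)

include hV hφ he

/-- Along a homogeneous splitting `e^s` kills `P_{-i}` inside `V` itself for `s > i`, not merely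
after projection to `V_{≥ s}`. -/
lemma isDeligneLift_of_eq (i : ℕ) (f : trivialAt (prim e i) (-i) ⟶ V)
    (hf : f.f = kernel.ι _ ≫ sec φ (-i)) : IsDeligneLift e i f := by
  refine ⟨?_, fun s hs => ?_⟩
  · rw [hf, Category.assoc]
    by_cases hi : (-i : ℤ) ∈ Finset.Icc (-r : ℤ) r
    · rw [sec_toQuot hφ _ hi]
    · rw [(hV _ (by rwa [← Finset.mem_Icc])).eq_of_src (sec φ (-i) ≫ V.toQuot (-i))]
  · have h : f.f ≫ (pow e s).f = 0 := by
      induction s, hs using Nat.le_induction with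
      | base =>
        rw [hf, Category.assoc, sec_pow hV hφ he (i + 1) (-i) (i + 2) (by push_cast; ring),
          kernel.condition_assoc, zero_comp]
      | succ s hs ih =>
        rw [pow_succ_f]
        refine (comp_shiftedHom_comp _ _ _ _).symm.trans ?_
        rw [ih, ShiftedHom.zero_comp]
    rw [← Category.assoc, h, zero_comp]

/-- The Deligne lift of a primitive part. -/
def deligneLift (e : V ⟶ V.twist 2 1) (hφ : IsGood φ) (i : ℕ) :
    trivialAt (prim e i) (-i) ⟶ V :=
  Hom.mk (V := trivialAt (prim e i) (-i)) (kernel.ι _ ≫ sec φ (-i)) (fun p => by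
    by_cases h : -(i : ℤ) ≤ p
    · refine Subobject.factors_of_factors_right _ (Subobject.factors_of_factors_right _ ?_)
      exact Subobject.factors_of_le _ (V.mono h) (factors_sec hφ _)
    · have h0 : ((trivialAt (prim e i) (-i)).F p).arrow = 0 := by
        have h1 : (trivialAt (prim e i) (-i)).F p = ⊥ := if_neg h
        exact (Subobject.bot_factors_iff_zero _).1 (h1 ▸ Subobject.factors_self _)
      rw [h0, zero_comp]
      exact Subobject.factors_zero)

include hL

lemma eq_of_isDeligneLift (i : ℕ) (f : trivialAt (prim e i) (-i) ⟶ V)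
    (hf : IsDeligneLift e i f) : f.f = kernel.ι _ ≫ sec φ (-i) := by
  obtain ⟨hf1, hf2⟩ := hf
  have hfac : (V.F (-i)).Factors f.f := by
    have h1 := f.factors (-i)
    have h2 : (trivialAt (prim e i) (-i)).F (-i) = ⊤ := if_pos le_rfl
    have : IsIso ((trivialAt (prim e i) (-i)).F (-i)).arrow :=
      (Subobject.isIso_arrow_iff_eq_top _).2 h2
    have h3 := Subobject.factors_of_factors_right
      (inv ((trivialAt (prim e i) (-i)).F (-i)).arrow) h1
    rwa [IsIso.inv_hom_id_assoc] at h3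
  refine hφ.decomp.hom_ext_right fun q hq => ?_
  change f.f ≫ ret φ q = (kernel.ι _ ≫ sec φ (-i)) ≫ ret φ q
  rw [Category.assoc]
  rcases lt_trichotomy q (-i) with hlt | rfl | hgt
  · obtain ⟨s, rfl⟩ : ∃ s : ℕ, q = -s := ⟨(-q).toNat, by lia⟩
    rw [sec_ret_of_ne φ hlt.ne', comp_zero]
    have h1 := hf2 s (by lia)
    have h2 : (V.F (s - 1)).arrow ≫ ret φ s = 0 := arrow_ret _ _ (by lia)
    have h3 : ret φ s = V.toQuot s ≫ cokernel.desc _ _ h2 := (cokernel.π_desc _ _ _).symm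
    have h4 : f.f ≫ (pow e s).f ≫ (ret φ s)⟦(s : ℤ)⟧' = 0 := by
      rw [h3, Functor.map_comp, ← Category.assoc, ← Category.assoc, Category.assoc f.f, h1,
        zero_comp]
    have := hL s
    rw [pow_ret hV hφ he s (-s) s (by ring), ← Category.assoc] at h4
    exact (cancel_mono (Hom.grMap (pow e s) (-s) s (by ring))).1 (h4.trans zero_comp.symm)
  · rw [sec_ret φ hq]
    have h1 : (V.F (-i)).factorThru _ hfac ≫ V.grπ (-i) = kernel.ι _ := by
      rw [← cancel_mono (V.grToQuot (-i)), Category.assoc, grπ_grToQuot,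
        Subobject.factorThru_arrow_assoc, hf1]
    rw [Category.comp_id, ← h1, ← arrow_ret_self hφ hq, Subobject.factorThru_arrow_assoc]
  -- Above `-i`: `f` is filtered and its source sits in position `-i`.
  · rw [sec_ret_of_ne φ hgt.ne, comp_zero, ← Subobject.factorThru_arrow _ _ hfac, Category.assoc,
      arrow_ret _ _ hgt, comp_zero]

/-- The images of the primitive parts under the iterates of `e` generate the graded pieces. -/
lemma eq_zero_of_prim {Y : C} (Δ : ∀ p, V.gr p ⟶ Y)
    (hΔ : ∀ i j : ℕ, j ≤ i → kernel.ι (Hom.grMap (pow e (i + 1)) (-i) (i + 2) (by push_cast; ring)) ≫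
      Hom.grMap (pow e j) (-i) (-i + 2 * j) (by ring) ≫ (Δ (-i + 2 * j))⟦(j : ℤ)⟧' = 0) (p : ℤ) :
    Δ p = 0 := by
  -- Descending induction on `i`, through `V_{-i} = P_{-i} + e V_{-i-2}`. The induction hypothesis,
  -- used with `j + 1` at `i + 2`, gives vanishing on the image of `e`.
  have key : ∀ n i : ℕ, r < i + n → ∀ j ≤ i, ∀ q h,
      Hom.grMap (pow e j) (-i) q h ≫ (Δ q)⟦(j : ℤ)⟧' = 0 := by
    intro n
    induction n with
    | zero =>
      intro i hi j _ q h
      exact (hV (-i) (by lia)).eq_of_src _ _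
    | succ n ih =>
      intro i hi j hj q h
      have hq : q = -i + 2 * j := by lia
      have hι := hΔ i j hj
      subst hq
      set x := Hom.grMap (pow e j) (-i) (-i + 2 * j) h ≫ (Δ (-i + 2 * j))⟦(j : ℤ)⟧' with hx
      have hex : Hom.grMap e (-(i + 2 : ℕ)) (-i) (by push_cast; ring) ≫ x⟦(1 : ℤ)⟧' = 0 := by
        have h1 := ih (i + 2) (by lia) (j + 1) (by lia) (-i + 2 * j) (by push_cast; ring)
        rw [grMap_pow_succ hV hφ he j (-(i + 2 : ℕ)) (-i) _ (by push_cast; ring) h,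
          ← shiftedHom_comp_map, ShiftedHom.comp, ← hx, ← Category.assoc] at h1
        rwa [Preadditive.IsIso.comp_right_eq_zero] at h1
      let y := Hom.grMap (pow e (i + 1)) (-i) (i + 2) (by push_cast; ring)
      -- The composite is `e^{i+2}` on `V_{-i-2}`, so HL makes `y = e^{i+1}` epi on `V_{-i}`. As `x`
      -- vanishes on `Ker y = P_{-i}`, it factors through `y`, and the factor is zero because it is
      -- zero after this isomorphism.
      have hiso : IsIso (Hom.grMap e (-(i + 2 : ℕ)) (-i) (by push_cast; ring) ≫ y⟦(1 : ℤ)⟧') := by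
        have h1 := hL (i + 2)
        have h2 := grMap_pow_succ hV hφ he (i + 1) (-(i + 2 : ℕ)) (-i) ((i + 2 : ℕ) : ℤ)
          (by push_cast; ring) (by push_cast; ring)
        rw [h2, ShiftedHom.comp, ← Category.assoc] at h1
        exact (isIso_comp_right_iff _ _).1 h1
      have hepi1 : Epi (y⟦(1 : ℤ)⟧') := epi_of_epi (Hom.grMap e (-(i + 2 : ℕ)) (-i) _) _
      have hepi : Epi y := (shiftFunctor C (1 : ℤ)).epi_of_epi_map hepi1
      have hz : Abelian.epiDesc y x hι = 0 := by
        refine (shiftFunctor C (1 : ℤ)).map_injective ?_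
        rw [← cancel_epi (Hom.grMap e (-(i + 2 : ℕ)) (-i) _ ≫ y⟦(1 : ℤ)⟧'), Category.assoc,
          ← Functor.map_comp, Abelian.comp_epiDesc, hex, Functor.map_zero, comp_zero]
      rw [← Abelian.comp_epiDesc y x hι, hz, comp_zero]
  have key' : ∀ i j : ℕ, j ≤ i → ∀ q h, Hom.grMap (pow e j) (-i) q h ≫ (Δ q)⟦(j : ℤ)⟧' = 0 :=
    fun i j hij q h => key (r + 1) i (by lia) j hij q h
  -- Every weight is reached from `V_{-i}` by an isomorphism: `e^i` onto `V_i` (`j = i`), or the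
  -- identity of `V_{-i}` (`j = 0`).
  obtain ⟨i, rfl | rfl⟩ : ∃ i : ℕ, p = i ∨ p = -i := ⟨p.natAbs, by lia⟩
  · have h1 := key' i i le_rfl i (by ring)
    have := hL i
    refine (shiftFunctor C (i : ℤ)).map_injective ?_
    rw [← cancel_epi (Hom.grMap (pow e i) (-i) i (by ring)), h1, Functor.map_zero, comp_zero]
  · have h1 := key' i 0 (Nat.zero_le _) (-i) (by simp)
    rw [grMap_pow_zero hV hφ] at h1
    refine (shiftFunctor C ((0 : ℕ) : ℤ)).map_injective ?_
    rw [Functor.map_zero]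
    exact (cancel_epi ((shiftFunctorZero' C ((0 : ℕ) : ℤ) rfl).inv.app (V.gr (-i)))).1
      (h1.trans comp_zero.symm)

theorem isPhiI_iff (ψ : V.graded r ≅ V) : IsPhiI e ψ ↔ ψ = φ := by
  constructor
  · rintro ⟨f, hf, h⟩
    refine splitting_ext fun p _ => ?_
    rw [← sub_eq_zero]
    refine eq_zero_of_prim hV hφ he hL (fun p => sec ψ p - sec φ p) (fun i j hij => ?_) p
    have h1 := h i j hij
    rw [eq_of_isDeligneLift hV hφ he hL i (f i) (hf i), Category.assoc,
      sec_pow hV hφ he j (-i) (-i + 2 * j) (by ring)] at h1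
    rw [Functor.map_sub, Preadditive.comp_sub, Preadditive.comp_sub, sub_eq_zero]
    exact h1
  · rintro rfl
    refine ⟨deligneLift e hφ, fun i => isDeligneLift_of_eq hV hφ he i _ rfl, fun i j _ => ?_⟩
    have h1 := sec_pow hV hφ he j (-i) (-i + 2 * j) (by ring)
    change _ = (kernel.ι _ ≫ sec ψ (-i)) ≫ (pow e j).f
    rw [Category.assoc, h1]
    rfl

end Primitive

end FiltObj

/-! ### Shifted arrows as endomorphisms of a `ℚ`-vector space. -/

namespace FiltObj

section Act

variable {C : Type u} [Category.{v} C] [Abelian C] [Linear ℚ C] [HasShift C ℤ] (T : C) {A B D : C}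

/-- The action by composition of a shifted arrow `A ⟶ B⟦n⟧` on the families of arrows
`T ⟶ A⟦m⟧`. -/
def act {n : ℤ} (f : ShiftedHom A B n) :
    (∀ m : ℤ, ShiftedHom T A m) →ₗ[ℚ] (∀ m : ℤ, ShiftedHom T B m) where
  toFun x m := ShiftedHom.comp (x (m - n)) f (by ring)
  map_add' x y := by ext m; exact ShiftedHom.add_comp _ _ _ _
  map_smul' c x := by ext m; exact ShiftedHom.smul_comp _ _ _ _

lemma act_apply {n : ℤ} (f : ShiftedHom A B n) (x : ∀ m : ℤ, ShiftedHom T A m) (m : ℤ) :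
    act T f x m = ShiftedHom.comp (x (m - n)) f (by ring) := rfl

lemma act_apply_of_eq {n : ℤ} (f : ShiftedHom A B n) (x : ∀ m : ℤ, ShiftedHom T A m) (m k : ℤ)
    (h : n + k = m) : act T f x m = ShiftedHom.comp (x k) f h := by
  obtain rfl : k = m - n := by lia
  rfl

/-- Arrows of different degrees live in different types; acting on families over all `m` places the
endomorphisms of all degrees in one ring. The order is reversed because shifted composition is
written from left to right. -/
lemma act_comp {a b c : ℤ} (f : ShiftedHom A B a) (g : ShiftedHom B D b) (h : b + a = c) :
    act T (ShiftedHom.comp f g h) = act T g ∘ₗ act T f := by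
  refine LinearMap.ext fun x => funext fun m => ?_
  rw [LinearMap.comp_apply, act_apply, act_apply_of_eq T g _ m (m - b) (by ring),
    act_apply_of_eq T f x (m - b) (m - c) (by lia),
    ShiftedHom.comp_assoc _ _ _ _ h (by lia)]

lemma act_precomp {a : ℤ} (f : A ⟶ B) (g : ShiftedHom B D a) :
    act T (f ≫ g : ShiftedHom A D a) = act T g ∘ₗ act T (ShiftedHom.mk₀ (0 : ℤ) rfl f) := by
  rw [← ShiftedHom.mk₀_comp (0 : ℤ) rfl f g, act_comp]

lemma act_postcomp {a : ℤ} (f : ShiftedHom A B a) (g : B ⟶ D) :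
    act T (f ≫ g⟦a⟧' : ShiftedHom A D a) = act T (ShiftedHom.mk₀ (0 : ℤ) rfl g) ∘ₗ act T f := by
  rw [← ShiftedHom.comp_mk₀ f (0 : ℤ) rfl g, act_comp]

lemma act_mk₀_comp (f : A ⟶ B) (g : B ⟶ D) :
    act T (ShiftedHom.mk₀ (0 : ℤ) rfl (f ≫ g)) =
      act T (ShiftedHom.mk₀ (0 : ℤ) rfl g) ∘ₗ act T (ShiftedHom.mk₀ (0 : ℤ) rfl f) := by
  rw [← act_comp _ _ _ (add_zero 0), ShiftedHom.mk₀_comp_mk₀]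

lemma act_id (m : ℤ) (hm : m = 0) : act T (ShiftedHom.mk₀ m hm (𝟙 A)) = LinearMap.id := by
  refine LinearMap.ext fun x => funext fun k => ?_
  rw [act_apply_of_eq T _ x k k (by lia)]
  exact ShiftedHom.comp_mk₀_id _ _ _

/-- Yoneda: with `T = A`, evaluate at the family concentrated in degree `0` with value the identity.
-/
lemma act_injective {n : ℤ} {f g : ShiftedHom A B n} (h : act A f = act A g) : f = g := by
  have h1 := congrFun (LinearMap.congr_fun h
    (fun m => if hm : m = 0 then ShiftedHom.mk₀ m hm (𝟙 A) else 0)) n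
  rw [act_apply_of_eq A f _ n 0 (add_zero n), act_apply_of_eq A g _ n 0 (add_zero n)] at h1
  simpa using h1

variable [∀ n : ℤ, (shiftFunctor C n).Additive]

/-- `act` as an additive map. -/
def actHom (A B : C) (n : ℤ) : ShiftedHom A B n →+
    ((∀ m : ℤ, ShiftedHom T A m) →ₗ[ℚ] (∀ m : ℤ, ShiftedHom T B m)) where
  toFun := act T
  map_zero' := LinearMap.ext fun _ => funext fun _ => ShiftedHom.comp_zero _ _ _
  map_add' _ _ := LinearMap.ext fun _ => funext fun _ => ShiftedHom.comp_add _ _ _ _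

lemma act_zero (n : ℤ) : act T (0 : ShiftedHom A B n) = 0 := (actHom T A B n).map_zero

lemma act_sub {n : ℤ} (f g : ShiftedHom A B n) : act T (f - g) = act T f - act T g :=
  (actHom T A B n).map_sub f g

lemma act_sum {n : ℤ} {ι : Type*} (S : Finset ι) (f : ι → ShiftedHom A B n) :
    act T (∑ i ∈ S, f i) = ∑ i ∈ S, act T (f i) :=
  map_sum (actHom T A B n) f S

end Act

/-- Shifting the inverse of `a` gives a one-sided inverse `b`; the other identity follows by
cancelling `a` in `(a b) a = a (b a)`. -/
lemma exists_shiftedHom_inv {C : Type u} [Category.{v} C] [HasShift C ℤ] {A B : C} {k : ℤ}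
    (a : ShiftedHom A B k) [IsIso a] : ∃ b : ShiftedHom B A (-k),
      ShiftedHom.comp a b (by ring) = ShiftedHom.mk₀ (0 : ℤ) rfl (𝟙 A) ∧
      ShiftedHom.comp b a (by ring) = ShiftedHom.mk₀ (0 : ℤ) rfl (𝟙 B) := by
  let b : ShiftedHom B A (-k) := ShiftedHom.mk₀ (0 : ℤ) rfl (𝟙 B) ≫
    (shiftFunctorAdd' C k (-k) 0 (by ring)).hom.app B ≫ (inv a)⟦-k⟧'
  have hb : ShiftedHom.comp b a (by ring) = ShiftedHom.mk₀ (0 : ℤ) rfl (𝟙 B) := by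
    simp only [ShiftedHom.comp, b, Category.assoc]
    rw [← Functor.map_comp_assoc, IsIso.inv_hom_id, CategoryTheory.Functor.map_id]
    simp
  refine ⟨b, ?_, hb⟩
  have h1 : ShiftedHom.comp (ShiftedHom.comp a b (show -k + k = 0 by ring)) a (add_zero k) =
      ShiftedHom.comp (ShiftedHom.mk₀ (0 : ℤ) rfl (𝟙 A)) a (add_zero k) := by
    rw [ShiftedHom.comp_assoc a b a _ (show k + -k = 0 by ring) (by ring), hb,
      ShiftedHom.mk₀_id_comp, ShiftedHom.comp_mk₀_id]
  unfold ShiftedHom.comp at h1 ⊢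
  exact (cancel_mono (a⟦(0 : ℤ)⟧' ≫ (shiftFunctorAdd' C k 0 k (add_zero k)).inv.app _)).1 h1

/-! ### The matrix of `e` and the third Deligne splitting. -/

section Homogeneous

variable {C : Type u} [Category.{v} C] [Abelian C] [HasShift C ℤ]
  {V : FiltObj C} {r : ℕ} {e : V ⟶ V.twist 2 1} {φ : V.graded r ≅ V}

lemma gι_homPart {m : ℤ} (u : ShiftedHom (V.graded r).X (V.graded r).X m) (d p : ℤ) :
    V.gι r p ≫ homPart V r u d =
      V.gι r p ≫ u ≫ (V.gπ r (p + d) ≫ V.gι r (p + d))⟦m⟧' := by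
  rw [homPart, Preadditive.comp_sum]
  by_cases hp : p ∈ Finset.Icc (-r : ℤ) r
  · rw [Finset.sum_eq_single_of_mem p hp]
    · rw [← Category.assoc, V.gι_gπ r hp, Category.id_comp]
    · intro q _ hq
      rw [← Category.assoc, V.gι_gπ_of_ne r hq.symm, zero_comp]
  · simp [gι_of_notMem _ _ hp]

lemma gι_matrix_gπ (p q : ℤ) : V.gι r p ≫ matrix e φ ≫ (V.gπ r q)⟦(1 : ℤ)⟧' =
    sec φ p ≫ e.f ≫ (ret φ q)⟦(1 : ℤ)⟧' := by
  simp only [matrix, sec, ret, Category.assoc, Functor.map_comp]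

variable [∀ n : ℤ, (shiftFunctor C n).Additive]

lemma IsEGood.isHomogeneous (h : IsEGood e φ) : IsHomogeneous e φ := by
  intro p q hpq
  rw [← gι_matrix_gπ, h.2, ← Category.assoc, gι_homPart, Category.assoc, Category.assoc,
    ← Functor.map_comp, Category.assoc, V.gι_gπ_of_ne r (Ne.symm hpq), comp_zero, Functor.map_zero,
    comp_zero, comp_zero]

lemma homPart_homPart {m : ℤ} (u : ShiftedHom (V.graded r).X (V.graded r).X m) {d d' : ℤ}
    (h : d ≠ d') : homPart V r (homPart V r u d) d' = 0 := by
  refine graded_hom_ext fun p _ => ?_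
  rw [gι_homPart, ← Category.assoc, gι_homPart, Category.assoc, Category.assoc, ← Functor.map_comp]
  have : (V.gπ r (p + d) ≫ V.gι r (p + d)) ≫ V.gπ r (p + d') ≫ V.gι r (p + d') = 0 := by
    have := reassoc_of% V.gι_gπ_of_ne r (show p + d ≠ p + d' by lia)
    rw [Category.assoc, this, zero_comp, comp_zero]
  rw [this, Functor.map_zero, comp_zero, comp_zero]

lemma adPow_zero {m : ℤ} (k : ℕ) :
    adPow e r (0 : ShiftedHom (V.graded r).X (V.graded r).X m) k = 0 := by
  induction k with
  | zero => exact ShiftedHom.zero_comp _ _ _ _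
  | succ k ih => rw [adPow, ih, ShiftedHom.zero_comp, ShiftedHom.comp_zero, sub_zero]

/-- The degrees tested are `1 - k`, never `2`, so the parts to be killed are already zero. -/
lemma IsEGood.isPhiIII (h : IsEGood e φ) : IsPhiIII e φ := by
  refine ⟨h.1, fun k => ?_⟩
  rw [h.2, homPart_homPart _ (by lia), adPow_zero]

variable (hV : V.HasType (-r) r) (hφ : IsGood φ) (he : IsHomogeneous e φ)

include hV hφ he

lemma gι_matrix (p : ℤ) : V.gι r p ≫ matrix e φ =
    Hom.grMap e p (p + 2) (by ring) ≫ (V.gι r (p + 2))⟦(1 : ℤ)⟧' := by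
  rw [matrix, ← Category.assoc, ← Category.assoc]
  erw [sec_e hV hφ he p (p + 2) (by ring)]
  rw [Category.assoc, ← Functor.map_comp, sec_inv]

lemma gι_conj_pow (k : ℕ) (p q : ℤ) (h : 2 * k + p = q) :
    V.gι r p ≫ φ.hom.f ≫ (pow e k).f ≫ φ.inv.f⟦(k : ℤ)⟧' =
      Hom.grMap (pow e k) p q h ≫ (V.gι r q)⟦(k : ℤ)⟧' := by
  rw [← Category.assoc, ← Category.assoc]
  erw [sec_pow hV hφ he k p q h]
  rw [Category.assoc, ← Functor.map_comp, sec_inv]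

/-- The arrow `ē` in the definition of `φ_III` is the matrix of `e` for the homogeneous splitting,
so `ẽ(ψ)` is conjugate to `ē` for every splitting `ψ`. -/
lemma gradedE_eq : gradedE e r = matrix e φ := by
  refine graded_hom_ext fun p hp => ?_
  rw [gι_matrix hV hφ he, gradedE, Preadditive.comp_sum, Finset.sum_eq_single_of_mem p hp]
  · rw [← Category.assoc, V.gι_gπ r hp, Category.id_comp]
  · intro q _ hq
    rw [← Category.assoc, V.gι_gπ_of_ne r hq.symm, zero_comp]

lemma matrix_comp_proj (p : ℤ) : (V.gπ r p ≫ V.gι r p) ≫ matrix e φ =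
    matrix e φ ≫ (V.gπ r (p + 2) ≫ V.gι r (p + 2))⟦(1 : ℤ)⟧' := by
  refine graded_hom_ext fun a _ => ?_
  have h1 : V.gι r a ≫ matrix e φ ≫ (V.gπ r (p + 2) ≫ V.gι r (p + 2))⟦(1 : ℤ)⟧' =
      Hom.grMap e a (a + 2) (by ring) ≫
        (V.gι r (a + 2) ≫ V.gπ r (p + 2) ≫ V.gι r (p + 2))⟦(1 : ℤ)⟧' := by
    rw [Functor.map_comp _ (V.gι r (a + 2)), ← Category.assoc, ← Category.assoc]
    exact congrArg (· ≫ _) (gι_matrix hV hφ he a)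
  refine Eq.trans ?_ h1.symm
  rw [← Category.assoc]
  rcases eq_or_ne a p with rfl | hne
  · rw [gι_proj, gι_proj, gι_matrix hV hφ he]
  · rw [gι_proj_of_ne _ _ hne, gι_proj_of_ne _ _ (by lia), Functor.map_zero, comp_zero, zero_comp]

end Homogeneous

section Adjoint

variable {C : Type u} [Category.{v} C] [Abelian C] [Linear ℚ C] [HasShift C ℤ]
  [∀ n : ℤ, (shiftFunctor C n).Additive]
  {V : FiltObj C} {r : ℕ} {e : V ⟶ V.twist 2 1} {φ : V.graded r ≅ V}

lemma act_homPart {m : ℤ} (u : ShiftedHom (V.graded r).X (V.graded r).X m) (d : ℤ) (T : C) :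
    act T (homPart V r u d) = ∑ p ∈ Finset.Icc (-r : ℤ) r,
      act T (ShiftedHom.mk₀ (0 : ℤ) rfl (V.gπ r (p + d) ≫ V.gι r (p + d))) ∘ₗ act T u ∘ₗ
        act T (ShiftedHom.mk₀ (0 : ℤ) rfl (V.gπ r p ≫ V.gι r p)) := by
  rw [homPart, act_sum]
  refine Finset.sum_congr rfl fun p _ => ?_
  rw [← act_precomp, ← act_postcomp]
  simp only [Category.assoc]

lemma act_adPow {m : ℤ} (u : ShiftedHom (V.graded r).X (V.graded r).X m) (k : ℕ) (T : C) :
    act T (adPow e r u k) = (fun x : Module.End ℚ (∀ m : ℤ, ShiftedHom T (V.graded r).X m) =>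
      act T (gradedE e r) * x - x * act T (gradedE e r))^[k] (act T u) := by
  induction k with
  | zero =>
    rw [adPow, act_comp, act_id]
    rfl
  | succ k ih => rw [adPow, act_sub, act_comp, act_comp, Function.iterate_succ_apply', ih]; rfl

variable (hV : V.HasType (-r) r) (hφ : IsGood φ) (he : IsHomogeneous e φ) (hL : HL e)

include hV hφ he

lemma act_pow (T : C) (k : ℕ) :
    (act T (gradedE e r) : Module.End ℚ (∀ m : ℤ, ShiftedHom T (V.graded r).X m)) ^ k =
      act T (φ.hom.f ≫ (pow e k).f ≫ φ.inv.f⟦(k : ℤ)⟧' :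
        ShiftedHom (V.graded r).X (V.graded r).X (k : ℤ)) := by
  induction k with
  | zero =>
    have h1 : (φ.hom.f ≫ (pow e 0).f ≫ φ.inv.f⟦((0 : ℕ) : ℤ)⟧' :
        ShiftedHom (V.graded r).X (V.graded r).X ((0 : ℕ) : ℤ)) =
        ShiftedHom.mk₀ _ rfl (𝟙 _) := by
      rw [← hom_inv_f φ, pow_zero_f, ShiftedHom.mk₀, ShiftedHom.mk₀, Category.id_comp,
        Category.assoc]
      exact congrArg _ ((shiftFunctorZero' C ((0 : ℕ) : ℤ) rfl).inv.naturality φ.inv.f).symm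
    rw [pow_zero, h1]
    exact (act_id T _ _).symm
  | succ k ih =>
    have h1 : (φ.hom.f ≫ (pow e (k + 1)).f ≫ φ.inv.f⟦((k + 1 : ℕ) : ℤ)⟧' :
        ShiftedHom (V.graded r).X (V.graded r).X ((k + 1 : ℕ) : ℤ)) =
        ShiftedHom.comp (matrix e φ) (φ.hom.f ≫ (pow e k).f ≫ φ.inv.f⟦(k : ℤ)⟧' :
          ShiftedHom (V.graded r).X (V.graded r).X (k : ℤ)) (by push_cast; ring) := by
      have h2 : (matrix e φ : ShiftedHom (V.graded r).X (V.graded r).X (1 : ℤ)) =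
          (φ.hom.f ≫ e.f) ≫ φ.inv.f⟦(1 : ℤ)⟧' := (Category.assoc _ _ _).symm
      rw [h2, shiftedHom_map_comp]
      have h3 : φ.inv.f ≫ φ.hom.f ≫ (pow e k).f ≫ φ.inv.f⟦(k : ℤ)⟧' =
          (pow e k).f ≫ φ.inv.f⟦(k : ℤ)⟧' := by
        rw [← Category.assoc, inv_hom_f, Category.id_comp]
      rw [h3, shiftedHom_comp_map, pow_succ_f', ← Category.assoc]
      congr 1
      exact (comp_shiftedHom_comp _ _ _ _).symm
    rw [_root_.pow_succ, ih, h1, act_comp, gradedE_eq hV hφ he]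
    rfl

include hL

/-- The bridge to the ring-theoretic part: projectors onto the `V_p`, the operator `ē`, and the
inverses of `e^k` supplied by HL as arrows of degree `-k`. -/
lemma exists_lefschetzData (T : C) :
    ∃ D : LefschetzData (Module.End ℚ (∀ m : ℤ, ShiftedHom T (V.graded r).X m)) r,
      D.e = act T (gradedE e r) ∧
      ∀ p, D.π p = act T (ShiftedHom.mk₀ (0 : ℤ) rfl (V.gπ r p ≫ V.gι r p)) := by
  have hinv : ∀ k : ℕ, ∃ b : ShiftedHom (V.gr k) (V.gr (-k)) (-(k : ℤ)),
      ShiftedHom.comp (Hom.grMap (pow e k) (-k) k (by ring)) b (by ring) =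
        ShiftedHom.mk₀ (0 : ℤ) rfl (𝟙 _) ∧
      ShiftedHom.comp b (Hom.grMap (pow e k) (-k) k (by ring)) (by ring) =
        ShiftedHom.mk₀ (0 : ℤ) rfl (𝟙 _) := by
    intro k
    have := hL k
    exact exists_shiftedHom_inv _
  choose b hb hb' using hinv
  let G (k : ℕ) : ShiftedHom (V.graded r).X (V.graded r).X (-(k : ℤ)) :=
    V.gπ r k ≫ b k ≫ (V.gι r (-k))⟦-(k : ℤ)⟧'
  let P (p : ℤ) : ShiftedHom (V.graded r).X (V.graded r).X (0 : ℤ) :=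
    ShiftedHom.mk₀ (0 : ℤ) rfl (V.gπ r p ≫ V.gι r p)
  have hmk : ∀ {A : C} (x : (V.graded r).X ⟶ A) (y : A ⟶ (V.graded r).X),
      x ≫ ShiftedHom.mk₀ (0 : ℤ) rfl (𝟙 A) ≫ y⟦(0 : ℤ)⟧' = ShiftedHom.mk₀ (0 : ℤ) rfl (x ≫ y) := by
    intro A x y
    simp only [ShiftedHom.mk₀, Category.id_comp, Category.assoc]
    exact congrArg _ ((shiftFunctorZero' C (0 : ℤ) rfl).inv.naturality y).symm
  refine ⟨{
    π := fun p => act T (P p)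
    e := act T (gradedE e r)
    g := fun k => act T (G k)
    π_mul_self := fun p => by
      change act T _ ∘ₗ act T _ = _
      rw [← act_mk₀_comp, Category.assoc, gι_proj]
    π_mul_of_ne := fun p q hpq => by
      change act T _ ∘ₗ act T _ = _
      rw [← act_mk₀_comp, Category.assoc, gι_proj_of_ne _ _ hpq.symm, comp_zero,
        ShiftedHom.mk₀_zero, act_zero]
    π_of_notMem := fun p hp => by
      change act T (ShiftedHom.mk₀ (0 : ℤ) rfl (V.gπ r p ≫ V.gι r p)) = 0
      rw [gι_of_notMem _ _ hp, comp_zero, ShiftedHom.mk₀_zero, act_zero]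
    sum_π := by
      rw [← act_sum]
      have : ∑ p ∈ Finset.Icc (-r : ℤ) r, P p = ShiftedHom.mk₀ (0 : ℤ) rfl (𝟙 (V.graded r).X) := by
        rw [← V.sum_gπ_gι r, ShiftedHom.mk₀, Preadditive.sum_comp]
        rfl
      rw [this]
      exact act_id T _ _
    e_mul_π := fun p => by
      change act T _ ∘ₗ act T _ = act T _ ∘ₗ act T _
      rw [← act_precomp, ← act_postcomp, gradedE_eq hV hφ he, matrix_comp_proj hV hφ he]
    g_mul_π := fun k => by
      change act T _ ∘ₗ act T _ = act T _ ∘ₗ act T _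
      rw [← act_precomp, ← act_postcomp]
      simp only [G, Category.assoc, ← Functor.map_comp, gι_proj]
      rw [← Category.assoc (V.gπ r k), ← Category.assoc (V.gπ r k ≫ V.gι r k), Category.assoc,
        Category.assoc, proj_gπ_assoc]
    g_mul_pow_mul_π := fun k => by
      rw [act_pow hV hφ he]
      change (act T _ ∘ₗ act T _) ∘ₗ act T _ = act T _
      rw [LinearMap.comp_assoc, ← act_precomp, Category.assoc,
        gι_conj_pow hV hφ he k (-k) k (by ring), ← act_comp _ _ _ (show -(k : ℤ) + k = 0 by ring),
        comp_shiftedHom_comp, shiftedHom_map_comp]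
      congr 1
      by_cases hk : (k : ℤ) ∈ Finset.Icc (-r : ℤ) r
      · simp only [G]
        have := reassoc_of% V.gι_gπ r hk
        rw [this, shiftedHom_comp_map, hb]
        exact hmk _ _
      · have hk' : -(k : ℤ) ∉ Finset.Icc (-r : ℤ) r := by rw [Finset.mem_Icc] at hk ⊢; lia
        simp only [P]
        rw [gπ_of_notMem _ _ hk', zero_comp, zero_comp, ShiftedHom.mk₀_zero]
    pow_mul_g_mul_π := fun k => by
      rw [act_pow hV hφ he]
      change (act T _ ∘ₗ act T _) ∘ₗ act T _ = act T _
      rw [LinearMap.comp_assoc, ← act_precomp, ← act_comp _ _ _ (show (k : ℤ) + -k = 0 by ring)]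
      congr 1
      have h1 : (V.gπ r k ≫ V.gι r k) ≫ G k = (V.gπ r k ≫ b k) ≫ (V.gι r (-k))⟦-(k : ℤ)⟧' := by
        simp only [G]
        rw [Category.assoc, proj_gπ_assoc, Category.assoc]
      rw [h1, shiftedHom_map_comp, gι_conj_pow hV hφ he k (-k) k (by ring),
        comp_shiftedHom_comp, shiftedHom_comp_map, hb']
      exact hmk _ _
  }, rfl, fun _ => rfl⟩

/-- `u` is `φ⁻¹ ψ` on `V_*`; it is shown to be the identity by applying the conjugation lemma to `n
= u - 1`, with `T = V_*` so that the action is faithful. -/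
theorem isPhiIII_unique {ψ : V.graded r ≅ V} (hψ : IsPhiIII e ψ) : ψ = φ := by
  obtain ⟨D, hDe, hDπ⟩ := exists_lefschetzData hV hφ he hL (V.graded r).X
  obtain ⟨hψg, hψ⟩ := hψ
  let u : (V.graded r).X ⟶ (V.graded r).X := ψ.hom.f ≫ φ.inv.f
  let U : Module.End ℚ (∀ m : ℤ, ShiftedHom (V.graded r).X (V.graded r).X m) := act (V.graded r).X (ShiftedHom.mk₀ (0 : ℤ) rfl u)
  have hU : U - 1 = 0 := by
    refine D.eq_zero_of_conj (e' := act (V.graded r).X (matrix e ψ)) ?_ ?_ ?_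
    · intro p q hpq
      have h1 : D.π q * U * D.π p = act (V.graded r).X (ShiftedHom.mk₀ (0 : ℤ) rfl
          (V.gπ r p ≫ (sec ψ p ≫ ret φ q) ≫ V.gι r q)) := by
        rw [hDπ, hDπ]
        change (act _ _ ∘ₗ act _ _) ∘ₗ act _ _ = _
        rw [← act_mk₀_comp, ← act_mk₀_comp]
        simp only [u, sec, ret, Category.assoc]
      rw [mul_sub, sub_mul, h1, mul_one]
      -- Goodness of both splittings puts identities on the diagonal; compatibility with the
      -- filtrations kills the entries that raise the degree.
      rcases hpq.eq_or_lt with rfl | hlt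
      · rw [D.π_mul_self, sub_eq_zero, hDπ]
        by_cases hp : p ∈ Finset.Icc (-r : ℤ) r
        · rw [sec_ret_of_isGood hφ hψg hp, Category.id_comp]
        · rw [gι_of_notMem _ _ hp, comp_zero, comp_zero]
      · have h2 : sec ψ p ≫ ret φ q = 0 := by
          rw [← Subobject.factorThru_arrow _ _ (factors_sec hψg p), Category.assoc,
            arrow_ret _ _ hlt, comp_zero]
        rw [D.π_mul_of_ne _ _ hlt.ne', sub_zero, h2, zero_comp, comp_zero, ShiftedHom.mk₀_zero,
          act_zero]
    · rw [add_sub_cancel, hDe, gradedE_eq hV hφ he]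
      change act _ _ ∘ₗ act _ _ = act _ _ ∘ₗ act _ _
      rw [← act_precomp, ← act_postcomp]
      congr 1
      simp only [matrix, u, Category.assoc, ← Functor.map_comp]
      congr 1
      have h1 := reassoc_of% inv_hom_f ψ
      have h2 := reassoc_of% inv_hom_f φ
      rw [h1, h2]
    · intro k
      have h1 := congrArg (act (V.graded r).X) (hψ k)
      rw [act_adPow, act_zero, act_homPart, ← hDe] at h1
      rw [← h1, LefschetzData.part]
      congr 1
      refine Finset.sum_congr rfl fun p _ => ?_
      rw [hDπ, hDπ]
      exact LinearMap.comp_assoc _ _ _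
  have h1 : act (V.graded r).X (ShiftedHom.mk₀ (0 : ℤ) rfl u) = act (V.graded r).X (ShiftedHom.mk₀ (0 : ℤ) rfl (𝟙 (V.graded r).X)) := by
    rw [act_id]
    exact sub_eq_zero.1 hU
  have h2 : u = 𝟙 (V.graded r).X := (ShiftedHom.homEquiv (0 : ℤ) rfl).injective (act_injective h1)
  refine Iso.ext (Hom.ext ?_)
  have h3 : u ≫ φ.hom.f = ψ.hom.f := by
    rw [Category.assoc, inv_hom_f, Category.comp_id]
  rw [← h3, h2, Category.id_comp]

end Adjoint

end FiltObj

/-! ### The splitting `ω_I`: removing the outer graded pieces. -/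

namespace FiltObj

lemma eq_of_isGood_zero {C : Type u} [Category.{v} C] [Abelian C] {V : FiltObj C}
    {φ ψ : V.graded 0 ≅ V} (hφ : IsGood φ) (hψ : IsGood ψ) : ψ = φ := by
  have h0 : ∀ p ∈ Finset.Icc (-(0 : ℕ) : ℤ) (0 : ℕ), p = 0 := by
    intro p hp
    rw [Finset.mem_Icc] at hp
    lia
  refine splitting_ext fun p hp => hφ.decomp.hom_ext_right fun q hq => ?_
  obtain rfl : p = q := (h0 p hp).trans (h0 q hq).symm
  exact (sec_ret_of_isGood hφ hψ hp).trans (sec_ret φ hp).symm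

lemma restrict_factors_iff {C : Type u} [Category.{v} C] [Abelian C] {W : FiltObj C} {K T : C} (ι : K ⟶ W.X) [Mono ι] (x : T ⟶ K) (p : ℤ) :
    ((W.restrict ι).F p).Factors x ↔ (W.F p).Factors (x ≫ ι) :=
  pullback_factors_iff _ _ _

lemma grπ_sec_bot {C : Type u} [Category.{v} C] [Abelian C] {V : FiltObj C} {r : ℕ}
    {φ : V.graded (r + 1) ≅ V} (hφ : IsGood φ) :
    V.grπ (-(r + 1 : ℕ)) ≫ sec φ (-(r + 1 : ℕ)) = (V.F (-(r + 1 : ℕ))).arrow := by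
  refine hφ.decomp.hom_ext_right fun q hq => ?_
  change (_ ≫ _) ≫ ret φ q = _ ≫ ret φ q
  rcases eq_or_ne q (-(r + 1 : ℕ)) with rfl | hne
  · rw [Category.assoc, sec_ret φ hq, Category.comp_id, arrow_ret_self hφ hq]
  · rw [Category.assoc, sec_ret_of_ne φ hne.symm, comp_zero, arrow_ret]
    rw [Finset.mem_Icc] at hq
    lia

namespace Unwrapping

variable {C : Type u} [Category.{v} C] [Abelian C] [HasShift C ℤ]
  {V : FiltObj C} {r : ℕ} {e : V ⟶ V.twist 2 1} {φ : V.graded (r + 1) ≅ V}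
  (D : Unwrapping (pow e (r + 1)) (-(r + 1 : ℕ)) (r + 1 : ℕ))

lemma bot_mem (r : ℕ) : (-((r + 1 : ℕ) : ℤ)) ∈ Finset.Icc (-(r + 1 : ℕ) : ℤ) (r + 1 : ℕ) := by
  rw [Finset.mem_Icc]; lia

lemma top_mem (r : ℕ) : ((r + 1 : ℕ) : ℤ) ∈ Finset.Icc (-(r + 1 : ℕ) : ℤ) (r + 1 : ℕ) := by
  rw [Finset.mem_Icc]; lia

lemma mem_succ {p : ℤ} (hp : p ∈ Finset.Icc (-r : ℤ) r) :
    p ∈ Finset.Icc (-(r + 1 : ℕ) : ℤ) (r + 1 : ℕ) := by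
  rw [Finset.mem_Icc] at hp ⊢; lia

/-- The first inclusion is determined by the filtration alone, so any good splitting computes it;
likewise for the last quotient. -/
lemma ia_eq (hφ : IsGood φ) : D.ia = sec φ (-(r + 1 : ℕ)) := by
  rw [← cancel_epi (V.grπ (-(r + 1 : ℕ))), D.grπ_ia, grπ_sec_bot hφ]

lemma pb_eq (hφ : IsGood φ) : D.pb = ret φ (r + 1 : ℕ) := by
  refine hφ.decomp.hom_ext_left fun p hp => ?_
  have h : (V.F (r + 1 : ℕ)).Factors (sec φ p) :=
    Subobject.factors_of_le _ (V.mono (Finset.mem_Icc.1 hp).2) (factors_sec hφ p)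
  change sec φ p ≫ D.pb = sec φ p ≫ ret φ _
  rw [← Subobject.factorThru_arrow _ _ h, Category.assoc, Category.assoc, D.arrow_pb,
    arrow_ret_self hφ (top_mem r)]

lemma grMap_laInv : Hom.grMap (pow e (r + 1)) _ _ D.h ≫ D.laInv = 𝟙 _ := by
  have := D.isIso
  exact IsIso.hom_inv_id _

lemma laInv_grMap : D.laInv ≫ Hom.grMap (pow e (r + 1)) _ _ D.h = 𝟙 _ := by
  have := D.isIso
  exact IsIso.inv_hom_id _

lemma nonempty_unwrapping (hφ : IsGood φ) (hL : HL e) :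
    Nonempty (Unwrapping (pow e (r + 1)) (-(r + 1 : ℕ)) (r + 1 : ℕ)) :=
  ⟨{ h := by ring
     isIso := hL (r + 1)
     ia := sec φ _
     grπ_ia := grπ_sec_bot hφ
     pb := ret φ _
     arrow_pb := arrow_ret_self hφ (top_mem r) }⟩

variable [∀ n : ℤ, (shiftFunctor C n).Additive]
  (hV : V.HasType (-(r + 1 : ℕ)) (r + 1 : ℕ)) (hφ : IsGood φ) (he : IsHomogeneous e φ)

include hV hφ he

/-- Homogeneity makes `l = e^{r+1}` carry `sec φ (-r-1)` to `sec φ (r+1)` through `l_a`, which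
`l_a⁻¹` cancels. -/
lemma sb_eq : D.sb = sec φ (r + 1 : ℕ) := by
  refine (shiftFunctor C ((r + 1 : ℕ) : ℤ)).map_injective ?_
  have h1 := sec_pow hV hφ he (r + 1) _ _ D.h
  have h2 := reassoc_of% D.laInv_grMap
  rw [sb, Functor.map_preimage, D.ia_eq hφ]
  exact (congrArg _ h1).trans (h2 _)

lemma comp_pb_laInv : (pow e (r + 1)).f ≫ D.pb⟦((r + 1 : ℕ) : ℤ)⟧' ≫ D.laInv =
    ret φ (-(r + 1 : ℕ)) := by
  have h1 := pow_ret hV hφ he (r + 1) _ _ D.h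
  rw [D.pb_eq hφ]
  refine (Category.assoc _ _ _).symm.trans ((congrArg (· ≫ D.laInv) h1).trans ?_)
  rw [Category.assoc, D.grMap_laInv, Category.comp_id]

/-- The correction term of `ρ` contains `sec φ (r+1) ≫ ret φ (-r-1) = 0`. Hence `Ker ρ` is the sum
of the inner `V_p`. -/
lemma ρ_eq : D.ρ = biprod.lift (ret φ (-(r + 1 : ℕ))) (ret φ (r + 1 : ℕ)) := by
  rw [ρ, D.comp_pb_laInv hV hφ he, D.pb_eq hφ, D.sb_eq hV hφ he, sec_ret_of_ne φ (by lia),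
    comp_zero, sub_zero]

lemma comp_ρ_eq_zero {T : C} {x : T ⟶ V.X} (h1 : x ≫ ret φ (-(r + 1 : ℕ)) = 0)
    (h2 : x ≫ ret φ (r + 1 : ℕ) = 0) : x ≫ D.ρ = 0 := by
  rw [D.ρ_eq hV hφ he]
  refine biprod.hom_ext _ _ ?_ ?_
  · rw [Category.assoc, biprod.lift_fst, h1, zero_comp]
  · rw [Category.assoc, biprod.lift_snd, h2, zero_comp]

lemma ι_ret_bot : kernel.ι D.ρ ≫ ret φ (-(r + 1 : ℕ)) = 0 := by
  have h : D.ρ ≫ biprod.fst = ret φ (-(r + 1 : ℕ)) := by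
    rw [D.ρ_eq hV hφ he, biprod.lift_fst]
  rw [← h, kernel.condition_assoc, zero_comp]

lemma ι_ret_top : kernel.ι D.ρ ≫ ret φ (r + 1 : ℕ) = 0 := by
  have h : D.ρ ≫ biprod.snd = ret φ (r + 1 : ℕ) := by
    rw [D.ρ_eq hV hφ he, biprod.lift_snd]
  rw [← h, kernel.condition_assoc, zero_comp]

lemma comp_sec_ρ {p : ℤ} (hp : p ∈ Finset.Icc (-r : ℤ) r) : sec φ p ≫ D.ρ = 0 := by
  rw [Finset.mem_Icc] at hp
  exact D.comp_ρ_eq_zero hV hφ he (sec_ret_of_ne φ (by lia)) (sec_ret_of_ne φ (by lia))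

/-- The component `V_p ⟶ Ker ρ` for `p ∈ [-r, r]`. -/
def kerSec (p : ℤ) : V.gr p ⟶ kernel D.ρ :=
  if hp : p ∈ Finset.Icc (-r : ℤ) r then kernel.lift D.ρ (sec φ p) (D.comp_sec_ρ hV hφ he hp) else 0

lemma kerSec_ι {p : ℤ} (hp : p ∈ Finset.Icc (-r : ℤ) r) :
    D.kerSec hV hφ he p ≫ kernel.ι D.ρ = sec φ p := by
  rw [kerSec, dif_pos hp, kernel.lift_ι]

lemma kerSec_of_notMem {p : ℤ} (hp : p ∉ Finset.Icc (-r : ℤ) r) : D.kerSec hV hφ he p = 0 :=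
  dif_neg hp

/-- The decomposition of `Ker ρ` induced by a splitting with respect to which `e` is
homogeneous. -/
abbrev kerDecomp : D.ker.Decomp r where
  A := V.gr
  s := D.kerSec hV hφ he
  t p := if p ∈ Finset.Icc (-r : ℤ) r then kernel.ι D.ρ ≫ ret φ p else 0
  s_t p hp := by
    rw [if_pos hp, ← Category.assoc, D.kerSec_ι hV hφ he hp, sec_ret φ (mem_succ hp)]
  s_t_of_ne p q h := by
    split_ifs with hq
    · by_cases hp : p ∈ Finset.Icc (-r : ℤ) r
      · rw [← Category.assoc, D.kerSec_ι hV hφ he hp, sec_ret_of_ne φ h]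
      · rw [D.kerSec_of_notMem hV hφ he hp, zero_comp]
    · rw [comp_zero]
  s_of_notMem p hp := D.kerSec_of_notMem hV hφ he hp
  t_of_notMem p hp := if_neg hp
  sum_t_s := by
    rw [← cancel_mono (kernel.ι D.ρ), Preadditive.sum_comp]
    have h1 : ∑ p ∈ Finset.Icc (-(r + 1 : ℕ) : ℤ) (r + 1 : ℕ), ret φ p ≫ sec φ p = 𝟙 V.X :=
      hφ.decomp.sum_t_s
    refine Eq.trans ?_ ((congrArg (kernel.ι D.ρ ≫ ·) h1).trans (Category.comp_id _) |>.trans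
      (Category.id_comp _).symm)
    rw [Preadditive.comp_sum, ← Finset.sum_subset (s₁ := Finset.Icc (-r : ℤ) r) (fun p hp => mem_succ hp)]
    · refine Finset.sum_congr rfl fun p hp => ?_
      rw [if_pos hp, Category.assoc, D.kerSec_ι hV hφ he hp, Category.assoc]
    · intro p hp hp'
      rw [Finset.mem_Icc] at hp hp'
      obtain rfl | rfl : p = -(r + 1 : ℕ) ∨ p = (r + 1 : ℕ) := by lia
      · rw [← Category.assoc, D.ι_ret_bot hV hφ he, zero_comp]
      · rw [← Category.assoc, D.ι_ret_top hV hφ he, zero_comp]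
  factors p := by
    by_cases hp : p ∈ Finset.Icc (-r : ℤ) r
    · exact (restrict_factors_iff _ _ _).2 (by
        rw [D.kerSec_ι hV hφ he hp]; exact factors_sec hφ p)
    · rw [D.kerSec_of_notMem hV hφ he hp]
      exact Subobject.factors_zero
  arrow_t p q h := by
    split_ifs
    · have h1 := (V.restrictι (kernel.ι D.ρ)).factors q
      rw [← Category.assoc]
      refine Eq.trans (congrArg (· ≫ ret φ p) (Subobject.factorThru_arrow _ _ h1).symm) ?_
      rw [Category.assoc, arrow_ret _ _ h, comp_zero]
    · rw [comp_zero]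

lemma kerDecomp_t {p : ℤ} (hp : p ∈ Finset.Icc (-r : ℤ) r) :
    (D.kerDecomp hV hφ he).t p = kernel.ι D.ρ ≫ ret φ p := if_pos hp

/-- The projection `V ⟶ Ker ρ`. -/
def kerRet : V.X ⟶ kernel D.ρ :=
  ∑ p ∈ Finset.Icc (-r : ℤ) r, ret φ p ≫ D.kerSec hV hφ he p

lemma sec_kerRet (p : ℤ) : sec φ p ≫ D.kerRet hV hφ he = D.kerSec hV hφ he p := by
  rw [kerRet, Preadditive.comp_sum]
  by_cases hp : p ∈ Finset.Icc (-r : ℤ) r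
  · rw [Finset.sum_eq_single_of_mem p hp, ← Category.assoc, sec_ret φ (mem_succ hp),
      Category.id_comp]
    intro q _ hq
    rw [← Category.assoc, sec_ret_of_ne φ hq.symm, zero_comp]
  · rw [D.kerSec_of_notMem hV hφ he hp]
    refine Finset.sum_eq_zero fun q hq => ?_
    rw [← Category.assoc, sec_ret_of_ne φ (by rintro rfl; exact hp hq), zero_comp]

lemma kerRet_t {p : ℤ} (hp : p ∈ Finset.Icc (-r : ℤ) r) :
    D.kerRet hV hφ he ≫ (D.kerDecomp hV hφ he).t p = ret φ p := by
  rw [kerRet, Preadditive.sum_comp, Finset.sum_eq_single_of_mem p hp, Category.assoc]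
  · exact (congrArg _ ((D.kerDecomp hV hφ he).s_t p hp)).trans (Category.comp_id _)
  · intro q _ hq
    rw [Category.assoc]
    exact (congrArg _ ((D.kerDecomp hV hφ he).s_t_of_ne q p hq)).trans comp_zero

lemma ι_kerRet : kernel.ι D.ρ ≫ D.kerRet hV hφ he = 𝟙 _ := by
  refine (D.kerDecomp hV hφ he).hom_ext_right fun p hp => ?_
  rw [Category.assoc, D.kerRet_t hV hφ he hp, Category.id_comp, D.kerDecomp_t hV hφ he hp]

lemma w_kerRet : D.w ≫ D.kerRet hV hφ he = biprod.snd ≫ biprod.fst := by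
  rw [w]
  refine biprod.hom_ext' _ _ ?_ (biprod.hom_ext' _ _ ?_ ?_)
  · rw [biprod.inl_desc_assoc, D.ia_eq hφ, sec_kerRet, kerSec_of_notMem _ _ _ _ (by simp)]
    simp
  · rw [biprod.inr_desc_assoc, biprod.inl_desc_assoc, ι_kerRet]
    simp
  · rw [biprod.inr_desc_assoc, biprod.inr_desc_assoc, D.sb_eq hV hφ he, sec_kerRet,
      kerSec_of_notMem _ _ _ _ (by simp)]
    simp

/-- Being epi is what makes the projection `t` in the definition of `ω_I` unique, so that it must be
`kerRet`. -/
lemma epi_w : Epi D.w := by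
  have h : biprod.lift (ret φ (-(r + 1 : ℕ)))
      (biprod.lift (D.kerRet hV hφ he) (ret φ (r + 1 : ℕ))) ≫ D.w = 𝟙 _ := by
    rw [w, biprod.lift_desc, biprod.lift_desc, D.ia_eq hφ, D.sb_eq hV hφ he]
    refine hφ.decomp.hom_ext_left fun p hp => ?_
    change sec φ p ≫ _ = sec φ p ≫ _
    simp only [Preadditive.comp_add, Category.comp_id]
    rw [← Category.assoc, ← Category.assoc, ← Category.assoc, sec_kerRet]
    by_cases hp' : p ∈ Finset.Icc (-r : ℤ) r
    · have hp2 := hp'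
      rw [Finset.mem_Icc] at hp2
      rw [sec_ret_of_ne φ (by lia), sec_ret_of_ne φ (by lia), D.kerSec_ι hV hφ he hp']
      simp
    · rw [D.kerSec_of_notMem hV hφ he hp', zero_comp]
      rw [Finset.mem_Icc] at hp hp'
      obtain rfl | rfl : p = -(r + 1 : ℕ) ∨ p = (r + 1 : ℕ) := by lia
      · rw [sec_ret φ (bot_mem r), sec_ret_of_ne φ (by lia)]
        simp
      · rw [sec_ret φ (top_mem r), sec_ret_of_ne φ (by lia)]
        simp
  exact (SplitEpi.mk _ h).epi

lemma arrow_kerRet_factors (p : ℤ) :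
    (D.ker.F p).Factors ((V.F p).arrow ≫ D.kerRet hV hφ he) := by
  rw [(D.kerDecomp hV hφ he).factors_iff]
  intro q hq hpq
  rw [Category.assoc, D.kerRet_t hV hφ he hq, arrow_ret _ _ hpq]

/-- The `Ker ρ`-component of `e`. -/
def kerE : D.ker ⟶ D.ker.twist 2 1 :=
  mkHom (V := D.ker) (W := D.ker) (n := 2) (m := 1)
    (kernel.ι D.ρ ≫ e.f ≫ (D.kerRet hV hφ he)⟦(1 : ℤ)⟧') (fun p => by
      have h1 := (V.restrictι (kernel.ι D.ρ)).factors p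
      have h2 := D.arrow_kerRet_factors hV hφ he (2 + p)
      refine ⟨(V.F p).factorThru _ h1 ≫ Hom.filMap e p (2 + p) rfl ≫
        ((D.ker.F (2 + p)).factorThru _ h2)⟦(1 : ℤ)⟧', ?_⟩
      rw [Category.assoc, Category.assoc, ← Functor.map_comp, Subobject.factorThru_arrow,
        Functor.map_comp, ← Category.assoc (Hom.filMap e p (2 + p) rfl), Hom.filMap_arrow,
        Category.assoc, Subobject.factorThru_arrow_assoc, Category.assoc]
      rfl)

lemma kerE_f : (D.kerE hV hφ he).f = kernel.ι D.ρ ≫ e.f ≫ (D.kerRet hV hφ he)⟦(1 : ℤ)⟧' := rfl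

/-- The bound `-r ≤ p` excludes the removed lower pieces, whose images under `e` can be nonzero in
`Ker ρ`. Above `r` both sides vanish. -/
lemma kerSec_kerE (p q : ℤ) (h : 2 + p = q) (hp : -(r : ℤ) ≤ p) :
    D.kerSec hV hφ he p ≫ (D.kerE hV hφ he).f =
      Hom.grMap e p q h ≫ (D.kerSec hV hφ he q)⟦(1 : ℤ)⟧' := by
  by_cases hp' : p ∈ Finset.Icc (-r : ℤ) r
  · rw [kerE_f, ← Category.assoc]
    erw [D.kerSec_ι hV hφ he hp']
    rw [← Category.assoc, sec_e hV hφ he p q h, Category.assoc, ← Functor.map_comp, sec_kerRet]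
  · rw [D.kerSec_of_notMem hV hφ he hp', D.kerSec_of_notMem hV hφ he (p := q)]
    · simp
    · rw [Finset.mem_Icc] at hp' ⊢
      lia

lemma kerSec_pow_kerE (k : ℕ) (p q : ℤ) (h : 2 * k + p = q) (hp : -(r : ℤ) ≤ p) :
    D.kerSec hV hφ he p ≫ (pow (D.kerE hV hφ he) k).f =
      Hom.grMap (pow e k) p q h ≫ (D.kerSec hV hφ he q)⟦(k : ℤ)⟧' := by
  induction k generalizing p with
  | zero =>
    obtain rfl : p = q := by simpa using h
    rw [grMap_pow_zero hV hφ p, pow_zero_f, ShiftedHom.mk₀, Category.id_comp]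
    exact (shiftFunctorZero' C ((0 : ℕ) : ℤ) rfl).inv.naturality (D.kerSec hV hφ he p)
  | succ k ih =>
    rw [grMap_pow_succ hV hφ he k p (2 + p) q rfl (by push_cast at h ⊢; lia), pow_succ_f']
    refine (comp_shiftedHom_comp _ _ _ _).symm.trans ?_
    rw [D.kerSec_kerE hV hφ he p (2 + p) rfl hp, shiftedHom_map_comp,
      ih (2 + p) (by push_cast at h ⊢; lia) (by lia), shiftedHom_comp_map]

/-- Up to the identifications `(Ker ρ)_p ≅ V_p`, the graded map of `e'^k` on position `-k` is that
of `e^k`; outside `[-r, r]` source and target are zero. -/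
lemma HL_kerE (hL : HL e) : HL (D.kerE hV hφ he) := by
  intro k
  rw [(D.kerDecomp hV hφ he).grMap_eq (D.kerDecomp hV hφ he)]
  by_cases hk : (k : ℤ) ∈ Finset.Icc (-r : ℤ) r
  · have hk' : (-k : ℤ) ∈ Finset.Icc (-r : ℤ) r := by rw [Finset.mem_Icc] at hk ⊢; lia
    have h1 : (D.kerDecomp hV hφ he).s (-k) ≫ (pow (D.kerE hV hφ he) k).f ≫
        ((D.kerDecomp hV hφ he).t k)⟦(k : ℤ)⟧' = Hom.grMap (pow e k) (-k) k (by ring) := by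
      rw [← Category.assoc]
      erw [D.kerSec_pow_kerE hV hφ he k (-k) k (by ring) (Finset.mem_Icc.1 hk').1]
      rw [Category.assoc, ← Functor.map_comp]
      refine (congrArg _ ((congrArg _ ((D.kerDecomp hV hφ he).s_t k hk)).trans
        (CategoryTheory.Functor.map_id _ _))).trans (Category.comp_id _)
    have h2 : IsIso ((D.kerDecomp hV hφ he).s (-k) ≫ (pow (D.kerE hV hφ he) k).f ≫
        ((D.kerDecomp hV hφ he).t k)⟦(k : ℤ)⟧') := by
      rw [h1]; exact hL k
    have h3 : IsIso ((D.kerDecomp hV hφ he).grHom (-k)) :=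
      ((D.kerDecomp hV hφ he).grIso hk').isIso_hom
    have h4 : IsIso ((D.kerDecomp hV hφ he).grInv k) :=
      ((D.kerDecomp hV hφ he).grIso hk).isIso_inv
    have h5 : IsIso (((D.kerDecomp hV hφ he).s (-k) ≫ (pow (D.kerE hV hφ he) k).f ≫
        ((D.kerDecomp hV hφ he).t k)⟦(k : ℤ)⟧') ≫
          ((D.kerDecomp hV hφ he).grInv k)⟦(k : ℤ)⟧') := inferInstance
    simp only [Category.assoc] at h5
    exact (isIso_comp_left_iff _ _).2 h5
  · have hk' : (-k : ℤ) ∉ Finset.Icc (-r : ℤ) r := by rw [Finset.mem_Icc] at hk ⊢; lia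
    exact isIso_of_source_target_iso_zero _
      ((D.kerDecomp hV hφ he).isZero_gr hk').isoZero
      ((shiftFunctor C (k : ℤ)).map_isZero ((D.kerDecomp hV hφ he).isZero_gr hk)).isoZero

lemma isHomogeneous_kerE :
    IsHomogeneous (D.kerE hV hφ he) (D.kerDecomp hV hφ he).splitting := by
  intro p q hpq
  have h1 : sec (D.kerDecomp hV hφ he).splitting p = _ :=
    (D.kerDecomp hV hφ he).gι_splitting_hom p
  have h2 : ret (D.kerDecomp hV hφ he).splitting q = _ :=
    (D.kerDecomp hV hφ he).splitting_inv_gπ q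
  have h3 : (D.kerDecomp hV hφ he).s p ≫ (D.kerE hV hφ he).f ≫
      ((D.kerDecomp hV hφ he).t q)⟦(1 : ℤ)⟧' = 0 := by
    by_cases hp : p ∈ Finset.Icc (-r : ℤ) r
    · rw [← Category.assoc]
      erw [D.kerSec_kerE hV hφ he p (2 + p) rfl (Finset.mem_Icc.1 hp).1]
      rw [Category.assoc, ← Functor.map_comp]
      refine (congrArg _ ((congrArg _ ((D.kerDecomp hV hφ he).s_t_of_ne _ _ (by lia))).trans
        (Functor.map_zero _ _ _))).trans comp_zero
    · rw [(D.kerDecomp hV hφ he).s_of_notMem p hp, zero_comp]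
  have h4 := reassoc_of% h3
  rw [h1, h2, Functor.map_comp, Category.assoc]
  refine (congrArg _ (h4 _)).trans ?_
  rw [zero_comp, comp_zero]

lemma gr_restrictι {p : ℤ} (hp : p ∈ Finset.Icc (-r : ℤ) r) :
    Hom.gr (V.restrictι (kernel.ι D.ρ)) p = (D.kerDecomp hV hφ he).grHom p := by
  rw [← cancel_epi (D.ker.grπ p), Decomp.grπ_grHom, D.kerDecomp_t hV hφ he hp]
  have h1 := (V.restrictι (kernel.ι D.ρ)).factors p
  have h2 : D.ker.grπ p ≫ Hom.gr (V.restrictι (kernel.ι D.ρ)) p =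
      (V.F p).factorThru _ h1 ≫ V.grπ p := cokernel.π_desc _ _ _
  rw [h2, ← arrow_ret_self hφ (mem_succ hp), Subobject.factorThru_arrow_assoc, Category.assoc]
  rfl

end Unwrapping

/-- The induction hypothesis applies to `Ker ρ` with the splitting inherited from `φ`; the outer
components agree by `ia_eq` and `sb_eq`, for any choice of unwrapping data. -/
theorem isOmegaI_iff {C : Type u} [Category.{v} C] [Abelian C] [HasShift C ℤ]
    [∀ n : ℤ, (shiftFunctor C n).Additive] (r : ℕ) {V : FiltObj C} {e : V ⟶ V.twist 2 1}
    {φ : V.graded r ≅ V} (hV : V.HasType (-r) r) (hφ : IsGood φ) (he : IsHomogeneous e φ)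
    (hL : HL e) (ψ : V.graded r ≅ V) : IsOmegaI r e ψ ↔ ψ = φ := by
  induction r generalizing V with
  | zero =>
    refine ⟨fun h => eq_of_isGood_zero hφ h, ?_⟩
    rintro rfl
    exact hφ
  | succ r ih =>
    have IH (D : Unwrapping (pow e (r + 1)) (-(r + 1 : ℕ)) (r + 1 : ℕ)) :=
      ih (D.kerDecomp hV hφ he).hasType (D.kerDecomp hV hφ he).isGood_splitting
        (D.isHomogeneous_kerE hV hφ he) (D.HL_kerE hV hφ he hL)
    have hcomp (D : Unwrapping (pow e (r + 1)) (-(r + 1 : ℕ)) (r + 1 : ℕ)) (p : ℤ)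
        (hp : p ∈ Finset.Icc (-r : ℤ) r) :
        D.ker.gι r p ≫ (D.kerDecomp hV hφ he).splitting.hom.f ≫ kernel.ι D.ρ =
          Hom.gr (V.restrictι (kernel.ι D.ρ)) p ≫ sec φ p := by
      rw [D.gr_restrictι hV hφ he hp, ← D.kerSec_ι hV hφ he hp, ← Category.assoc,
        ← Category.assoc]
      exact congrArg (· ≫ _) ((D.kerDecomp hV hφ he).gι_splitting_hom p)
    constructor
    · rintro ⟨D, t, e', χ, ht, he', hχ, ha, hb, hp⟩
      have := D.epi_w hV hφ he
      have ht' : t = D.kerRet hV hφ he := by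
        rw [← cancel_epi D.w, ht, D.w_kerRet hV hφ he]
      subst ht'
      obtain rfl : e' = D.kerE hV hφ he := Hom.ext he'
      rw [IH D] at hχ
      subst hχ
      refine splitting_ext fun p hpm => ?_
      by_cases hp' : p ∈ Finset.Icc (-r : ℤ) r
      · have h1 := (hp p hp').trans (hcomp D p hp')
        have : IsIso (Hom.gr (V.restrictι (kernel.ι D.ρ)) p) := by
          rw [D.gr_restrictι hV hφ he hp']
          exact ((D.kerDecomp hV hφ he).grIso hp').isIso_hom
        exact (cancel_epi _).1 h1
      · rw [Finset.mem_Icc] at hpm hp'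
        obtain rfl | rfl : p = -(r + 1 : ℕ) ∨ p = (r + 1 : ℕ) := by lia
        · exact ha.trans (D.ia_eq hφ)
        · exact hb.trans (D.sb_eq hV hφ he)
    · rintro rfl
      obtain ⟨D⟩ := Unwrapping.nonempty_unwrapping hφ hL
      refine ⟨D, D.kerRet hV hφ he, D.kerE hV hφ he, _, D.w_kerRet hV hφ he, rfl,
        (IH D _).2 rfl, (D.ia_eq hφ).symm, (D.sb_eq hV hφ he).symm, fun p hp => ?_⟩
      exact (hcomp D p hp).symm

end FiltObj

/-! ### Duality: transposed splittings and the second versions. -/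

namespace FiltObj

section OpDecomp

variable {C : Type u} [Category.{v} C] [Abelian C] {V : FiltObj C} {r : ℕ}
  {φ : V.graded r ≅ V} (hφ : IsGood φ)

lemma neg_mem_Icc {r : ℕ} {i : ℤ} : -i ∈ Finset.Icc (-r : ℤ) r ↔ i ∈ Finset.Icc (-r : ℤ) r := by
  rw [Finset.mem_Icc, Finset.mem_Icc]
  lia

lemma op_factors_ret (i : ℤ) : (V.op.F i).Factors (ret φ (-i)).op := by
  have h : (V.F (-i - 1)).arrow ≫ ret φ (-i) = 0 := arrow_ret _ _ (by lia)
  refine (Subobject.mk_factors_iff _ _).2 ⟨(cokernel.desc _ (ret φ (-i)) h).op, ?_⟩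
  exact congrArg Quiver.Hom.op (cokernel.π_desc _ _ h)

include hφ in
lemma sec_toQuot_of_lt {p q : ℤ} (h : p < q) : sec φ p ≫ V.toQuot q = 0 := by
  have h1 : (V.F (q - 1)).Factors (sec φ p) :=
    Subobject.factors_of_le _ (V.mono (by lia)) (factors_sec hφ p)
  rw [← Subobject.factorThru_arrow _ _ h1, Category.assoc, V.arrow_toQuot _ _ (by lia), comp_zero]

/-- The decomposition of `V^o` defined by a good splitting of `V`. -/
abbrev IsGood.opDecomp : V.op.Decomp r where
  A i := Opposite.op (V.gr (-i))
  s i := (ret φ (-i)).op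
  t i := (sec φ (-i)).op
  s_t i hi := by rw [← op_comp, sec_ret φ (neg_mem_Icc.2 hi), op_id]
  s_t_of_ne i j h := by rw [← op_comp, sec_ret_of_ne φ (by lia), op_zero]
  s_of_notMem i hi := by rw [ret_of_notMem (mt neg_mem_Icc.1 hi), op_zero]
  t_of_notMem i hi := by rw [sec_of_notMem (mt neg_mem_Icc.1 hi), op_zero]
  sum_t_s := by
    have h := congrArg Quiver.Hom.op hφ.decomp.sum_t_s
    rw [op_sum, op_id] at h
    rw [← h]
    refine Finset.sum_bij' (fun i _ => -i) (fun i _ => -i) (fun i hi => neg_mem_Icc.2 hi)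
      (fun i hi => neg_mem_Icc.2 hi) (fun i _ => neg_neg i) (fun i _ => neg_neg i)
      (fun i _ => op_comp.symm)
  factors := op_factors_ret
  arrow_t i j h := by
    rw [← opFIso_hom_toQuot, Category.assoc, ← op_comp, sec_toQuot_of_lt hφ (by lia), op_zero,
      comp_zero]

/-- The transposed decomposition induces the canonical identification `(V^o)_i ≅ (V_{-i})^o`, so its
splitting is exactly the dual of `φ`. -/
lemma opDecomp_grHom {i : ℤ} (hi : i ∈ Finset.Icc (-r : ℤ) r) :
    hφ.opDecomp.grHom i = (V.grOp i).hom := by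
  rw [← cancel_epi (V.op.grπ i), Decomp.grπ_grHom, grπ_grOp, ← opFIso_hom_toQuot, Category.assoc,
    ← op_comp, sec_toQuot hφ _ (neg_mem_Icc.2 hi)]

lemma isDual_splitting : IsDual φ hφ.opDecomp.splitting := fun i hi => by
  rw [Decomp.gι_splitting_hom, opDecomp_grHom hφ hi]
  rfl

/-- The dual splitting records all components of `φ⁻¹`, and these determine `φ`. -/
lemma IsDual.eq {φ ψ : V.graded r ≅ V} {χ : V.op.graded r ≅ V.op} (h : IsDual φ χ)
    (h' : IsDual ψ χ) : ψ = φ := by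
  suffices h1 : ψ.inv.f = φ.inv.f from (Iso.ext_inv (Hom.ext h1))
  have h2 (p : ℤ) (hp : p ∈ Finset.Icc (-r : ℤ) r) : ret ψ p = ret φ p := by
    obtain ⟨i, rfl⟩ : ∃ i, p = -i := ⟨-p, by simp⟩
    have h3 := (h' i (neg_mem_Icc.1 hp)).symm.trans (h i (neg_mem_Icc.1 hp))
    exact Quiver.Hom.op_inj ((cancel_epi _).1 h3)
  rw [← Category.comp_id ψ.inv.f, ← Category.comp_id φ.inv.f, ← V.sum_gπ_gι r,
    Preadditive.comp_sum, Preadditive.comp_sum]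
  refine Finset.sum_congr rfl fun p hp => ?_
  rw [← Category.assoc, ← Category.assoc]
  exact congrArg (· ≫ _) (h2 p hp)

end OpDecomp

section OpShift

variable {C : Type u} [Category.{v} C] [HasShift C ℤ]

lemma op_comp_opEquiv {X Y Z : C} {n : ℤ} (f : ShiftedHom X Y n) (z : Y ⟶ Z) :
    z.op ≫ ShiftedHom.opEquiv n f = ShiftedHom.opEquiv n (f ≫ z⟦n⟧' : ShiftedHom X Z n) :=
  ((Pretriangulated.opShiftFunctorEquivalence C n).symm.toAdjunction.homEquiv_naturality_left
    z.op f.op).symm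

lemma opEquiv_comp_op {X Y Z : C} {n : ℤ} (f : ShiftedHom Y Z n) (x : X ⟶ Y) :
    ShiftedHom.opEquiv n f ≫ x.op⟦n⟧' = ShiftedHom.opEquiv n (x ≫ f : ShiftedHom X Z n) :=
  ((Pretriangulated.opShiftFunctorEquivalence C n).symm.toAdjunction.homEquiv_naturality_right
    (X := Opposite.op Z) f.op x.op).symm

lemma opEquiv_eq {X Y : C} {n : ℤ} (f : ShiftedHom X Y n) : ShiftedHom.opEquiv n f =
    (Pretriangulated.opShiftFunctorEquivalence C n).counitIso.inv.app (Opposite.op Y) ≫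
      (shiftFunctor Cᵒᵖ n).map f.op := rfl

lemma isIso_opEquiv {X Y : C} {n : ℤ} (f : ShiftedHom X Y n) (hf : IsIso f) :
    IsIso (ShiftedHom.opEquiv n f) := by
  rw [opEquiv_eq]
  have : IsIso (Quiver.Hom.op f) := isIso_op f
  infer_instance

/-- A formal consequence of anti-multiplicativity: an equivalence reversing composition must
preserve the unit. -/
lemma opEquiv_mk₀_id (X : C) (n : ℤ) (hn : n = 0) :
    ShiftedHom.opEquiv n (ShiftedHom.mk₀ n hn (𝟙 X)) = ShiftedHom.mk₀ n hn (𝟙 (Opposite.op X)) := by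
  have h1 := ShiftedHom.opEquiv_symm_comp
    (ShiftedHom.opEquiv n (ShiftedHom.mk₀ n hn (𝟙 X))) (ShiftedHom.mk₀ n hn (𝟙 (Opposite.op X)))
    (show n + n = n by lia)
  rw [ShiftedHom.comp_mk₀_id, Equiv.symm_apply_apply, ShiftedHom.comp_mk₀_id] at h1
  rw [h1, Equiv.apply_symm_apply]

end OpShift

variable {C : Type u} [Category.{v} C] [Abelian C] [HasShift C ℤ]
  {V : FiltObj C} {r : ℕ} {e : V ⟶ V.twist 2 1} {φ : V.graded r ≅ V}

lemma opHom_f (e : V ⟶ V.twist 2 1) : (opHom e).f = ShiftedHom.opEquiv 1 e.f := rfl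

/-- Passing to the opposite reverses composition, hence the two forms of the recursion for the
iterates. -/
lemma pow_opHom_f (e : V ⟶ V.twist 2 1) (k : ℕ) :
    (pow (opHom e) k).f = ShiftedHom.opEquiv (k : ℤ) (pow e k).f := by
  induction k with
  | zero => exact (opEquiv_mk₀_id V.X _ rfl).symm
  | succ k ih =>
    rw [← Equiv.symm_apply_eq, pow_succ_f, pow_succ_f', ShiftedHom.opEquiv_symm_comp]
    congr 1
    · exact (Equiv.symm_apply_apply _ e.f)
    · rw [ih]
      exact Equiv.symm_apply_apply _ _

lemma ret_op_comp_opEquiv_comp {m : ℤ} (f : V.X ⟶ V.X⟦m⟧) (p q : ℤ) :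
    (ret φ q).op ≫ ShiftedHom.opEquiv m f ≫ ((sec φ p).op)⟦m⟧' =
      ShiftedHom.opEquiv m (sec φ p ≫ f ≫ (ret φ q)⟦m⟧') := by
  rw [opEquiv_comp_op, op_comp_opEquiv, Category.assoc]

variable [∀ n : ℤ, (shiftFunctor C n).Additive]

lemma opEquiv_zero {X Y : C} (n : ℤ) : ShiftedHom.opEquiv n (0 : X ⟶ Y⟦n⟧) = 0 := by
  rw [opEquiv_eq]
  erw [op_zero]
  rw [Functor.map_zero, comp_zero]

lemma isHomogeneous_opHom (hφ : IsGood φ) (he : IsHomogeneous e φ) :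
    IsHomogeneous (opHom e) hφ.opDecomp.splitting := by
  intro p q hpq
  have h1 : sec hφ.opDecomp.splitting p = _ := hφ.opDecomp.gι_splitting_hom p
  have h2 : ret hφ.opDecomp.splitting q = _ := hφ.opDecomp.splitting_inv_gπ q
  have h3 : (ret φ (-p)).op ≫ (opHom e).f ≫ ((sec φ (-q)).op)⟦(1 : ℤ)⟧' = 0 := by
    rw [opHom_f]
    refine (ret_op_comp_opEquiv_comp _ _ _).trans ?_
    rw [he _ _ (by lia), opEquiv_zero]
  have h4 := reassoc_of% h3
  rw [h1, h2, Functor.map_comp, Category.assoc]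
  refine (congrArg _ (h4 _)).trans ?_
  rw [zero_comp, comp_zero]

lemma HL_opHom (hV : V.HasType (-r) r) (hφ : IsGood φ) (hL : HL e) : HL (opHom e) := by
  intro k
  rw [hφ.opDecomp.grMap_eq hφ.opDecomp]
  by_cases hk : (k : ℤ) ∈ Finset.Icc (-r : ℤ) r
  · have hk' : (-k : ℤ) ∈ Finset.Icc (-r : ℤ) r := neg_mem_Icc.2 hk
    -- The target index arises as `- -k`; generalizing it avoids transporting along `neg_neg`.
    have h0 : ∀ b : ℤ, b = k → ∀ h, IsIso (Hom.grMap (pow e k) (-k) b h) := by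
      rintro _ rfl _
      exact hL k
    have h1 : (ret φ (- -(k : ℤ))).op ≫ (pow (opHom e) k).f ≫ ((sec φ (-(k : ℤ))).op)⟦(k : ℤ)⟧' =
        ShiftedHom.opEquiv (k : ℤ) (Hom.grMap (pow e k) (-k) (- -(k : ℤ)) (by ring)) := by
      rw [pow_opHom_f, grMap_eq_of_isGood hV hV hφ hφ]
      exact ret_op_comp_opEquiv_comp _ _ _
    have h2 : IsIso ((ret φ (- -(k : ℤ))).op ≫ (pow (opHom e) k).f ≫
        ((sec φ (-(k : ℤ))).op)⟦(k : ℤ)⟧') := by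
      rw [h1]
      exact isIso_opEquiv _ (h0 _ (neg_neg _) _)
    have h3 : IsIso (hφ.opDecomp.grHom (-k)) := (hφ.opDecomp.grIso hk').isIso_hom
    have h4 : IsIso (hφ.opDecomp.grInv k) := (hφ.opDecomp.grIso hk).isIso_inv
    have h5 : IsIso (((ret φ (- -(k : ℤ))).op ≫ (pow (opHom e) k).f ≫
        ((sec φ (-(k : ℤ))).op)⟦(k : ℤ)⟧') ≫ (hφ.opDecomp.grInv k)⟦(k : ℤ)⟧') := inferInstance
    simp only [Category.assoc] at h5
    exact (isIso_comp_left_iff _ _).2 h5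
  · have hk' : (-k : ℤ) ∉ Finset.Icc (-r : ℤ) r := mt neg_mem_Icc.1 hk
    exact isIso_of_source_target_iso_zero _ (hφ.opDecomp.isZero_gr hk').isoZero
      ((shiftFunctor Cᵒᵖ (k : ℤ)).map_isZero (hφ.opDecomp.isZero_gr hk)).isoZero

variable (hV : V.HasType (-r) r) (hφ : IsGood φ) (he : IsHomogeneous e φ) (hL : HL e)

include hV hφ he hL

theorem isOmegaII_iff (ψ : V.graded r ≅ V) : IsOmegaII e ψ ↔ ψ = φ := by
  have H := isOmegaI_iff r hφ.opDecomp.hasType hφ.opDecomp.isGood_splitting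
    (isHomogeneous_opHom hφ he) (HL_opHom hV hφ hL)
  constructor
  · rintro ⟨χ, hχ, h⟩
    rw [H] at hχ
    subst hχ
    exact (isDual_splitting hφ).eq h
  · rintro rfl
    exact ⟨_, (H _).2 rfl, isDual_splitting hφ⟩

theorem isPhiII_iff (ψ : V.graded r ≅ V) : IsPhiII e ψ ↔ ψ = φ := by
  have H := isPhiI_iff hφ.opDecomp.hasType hφ.opDecomp.isGood_splitting
    (isHomogeneous_opHom hφ he) (HL_opHom hV hφ hL)
  constructor
  · rintro ⟨χ, hχ, h⟩
    rw [H] at hχ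
    subst hχ
    exact (isDual_splitting hφ).eq h
  · rintro rfl
    exact ⟨_, (H _).2 rfl, isDual_splitting hφ⟩

end FiltObj

end

theorem proposition2p14 {C : Type u} [Category.{v} C] [Abelian C] [Linear ℚ C] [HasShift C ℤ]
    [∀ n : ℤ, (shiftFunctor C n).Additive] (r : ℕ) (V : FiltObj C) (hV : V.HasType (-r) r)
    (e : V ⟶ V.twist 2 1) (he : FiltObj.HL e)
    (φ : V.graded r ≅ V) (hφ : FiltObj.IsEGood e φ) :
    (∀ ψ : V.graded r ≅ V, FiltObj.IsEGood e ψ ↔ ψ = φ) ∧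
    (∀ ψ : V.graded r ≅ V, FiltObj.IsPhiIII e ψ ↔ ψ = φ) ∧
    (∀ ψ : V.graded r ≅ V, FiltObj.IsOmegaI r e ψ ↔ ψ = φ) ∧
    (∀ ψ : V.graded r ≅ V, FiltObj.IsOmegaII e ψ ↔ ψ = φ) ∧
    (∀ ψ : V.graded r ≅ V, FiltObj.IsPhiI e ψ ↔ ψ = φ) ∧
    (∀ ψ : V.graded r ≅ V, FiltObj.IsPhiII e ψ ↔ ψ = φ) := by
  have he' := hφ.isHomogeneous
  have hg := hφ.1
  -- An `e`-good splitting also satisfies the condition of `φ_III`, so its uniqueness is inherited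
  -- from that of `φ_III`.
  refine ⟨fun ψ => ⟨fun h => FiltObj.isPhiIII_unique hV hg he' he h.isPhiIII, ?_⟩,
    fun ψ => ⟨FiltObj.isPhiIII_unique hV hg he' he, ?_⟩,
    FiltObj.isOmegaI_iff r hV hg he' he, FiltObj.isOmegaII_iff hV hg he' he,
    FiltObj.isPhiI_iff hV hg he' he, FiltObj.isPhiII_iff hV hg he' he⟩
  · rintro rfl
    exact hφ
  · rintro rfl
    exact hφ.isPhiIII
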